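/- **Max-based strategies.** There are $N\ge 1$ experts. In each round, given the history of past rounds, the adversary picks a probability law $a$ on $[-1,1]^N$ and the player a law $p$ on $\{1,\dots,N\}$; losses $q\sim a$ and an expert $I\sim p$ are drawn independently given the history and revealed. The instantaneous regret is $r=q_I\mathbb 1-q$. The number $T$ of rounds is independent of the play and geometric with parameter $\delta\in(0,1)$; all statements below hold both for the law $P(T=k+1)=\delta(1-\delta)^k$, $k\ge 0$ (mean $1/\delta$) and for $P(T=k)=\delta(1-\delta)^k$, $k\ge0$. Put $$R(a,p)=\mathbb E\Big[\sum_{\tau\le T}(q_\tau)_{I_\tau}-\min_i\sum_{\tau\le T}(q_\tau)_i\Big].$$ A Markovian strategy depends only on the current regret $x+\sum_\tau r_\tau$, where $x\in\mathbb R^N$ is the initial regret. For a Markovian adversary $a$ and a Markovian player $p$, the value functions are $v_a(x)=\inf_{p'}\mathbb E\max_i(x_i+\sum_{\tau\le T}r_{\tau,i})$ and $v_p(x)=\sup_{a'}\mathbb E\max_i(x_i+\sum_{\tau\le T}r_{\tau,i})$, over all history-dependent strategies $p'$ and $a'$; likewise for $\min_pR(a,p)$ and $\max_aR(a,p)$ (as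 infimum and supremum). With $x_{(1)}\ge\dots\ge x_{(N)}$ the ordered coordinates of $x$, $\operatorname{erf}(y)=\frac2{\sqrt\pi}\int_0^ye^{-s^2}ds$, $\operatorname{erfc}=1-\operatorname{erf}$ and $f(z)=\sqrt{2/\pi}\,e^{-z^2/2}+z\operatorname{erf}(z/\sqrt2)$, let for $\kappa>0$, $t<0$ $$\psi(x,t)=\frac1N\sum_ix_i+\sqrt{-2\kappa t}\sum_{l=1}^{N-1}\frac{f(z_l)}{l(l+1)},\qquad z_l=\frac{\sum_{n=1}^lx_{(n)}-l\,x_{(l+1)}}{\sqrt{-2\kappa t}},\qquad \hat\psi(x)=e^\delta\int_{-\infty}^{-\delta}e^t\psi(x,t)\,dt .$$ Let $\hat u^m=\hat\psi-2\sqrt{\kappa\delta/\pi}\,\frac{N-1}N$ with $\kappa=\frac{2(1-\delta)}\delta$, and $\hat w^m=\hat\psi$ with $\kappa=\kappa_m$, where $\kappa_m=\frac{1-\delta}\delta\frac{N^2}{2(N-1)}$ for $N$ even and $\kappa_m=\frac{1-\delta}\delta\frac{N+1}2$ for $N$ odd. The max adversary $a^m$ plays each of $q^m$ and $-q^m$ with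 probability $\frac12$, where $q^m$ has entry $1$ at a largest component of the current regret (ties broken by any measurable rule) and $-1$ elsewhere. The max-based player is $p^m=\nabla\hat w^m$. Then there are error terms $E_{\hat u^m},E_{\hat w^m}\ge0$, depending only on $N$ and $\delta$ and at most $K\,N(1+\log\frac1\delta)$ with an absolute constant $K$, such that the following hold. 1. For every $\kappa>0$, $\psi$ is a classical solution of $\psi_t+\kappa\max_i\partial_{ii}\psi=0$ on $\mathbb R^N\times(-\infty,0)$, with $\psi(x,0)=\max_ix_i$ attained as a limit. 2. For all $N\ge1$ and $\delta\in(0,1)$, $\hat w^m$ is differentiable, $\nabla\hat w^m(x)$ is a probability vector for all $x$, and $$\hat u^m(x)-E_{\hat u^m}\le v_{a^m}(x),\qquad v_{p^m}(x)\le\hat w^m(x)+E_{\hat w^m}\qquad(x\in\mathbb R^N),$$ $$\frac{N-1}N\sqrt{\frac{2(1-\delta)}\delta}\,e^\delta\operatorname{erfc}(\sqrt\delta)-E_{\hat u^m}\le\min_pR(a^m,p),$$ $$\max_aR(a,p^m)\le\frac{N-1}N\sqrt{\kappa_m}\Big(e^\delta\operatorname{erfc}(\sqrt\delta)+\frac4{\sqrt\pi}\sqrt\delta\Big)+E_{\hat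 w^m}.$$ 3. For $N=2$ with $c=1$ and for $N=3$ with $c=\frac43$, the bounds match to leading order and are asymptotically optimal: as $\delta\to0^+$, each of $\hat u^m(0)$, $\hat w^m(0)$, the lower and the upper regret bound in 2 (with error terms), $\min_pR(a^m,p)$, $\max_aR(a,p^m)$ and the minimax regret $\inf_p\sup_aR(a,p)$ is asymptotically equivalent to $c\sqrt{\frac{1-\delta}{2\delta}}$. -/

import Mathlib

open MeasureTheory ProbabilityTheory Filter Topology Asymptotics

noncomputable section

/-! The game. -/

/-- The outcome of one round: the loss vector `q` and the expert `I` followed by the player. -/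
abbrev Round (N : ℕ) : Type := (Fin N → ℝ) × Fin N

/-- The instantaneous regret vector `r = q_I 𝟙 - q` of a round. -/
def instRegret {N : ℕ} (ω : Round N) : Fin N → ℝ := fun i => ω.1 ω.2 - ω.1 i

/-- The cumulative regret vector after the rounds `h`, started from `x`. -/
def cumRegret {N n : ℕ} (x : Fin N → ℝ) (h : Fin n → Round N) : Fin N → ℝ :=
  x + ∑ τ, instRegret (h τ)

theorem measurable_instRegret {N : ℕ} : Measurable (instRegret (N := N)) := by
  refine measurable_pi_lambda _ fun i => Measurable.sub ?_ ?_
  · exact measurable_from_prod_countable_left fun j => measurable_pi_apply j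
  · exact (measurable_pi_apply i).comp measurable_fst

theorem measurable_cumRegret {N n : ℕ} (x : Fin N → ℝ) :
    Measurable (cumRegret (n := n) x) :=
  (Finset.measurable_sum Finset.univ fun τ _ =>
    measurable_instRegret.comp (measurable_pi_apply τ)).const_add x

/-- Adversary strategies: in round `n` a law of the losses, depending measurably on the
history of the previous `n` rounds. -/
abbrev AdversaryRule (N : ℕ) : Type := ∀ n : ℕ, Kernel (Fin n → Round N) (Fin N → ℝ)

/-- Player strategies: in round `n` a law of the chosen expert, depending measurably on the
history of the previous `n` rounds. -/
abbrev PlayerRule (N : ℕ) : Type := ∀ n : ℕ, Kernel (Fin n → Round N) (Fin N)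

/-- The losses have a probability law on the cube `[-1,1]^N`. -/
def IsAdversary {N : ℕ} (a : AdversaryRule N) : Prop :=
  ∀ n, IsMarkovKernel (a n) ∧ ∀ h, ∀ᵐ q ∂(a n h), ∀ i, q i ∈ Set.Icc (-1 : ℝ) 1

/-- The chosen expert has a probability law. -/
def IsPlayer {N : ℕ} (p : PlayerRule N) : Prop := ∀ n, IsMarkovKernel (p n)

/-- The joint law of the first `n` rounds. In every round the losses and the chosen expert are
independent given the history. -/
def outcomeLaw {N : ℕ} (a : AdversaryRule N) (p : PlayerRule N) :
    ∀ n : ℕ, Measure (Fin n → Round N)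
  | 0 => Measure.dirac Fin.elim0
  | n + 1 => ((outcomeLaw a p n).compProd (Kernel.prod (a n) (p n))).map
      fun hω => (Fin.snoc hω.1 hω.2 : Fin (n + 1) → Round N)

/-- `𝔼 max_i (x_i + ∑_{τ ≤ T} r_{τ,i})` for a fixed number `T` of rounds. -/
def finalRegret {N : ℕ} (a : AdversaryRule N) (p : PlayerRule N) (x : Fin N → ℝ) (T : ℕ) : ℝ :=
  ∫ h, ⨆ i, cumRegret x h i ∂(outcomeLaw a p T)

/-- `R_T(p, a) = 𝔼 [∑_τ (q_τ)_{I_τ} - min_i ∑_τ (q_τ)_i]`. -/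
def fixedRegret {N : ℕ} (a : AdversaryRule N) (p : PlayerRule N) (T : ℕ) : ℝ :=
  ∫ h : Fin T → Round N, (∑ τ, (h τ).1 (h τ).2 - ⨅ i, ∑ τ, (h τ).1 i) ∂(outcomeLaw a p T)

/-- The mean of `F T` when `P(T = k + b) = δ (1 - δ) ^ k` for `k = 0, 1, 2, …`. For `b = 1` this is
the geometric law on `{1, 2, …}`, of mean `1 / δ`; for `b = 0` it is the geometric law on
`{0, 1, 2, …}`, which is the one that belongs to the recursion
`v(x) = δ max_i x_i + (1 - δ) min_p 𝔼 v(x + r)`. -/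
def geomMean (b : ℕ) (δ : ℝ) (F : ℕ → ℝ) : ℝ := ∑' k : ℕ, δ * (1 - δ) ^ k * F (k + b)

/-- The geometric stopping regret `R(a, p)`. -/
def regret {N : ℕ} (b : ℕ) (δ : ℝ) (a : AdversaryRule N) (p : PlayerRule N) : ℝ :=
  geomMean b δ (fixedRegret a p)

/-- A Markovian adversary, played from the initial regret `x`. -/
def markovAdversary {N : ℕ} (α : Kernel (Fin N → ℝ) (Fin N → ℝ)) (x : Fin N → ℝ) :
    AdversaryRule N := fun _ => α.comap (cumRegret x) (measurable_cumRegret x)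

/-- A Markovian player, played from the initial regret `x`. -/
def markovPlayer {N : ℕ} (π : Kernel (Fin N → ℝ) (Fin N)) (x : Fin N → ℝ) :
    PlayerRule N := fun _ => π.comap (cumRegret x) (measurable_cumRegret x)

/-- The value function `v_a` of a Markovian adversary: the player behaves optimally. -/
def adversaryValue {N : ℕ} (b : ℕ) (δ : ℝ) (α : Kernel (Fin N → ℝ) (Fin N → ℝ))
    (x : Fin N → ℝ) : ℝ :=
  ⨅ p : {p : PlayerRule N // IsPlayer p}, geomMean b δ (finalRegret (markovAdversary α x) p x)

/-- The value function `v_p` of a Markovian player: the adversary behaves optimally. -/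
def playerValue {N : ℕ} (b : ℕ) (δ : ℝ) (π : Kernel (Fin N → ℝ) (Fin N))
    (x : Fin N → ℝ) : ℝ :=
  ⨆ a : {a : AdversaryRule N // IsAdversary a}, geomMean b δ (finalRegret a (markovPlayer π x) x)

/-- `min_p R(a, p)` for a Markovian adversary. -/
def minRegret {N : ℕ} (b : ℕ) (δ : ℝ) (α : Kernel (Fin N → ℝ) (Fin N → ℝ)) : ℝ :=
  ⨅ p : {p : PlayerRule N // IsPlayer p}, regret b δ (markovAdversary α 0) p

/-- `max_a R(a, p)` for a Markovian player. -/
def maxRegret {N : ℕ} (b : ℕ) (δ : ℝ) (π : Kernel (Fin N → ℝ) (Fin N)) : ℝ :=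
  ⨆ a : {a : AdversaryRule N // IsAdversary a}, regret b δ a (markovPlayer π 0)

/-- The minimax regret `min_p max_a R(a, p)`. -/
def minimaxRegret (N b : ℕ) (δ : ℝ) : ℝ :=
  ⨅ p : {p : PlayerRule N // IsPlayer p}, ⨆ a : {a : AdversaryRule N // IsAdversary a},
    regret b δ (a : AdversaryRule N) (p : PlayerRule N)

/-! The max potential. -/

/-- The error function. -/
def erf (y : ℝ) : ℝ := 2 / √Real.pi * ∫ s in (0 : ℝ)..y, Real.exp (-s ^ 2)

/-- The complementary error function. -/
def erfc (y : ℝ) : ℝ := 1 - erf y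

/-- The profile `f`. -/
def profile (z : ℝ) : ℝ := √(2 / Real.pi) * Real.exp (-z ^ 2 / 2) + z * erf (z / √2)

/-- The coordinates of `x` in decreasing order: `ranked x n` is `x_(n+1)`. -/
def ranked {N : ℕ} (x : Fin N → ℝ) (n : ℕ) : ℝ :=
  if h : n < N then x (Tuple.sort (fun i => -x i) ⟨n, h⟩) else 0

/-- The argument `z_l = (x_(1) + ⋯ + x_(l) - l x_(l+1)) / √(-2κt)`. -/
def rankArg {N : ℕ} (κ : ℝ) (x : Fin N → ℝ) (t : ℝ) (l : ℕ) : ℝ :=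
  (∑ n ∈ Finset.range l, ranked x n - l * ranked x l) / √(-2 * κ * t)

/-- The max potential `ψ`, for `t < 0`. -/
def maxPotential (N : ℕ) (κ : ℝ) (x : Fin N → ℝ) (t : ℝ) : ℝ :=
  1 / (N : ℝ) * ∑ i, x i +
    √(-2 * κ * t) * ∑ l ∈ Finset.Ico 1 N, 1 / ((l : ℝ) * (l + 1)) * profile (rankArg κ x t l)

/-- The partial derivative `∂_i u`. -/
def partialDeriv {N : ℕ} (i : Fin N) (u : (Fin N → ℝ) → ℝ) (x : Fin N → ℝ) : ℝ :=
  fderiv ℝ u x (Pi.single i 1)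

/-- `u` is a classical solution of `u_t + κ max_i ∂_ii u = 0` on `ℝ^N × (-∞, 0)` with the final
condition `u(x, 0) = max_i x_i`, attained as a limit. -/
structure IsClassicalMaxSolution (N : ℕ) (κ : ℝ) (u : (Fin N → ℝ) → ℝ → ℝ) : Prop where
  contDiff_space : ∀ t < 0, ContDiff ℝ 2 fun x => u x t
  differentiable_time : ∀ x, ∀ t < 0, DifferentiableAt ℝ (u x) t
  continuous_time : ContinuousOn (fun y : (Fin N → ℝ) × ℝ => deriv (u y.1) y.2)
    (Set.univ ×ˢ Set.Iio 0)
  continuous_space : ∀ i, ContinuousOn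
    (fun y : (Fin N → ℝ) × ℝ => partialDeriv i (partialDeriv i fun x => u x y.2) y.1)
    (Set.univ ×ˢ Set.Iio 0)
  equation : ∀ x, ∀ t < 0,
    deriv (u x) t + κ * ⨆ i, partialDeriv i (partialDeriv i fun y => u y t) x = 0
  final : ∀ x, Tendsto (fun y : (Fin N → ℝ) × ℝ => u y.1 y.2) (𝓝 x ×ˢ 𝓝[<] 0) (𝓝 (⨆ i, x i))

/-- The Laplace transform `ψ̂(x) = e^δ ∫_{-∞}^{-δ} e^t ψ(x, t) dt`. -/
def maxTransform (N : ℕ) (δ κ : ℝ) (x : Fin N → ℝ) : ℝ :=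
  Real.exp δ * ∫ t in Set.Iic (-δ), Real.exp t * maxPotential N κ x t

/-- The diffusion factor of the lower bound. -/
def kappaLower (δ : ℝ) : ℝ := 2 * (1 - δ) / δ

/-- The diffusion factor `κ_m` of the upper bound. -/
def kappaUpper (N : ℕ) (δ : ℝ) : ℝ :=
  if Even N then (1 - δ) / δ * ((N : ℝ) ^ 2 / (2 * ((N : ℝ) - 1)))
  else (1 - δ) / δ * (((N : ℝ) + 1) / 2)

/-- The geometric lower bound potential `û^m = ψ̂ - C^ψ`. -/
def geomLowerPotential (N : ℕ) (δ : ℝ) (x : Fin N → ℝ) : ℝ :=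
  maxTransform N δ (kappaLower δ) x -
    2 * √(kappaLower δ * δ / Real.pi) * (((N : ℝ) - 1) / N)

/-- The geometric upper bound potential `ŵ^m = ψ̂`. -/
def geomUpperPotential (N : ℕ) (δ : ℝ) (x : Fin N → ℝ) : ℝ :=
  maxTransform N δ (kappaUpper N δ) x

/-- The explicit part of the lower regret bound. -/
def lowerRegretBound (N : ℕ) (δ : ℝ) : ℝ :=
  ((N : ℝ) - 1) / N * √(2 * (1 - δ) / δ) * (Real.exp δ * erfc √δ)

/-- The explicit part of the upper regret bound. -/
def upperRegretBound (N : ℕ) (δ : ℝ) : ℝ :=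
  ((N : ℝ) - 1) / N * √(kappaUpper N δ) * (Real.exp δ * erfc √δ + 4 / √Real.pi * √δ)

/-- The leading term `c √((1 - δ) / (2δ))`. -/
def leadingTerm (c δ : ℝ) : ℝ := c * √((1 - δ) / (2 * δ))

/-! The strategies. -/

/-- `s x` is the index of a largest component of `x` (with an arbitrary measurable way of
breaking ties). -/
structure IsArgmax {N : ℕ} (s : (Fin N → ℝ) → Fin N) : Prop where
  measurable : Measurable s
  le : ∀ (x : Fin N → ℝ) (j : Fin N), x j ≤ x (s x)

/-- The vector with entry `1` at `i` and all other entries `-1`. -/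
def maxVector {N : ℕ} (i : Fin N) : Fin N → ℝ := fun j => if j = i then 1 else -1

/-- The max adversary `a^m`: probability `1/2` on each of `q^m` and `-q^m`. -/
def maxAdversary {N : ℕ} (s : (Fin N → ℝ) → Fin N) (hs : IsArgmax s) :
    Kernel (Fin N → ℝ) (Fin N → ℝ) where
  toFun x := (2⁻¹ : ENNReal) • Measure.dirac (maxVector (s x)) +
    (2⁻¹ : ENNReal) • Measure.dirac (-maxVector (s x))
  measurable' := by
    have h : Measurable fun i : Fin N => (2⁻¹ : ENNReal) • Measure.dirac (maxVector i) +
      (2⁻¹ : ENNReal) • Measure.dirac (-maxVector i) := measurable_of_countable _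
    exact h.comp hs.measurable

/-- The max-based player `p^m`: expert `i` is followed with probability `∂_i ŵ^m(x)`. -/
def maxPlayer (N : ℕ) (δ : ℝ) : Kernel (Fin N → ℝ) (Fin N) where
  toFun x := ∑ i, ENNReal.ofReal (partialDeriv i (geomUpperPotential N δ) x) • Measure.dirac i
  measurable' := by
    refine Measure.measurable_of_measurable_coe _ fun S _ => ?_
    simp only [Measure.coe_finsetSum, Finset.sum_apply, Measure.smul_apply, smul_eq_mul]
    exact Finset.measurable_sum _ fun i _ =>
      (measurable_fderiv_apply_const ℝ _ _).ennreal_ofReal.mul_const _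

end

/-!
The potential has a representation without order statistics. Write
`H(x, y) = ∑ j, (x_j - y)₊` for the excess of `x` over the level `y`, and `F`, `ρ` for the
distribution function and the density of `|Z|`, with `Z` standard normal; the profile is an
antiderivative of `F`. Between two consecutive ranked coordinates, `H(x, ·)` is affine with slope
minus the number `n(y)` of coordinates above the level. Integrating level by level and summing by
parts therefore turns `∫ (F (H(x, y)) - 1_{y < b}) dy` into the weighted sum over ranks in the
definition of `ψ` (`integral_comp_excess`, `unitPotential_eq`). Differentiation under the integral
sign gives, at the time at which `√(-2κt) = 1`,

* `∂_i ψ = ∫_{y < x_i} ρ(H) dy ≥ 0` (`unitGrad`);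
* the second derivative in direction `v` as the integral over all levels of
  `H ρ(H) (n ∑ v_i² - (∑ v_i)²)`, with sums over the `n` coordinates above the level
  (`unitQuad`).

In particular `∂_ii ψ = ∫_{y < x_i} H ρ(H) (n - 1) dy` is largest for a leading coordinate, and the
maximum agrees with `-ψ_t / κ`, which is the differential equation
(`isClassicalMaxSolution_maxPotential`). For `q` in the cube, convexity bounds
`n ∑ q_i² - (∑ q_i)²` by its value at sign vectors, which is at most a constant times `n - 1`, the
constant being what `κ_m` encodes (`card_mul_sum_sq_sub_le`, `unitQuad_le`). For `q = ±q^m` it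
equals `4 (n - 1)` or `0`, according to whether the coordinate singled out by `q^m` lies above the
level (`unitQuad_maxVector`). The curvature is Lipschitz in `x`, so each step of the game costs a
third order error of order `1 / |t|`, and the Laplace transform in time turns this into
`log (1 / δ)` and turns `-ψ_t` into `ψ̂ - ψ(·, -δ)` (`maxTransform_add_le`,
`le_maxTransform_add_maxVector`).

The value bounds follow by verification. Against the player `∇ψ̂` the first order terms cancel,
whatever the adversary does; against the max adversary they cancel by symmetry, whatever the player
does. In both cases `ψ̂` satisfies the dynamic programming inequality
`(1 - δ) 𝔼 ψ̂(x + r) ≤ ψ̂(x) - δ max x + error`, or its reverse, which is summed along the play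
(`geomMean_finalRegret_le`, `le_geomMean_finalRegret`). Stopping one round later changes the mean by
at most `2`, which covers the other geometric law. For two and three experts `κ_m` agrees with the
diffusion factor of the lower bound, so both regret bounds have the same leading term, and all other
quantities lie between them.
-/

noncomputable section

/-! ### The half-normal law -/

/-- The density `√(2/π) e^{-h²/2}` of the absolute value of a standard normal variable. -/
def halfDens (h : ℝ) : ℝ := √(2 / Real.pi) * Real.exp (-h ^ 2 / 2)

/-- The distribution function of the half-normal law on `[0, ∞)`. -/
def halfCdf (h : ℝ) : ℝ := erf (h / √2)

theorem hasDerivAt_erf (y : ℝ) : HasDerivAt erf (2 / √Real.pi * Real.exp (-y ^ 2)) y := by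
  unfold erf
  refine HasDerivAt.const_mul _ ?_
  have hc : Continuous fun s : ℝ => Real.exp (-s ^ 2) := by fun_prop
  exact intervalIntegral.integral_hasDerivAt_right (hc.intervalIntegrable _ _)
    hc.stronglyMeasurable.stronglyMeasurableAtFilter hc.continuousAt

theorem hasDerivAt_halfCdf (h : ℝ) : HasDerivAt halfCdf (halfDens h) h := by
  have h1 := (hasDerivAt_erf (h / √2)).comp h ((hasDerivAt_id h).div_const (√2))
  refine h1.congr_deriv ?_
  have h2 : √2 ^ 2 = (2 : ℝ) := Real.sq_sqrt (by norm_num)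
  have h2' : √2 ≠ (0 : ℝ) := by positivity
  have h3 : √Real.pi ≠ 0 := by positivity
  unfold halfDens
  rw [div_pow, h2, Real.sqrt_div (by norm_num), neg_div]
  field_simp
  rw [h2]

theorem hasDerivAt_halfDens (h : ℝ) : HasDerivAt halfDens (-(h * halfDens h)) h := by
  unfold halfDens
  have h1 : HasDerivAt (fun h : ℝ => -h ^ 2 / 2) (-h) h := by
    refine (((hasDerivAt_id h).pow 2).neg.div_const 2).congr_deriv ?_
    simp
    ring
  refine (h1.exp.const_mul (√(2 / Real.pi))).congr_deriv ?_
  ring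

theorem hasDerivAt_profile (z : ℝ) : HasDerivAt profile (halfCdf z) z := by
  have h1 := (hasDerivAt_halfDens z).add ((hasDerivAt_id z).mul (hasDerivAt_halfCdf z))
  refine h1.congr_deriv ?_
  simp

theorem profile_eq (z : ℝ) : profile z = halfDens z + z * halfCdf z := rfl

theorem continuous_halfDens : Continuous halfDens := by unfold halfDens; fun_prop

theorem continuous_halfCdf : Continuous halfCdf :=
  continuous_iff_continuousAt.2 fun h => (hasDerivAt_halfCdf h).continuousAt

theorem halfDens_pos (h : ℝ) : 0 < halfDens h := by unfold halfDens; positivity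

theorem halfCdf_zero : halfCdf 0 = 0 := by simp [halfCdf, erf]

theorem halfDens_zero : halfDens 0 = √(2 / Real.pi) := by simp [halfDens]

theorem sqrt_two_div_pi_le_one : √(2 / Real.pi) ≤ 1 := by
  refine Real.sqrt_le_one.2 ((div_le_one Real.pi_pos).2 ?_)
  exact Real.two_le_pi

theorem halfDens_le (h : ℝ) : halfDens h ≤ 2 * Real.exp (-h) := by
  have h1 : Real.exp (-h ^ 2 / 2) ≤ Real.exp (1 / 2) * Real.exp (-h) := by
    rw [← Real.exp_add]
    exact Real.exp_le_exp.2 (by nlinarith [sq_nonneg (h - 1)])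
  have h2 : Real.exp (1 / 2) ≤ 2 := by
    have h3 : Real.exp (1 / 2) ^ 2 = Real.exp 1 := by rw [← Real.exp_nat_mul]; norm_num
    have := Real.exp_one_lt_d9
    nlinarith [Real.exp_pos (1 / 2)]
  calc halfDens h ≤ 1 * Real.exp (-h ^ 2 / 2) :=
        mul_le_mul_of_nonneg_right sqrt_two_div_pi_le_one (Real.exp_pos _).le
    _ ≤ Real.exp (1 / 2) * Real.exp (-h) := by rw [one_mul]; exact h1
    _ ≤ _ := mul_le_mul_of_nonneg_right h2 (Real.exp_pos _).le

theorem halfDens_le_exp_mul_exp (h : ℝ) :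
    halfDens h ≤ 8 * (Real.exp (-h) * Real.exp (-h)) := by
  have h1 : Real.exp (-h ^ 2 / 2) ≤ Real.exp 2 * (Real.exp (-h) * Real.exp (-h)) := by
    rw [← Real.exp_add, ← Real.exp_add]
    exact Real.exp_le_exp.2 (by nlinarith [sq_nonneg (h - 2)])
  have h3 : Real.exp 2 ≤ 8 := by
    have h3 : Real.exp 1 ^ 2 = Real.exp 2 := by rw [← Real.exp_nat_mul]; norm_num
    have := Real.exp_one_lt_d9
    nlinarith [Real.exp_pos 1]
  have h4 : halfDens h ≤ Real.exp (-h ^ 2 / 2) := by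
    have := mul_le_mul_of_nonneg_right sqrt_two_div_pi_le_one (Real.exp_pos (-h ^ 2 / 2)).le
    simpa [halfDens] using this
  refine (h4.trans h1).trans ?_
  gcongr

theorem mul_halfDens_le {h : ℝ} (hh : 0 ≤ h) : h * halfDens h ≤ 20 * Real.exp (-h) := by
  have h2 : h * Real.exp (-h) ≤ 1 := by
    rw [Real.exp_neg, ← div_eq_mul_inv, div_le_one (Real.exp_pos _)]
    linarith [Real.add_one_le_exp h]
  calc h * halfDens h ≤ h * (8 * (Real.exp (-h) * Real.exp (-h))) := by
        gcongr
        exact halfDens_le_exp_mul_exp h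
    _ = 8 * (h * Real.exp (-h)) * Real.exp (-h) := by ring
    _ ≤ 20 * 1 * Real.exp (-h) := by gcongr; norm_num
    _ = _ := by ring

theorem hasDerivAt_mul_halfDens (h : ℝ) :
    HasDerivAt (fun h => h * halfDens h) ((1 - h ^ 2) * halfDens h) h := by
  refine ((hasDerivAt_id h).mul (hasDerivAt_halfDens h)).congr_deriv ?_
  simp; ring

theorem abs_deriv_mul_halfDens_le {h : ℝ} (hh : 0 ≤ h) :
    |(1 - h ^ 2) * halfDens h| ≤ 20 * Real.exp (-h) := by
  have h2 : h ^ 2 * Real.exp (-h) ≤ 2 := by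
    rw [Real.exp_neg, ← div_eq_mul_inv, div_le_iff₀ (Real.exp_pos _)]
    have := Real.quadratic_le_exp_of_nonneg hh
    nlinarith
  rw [abs_mul, abs_of_pos (halfDens_pos h)]
  have h5 : |1 - h ^ 2| ≤ 1 + h ^ 2 := by
    rw [abs_le]; constructor <;> nlinarith [sq_nonneg h]
  have h6 : h ^ 2 * halfDens h ≤ 16 * Real.exp (-h) :=
    calc h ^ 2 * halfDens h ≤ h ^ 2 * (8 * (Real.exp (-h) * Real.exp (-h))) := by
          gcongr
          exact halfDens_le_exp_mul_exp h
      _ = 8 * (h ^ 2 * Real.exp (-h)) * Real.exp (-h) := by ring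
      _ ≤ 8 * 2 * Real.exp (-h) := by gcongr
      _ = _ := by ring
  have h7 := mul_le_mul_of_nonneg_right h5 (halfDens_pos h).le
  nlinarith [halfDens_le h, Real.exp_pos (-h)]

/-- A function whose derivative is dominated by `C e^{-h}` on `[0, ∞)` is Lipschitz on `[c, ∞)` with
constant `C e^{-c}`. The decay in `c` makes the Lipschitz bounds integrable over the levels. -/
theorem abs_sub_le_of_deriv_exp {g g' : ℝ → ℝ} {C : ℝ} (hg : ∀ h, HasDerivAt g (g' h) h)
    (hC : ∀ h, 0 ≤ h → |g' h| ≤ C * Real.exp (-h)) {c a b : ℝ} (hc : 0 ≤ c) (ha : c ≤ a)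
    (hb : c ≤ b) : |g a - g b| ≤ C * Real.exp (-c) * |a - b| := by
  have hC0 : 0 ≤ C := by
    have := hC 0 le_rfl
    simp at this
    exact (abs_nonneg _).trans this
  have := Convex.norm_image_sub_le_of_norm_hasDerivWithin_le (f := g) (f' := g')
    (s := Set.Ici c) (x := b) (y := a) (C := C * Real.exp (-c))
    (fun x _ => (hg x).hasDerivWithinAt) (fun x hx => ?_) (convex_Ici c) hb ha
  · simpa using this
  · refine (hC x (hc.trans hx)).trans ?_
    gcongr
    exact hx

theorem abs_halfCdf_sub_le {c a b : ℝ} (hc : 0 ≤ c) (ha : c ≤ a) (hb : c ≤ b) :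
    |halfCdf a - halfCdf b| ≤ 2 * Real.exp (-c) * |a - b| :=
  abs_sub_le_of_deriv_exp hasDerivAt_halfCdf
    (fun h _ => by rw [abs_of_pos (halfDens_pos h)]; exact halfDens_le h) hc ha hb

theorem abs_halfDens_sub_le {c a b : ℝ} (hc : 0 ≤ c) (ha : c ≤ a) (hb : c ≤ b) :
    |halfDens a - halfDens b| ≤ 20 * Real.exp (-c) * |a - b| :=
  abs_sub_le_of_deriv_exp hasDerivAt_halfDens
    (fun h hh => by
      rw [abs_neg, abs_of_nonneg (mul_nonneg hh (halfDens_pos h).le)]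
      exact mul_halfDens_le hh) hc ha hb

theorem abs_mul_halfDens_sub_le {c a b : ℝ} (hc : 0 ≤ c) (ha : c ≤ a) (hb : c ≤ b) :
    |a * halfDens a - b * halfDens b| ≤ 20 * Real.exp (-c) * |a - b| :=
  abs_sub_le_of_deriv_exp hasDerivAt_mul_halfDens
    (fun _ hh => abs_deriv_mul_halfDens_le hh) hc ha hb

theorem tendsto_halfDens : Tendsto halfDens atTop (𝓝 0) := by
  refine squeeze_zero (fun h => (halfDens_pos h).le) halfDens_le ?_
  simpa using Real.tendsto_exp_neg_atTop_nhds_zero.const_mul 2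

theorem tendsto_erf : Tendsto erf atTop (𝓝 1) := by
  have h1 : IntegrableOn (fun s : ℝ => Real.exp (-s ^ 2)) (Set.Ioi 0) := by
    simpa using (integrable_exp_neg_mul_sq (b := 1) one_pos).integrableOn
  have h2 := intervalIntegral_tendsto_integral_Ioi 0 h1 tendsto_id
  have h3 := integral_gaussian_Ioi 1
  simp only [neg_mul, one_mul, div_one] at h3
  rw [h3] at h2
  have h4 := h2.const_mul (2 / √Real.pi)
  have h5 : 2 / √Real.pi * (√Real.pi / 2) = 1 := by
    have : √Real.pi ≠ 0 := by positivity
    field_simp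
  rw [h5] at h4
  exact h4

theorem tendsto_halfCdf : Tendsto halfCdf atTop (𝓝 1) :=
  tendsto_erf.comp (tendsto_id.atTop_div_const (by positivity))

theorem halfCdf_strictMono : StrictMono halfCdf :=
  strictMono_of_hasDerivAt_pos hasDerivAt_halfCdf halfDens_pos

theorem halfCdf_le_one (h : ℝ) : halfCdf h ≤ 1 :=
  halfCdf_strictMono.monotone.ge_of_tendsto tendsto_halfCdf h

theorem one_sub_halfCdf_le (h : ℝ) : 1 - halfCdf h ≤ 2 * Real.exp (-h) := by
  have hanti : Antitone fun s => halfCdf s + 2 * Real.exp (-s) :=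
    antitone_of_hasDerivAt_nonpos (f' := fun s => halfDens s + 2 * (Real.exp (-s) * -1))
      (fun s => (hasDerivAt_halfCdf s).add (((hasDerivAt_neg s).exp).const_mul 2))
      (fun s => by simp only [Pi.zero_apply]; linarith [halfDens_le s])
  have hlim : Tendsto (fun s => halfCdf s + 2 * Real.exp (-s)) atTop (𝓝 (1 + 2 * 0)) :=
    tendsto_halfCdf.add (Real.tendsto_exp_neg_atTop_nhds_zero.const_mul 2)
  have := hanti.le_of_tendsto hlim h
  linarith

theorem profile_zero : profile 0 = √(2 / Real.pi) := by simp [profile]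

theorem profile_le {z : ℝ} (hz : 0 ≤ z) : profile z ≤ z + √(2 / Real.pi) := by
  rw [profile_eq]
  have h1 : halfDens z ≤ √(2 / Real.pi) := by
    unfold halfDens
    refine mul_le_of_le_one_right (Real.sqrt_nonneg _) (Real.exp_le_one_iff.2 ?_)
    nlinarith [sq_nonneg z]
  nlinarith [halfCdf_le_one z]

/-- The Mills ratio bound `z (1 - halfCdf z) ≤ halfDens z`: the difference of the two sides is
nonincreasing and nonnegative at infinity. -/
theorem mul_one_sub_halfCdf_le (z : ℝ) : z * (1 - halfCdf z) ≤ halfDens z := by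
  have hanti : AntitoneOn (fun s => halfDens s + z * halfCdf s) (Set.Ici z) := by
    refine antitoneOn_of_hasDerivWithinAt_nonpos (convex_Ici z)
      (f' := fun s => -(s * halfDens s) + z * halfDens s)
      (by have := continuous_halfDens; have := continuous_halfCdf; fun_prop) ?_ ?_
    · intro s _
      exact ((hasDerivAt_halfDens s).add ((hasDerivAt_halfCdf s).const_mul z)).hasDerivWithinAt
    · intro s hs
      rw [interior_Ici] at hs
      nlinarith [halfDens_pos s, hs.out]
  have hlim : Tendsto (fun s => halfDens s + z * halfCdf s) atTop (𝓝 (0 + z * 1)) :=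
    tendsto_halfDens.add (tendsto_halfCdf.const_mul z)
  have := le_of_tendsto hlim
    ((eventually_ge_atTop z).mono fun s hs => hanti Set.self_mem_Ici hs hs)
  linarith

theorem le_profile (z : ℝ) : z ≤ profile z := by
  rw [profile_eq]
  linarith [mul_one_sub_halfCdf_le z]

theorem tendsto_profile_sub : Tendsto (fun z => profile z - z) atTop (𝓝 0) := by
  refine squeeze_zero' (Eventually.of_forall fun z => sub_nonneg.2 (le_profile z))
    ((eventually_ge_atTop 0).mono fun z hz => ?_) tendsto_halfDens
  rw [profile_eq]
  nlinarith [halfCdf_le_one z]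

/-! ### The excess of a vector over a level -/

variable {N : ℕ}

/-- The total amount `∑ j, (x_j - y)₊` by which the coordinates of `x` exceed the level `y`. -/
def excess (x : Fin N → ℝ) (y : ℝ) : ℝ := ∑ j, max (x j - y) 0

/-- The coordinates of `x` above the level `y`. -/
def above (x : Fin N → ℝ) (y : ℝ) : Finset (Fin N) := Finset.univ.filter fun j => y < x j

theorem mem_above {x : Fin N → ℝ} {y : ℝ} {j : Fin N} : j ∈ above x y ↔ y < x j := by
  simp [above]

theorem continuous_excess : Continuous fun p : (Fin N → ℝ) × ℝ => excess p.1 p.2 := by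
  unfold excess; fun_prop

theorem continuous_excess_right (x : Fin N → ℝ) : Continuous (excess x) := by
  unfold excess; fun_prop

theorem excess_nonneg (x : Fin N → ℝ) (y : ℝ) : 0 ≤ excess x y :=
  Finset.sum_nonneg fun _ _ => le_max_right _ _

theorem sub_le_excess (x : Fin N → ℝ) (y : ℝ) (k : Fin N) : x k - y ≤ excess x y :=
  (le_max_left _ _).trans
    (Finset.single_le_sum (f := fun j => max (x j - y) 0) (fun _ _ => le_max_right _ _)
      (Finset.mem_univ k))

theorem excess_eq_zero {x : Fin N → ℝ} {y : ℝ} (h : ∀ j, x j ≤ y) : excess x y = 0 :=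
  Finset.sum_eq_zero fun j _ => max_eq_right (by linarith [h j])

theorem excess_eq_sum_above (x : Fin N → ℝ) (y : ℝ) :
    excess x y = ∑ j ∈ above x y, (x j - y) := by
  rw [excess, above, Finset.sum_filter]
  refine Finset.sum_congr rfl fun j _ => ?_
  split_ifs with h
  · exact max_eq_left (by linarith)
  · exact max_eq_right (by linarith)

theorem abs_excess_sub_le (x x' : Fin N → ℝ) (y : ℝ) :
    |excess x y - excess x' y| ≤ N * ‖x - x'‖ := by
  unfold excess
  rw [← Finset.sum_sub_distrib]
  refine (Finset.abs_sum_le_sum_abs _ _).trans ?_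
  refine (Finset.sum_le_card_nsmul _ _ ‖x - x'‖ fun j _ => ?_).trans (by simp)
  refine (abs_max_sub_max_le_abs _ _ _).trans ?_
  rw [sub_sub_sub_cancel_right]
  exact norm_le_pi_norm (x - x') j

/-- Away from the coordinates of `x`, the set `above x y` is locally constant. -/
theorem eventually_above_eq {x : Fin N → ℝ} {y : ℝ} (h : ∀ j, x j ≠ y) :
    ∀ᶠ p : (Fin N → ℝ) × ℝ in 𝓝 (x, y), above p.1 p.2 = above x y := by
  have h1 : ∀ j, ∀ᶠ p : (Fin N → ℝ) × ℝ in 𝓝 (x, y), (p.2 < p.1 j ↔ y < x j) := by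
    intro j
    have hc : ContinuousAt (fun p : (Fin N → ℝ) × ℝ => p.1 j - p.2) (x, y) := by fun_prop
    rcases lt_or_gt_of_ne (h j) with hj | hj
    · filter_upwards [hc.eventually_lt continuousAt_const (by simpa using hj : x j - y < 0)]
        with p hp
      exact ⟨fun h => by linarith, fun h => by linarith⟩
    · filter_upwards [continuousAt_const.eventually_lt hc (by simpa using hj : 0 < x j - y)]
        with p hp
      exact ⟨fun h => by linarith, fun h => by linarith⟩
  filter_upwards [eventually_all.2 h1] with p hp
  ext j
  simp [above, hp j]

theorem hasFDerivAt_excess {x : Fin N → ℝ} {y : ℝ} (h : ∀ j, x j ≠ y) :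
    HasFDerivAt (fun x => excess x y)
      (∑ j ∈ above x y, ContinuousLinearMap.proj (R := ℝ) (φ := fun _ : Fin N => ℝ) j) x := by
  have h1 : (fun x' => excess x' y) =ᶠ[𝓝 x] fun x' => ∑ j ∈ above x y, (x' j - y) := by
    have : Tendsto (fun x' : Fin N → ℝ => (x', y)) (𝓝 x) (𝓝 (x, y)) :=
      (by fun_prop : Continuous fun x' : Fin N → ℝ => (x', y)).tendsto x
    filter_upwards [this.eventually (eventually_above_eq h)] with x' hx'
    rw [excess_eq_sum_above, hx']
  refine HasFDerivAt.congr_of_eventuallyEq ?_ h1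
  refine HasFDerivAt.fun_sum fun j _ => ?_
  exact (ContinuousLinearMap.proj (R := ℝ) (φ := fun _ : Fin N => ℝ) j).hasFDerivAt.sub_const y

theorem hasDerivAt_excess {x : Fin N → ℝ} {y : ℝ} (h : ∀ j, x j ≠ y) :
    HasDerivAt (excess x) (-((above x y).card : ℝ)) y := by
  have h1 : excess x =ᶠ[𝓝 y] fun y' => ∑ j ∈ above x y, (x j - y') := by
    have : Tendsto (fun y' : ℝ => (x, y')) (𝓝 y) (𝓝 (x, y)) :=
      (by fun_prop : Continuous fun y' : ℝ => (x, y')).tendsto y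
    filter_upwards [this.eventually (eventually_above_eq h)] with x' hx'
    rw [excess_eq_sum_above, hx']
  refine HasDerivAt.congr_of_eventuallyEq ?_ h1
  refine (HasDerivAt.fun_sum fun j _ => (hasDerivAt_id y).const_sub (x j)).congr_deriv ?_
  simp

/-! ### Ranked coordinates -/

/-- The ranked coordinates can be read off from any permutation that sorts `x`, whatever it does
with ties. -/
theorem ranked_eq {x : Fin N → ℝ} {σ : Equiv.Perm (Fin N)} (hσ : Antitone (x ∘ σ)) {n : ℕ}
    (hn : n < N) : ranked x n = x (σ ⟨n, hn⟩) := by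
  have h1 : Monotone ((fun i => -x i) ∘ σ) := fun i j hij => neg_le_neg (hσ hij)
  have h2 := Tuple.unique_monotone (Tuple.monotone_sort fun i => -x i) h1
  have h3 := congrFun h2 ⟨n, hn⟩
  simp only [Function.comp_apply, neg_inj] at h3
  rw [ranked, dif_pos hn, h3]

theorem antitone_comp_sort (x : Fin N → ℝ) :
    Antitone (x ∘ Tuple.sort fun i => -x i) := fun _ _ hij =>
  neg_le_neg_iff.1 (Tuple.monotone_sort (fun i => -x i) hij)

theorem ranked_anti (x : Fin N → ℝ) {m n : ℕ} (hmn : m ≤ n) (hn : n < N) :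
    ranked x n ≤ ranked x m := by
  rw [ranked, ranked, dif_pos hn, dif_pos (hmn.trans_lt hn)]
  exact antitone_comp_sort x (show (⟨m, _⟩ : Fin N) ≤ ⟨n, hn⟩ from hmn)

theorem sum_ranked (x : Fin N → ℝ) (g : ℝ → ℝ) :
    ∑ n ∈ Finset.range N, g (ranked x n) = ∑ i, g (x i) := by
  rw [Finset.sum_range, ← Equiv.sum_comp (Tuple.sort fun i => -x i) (fun i => g (x i))]
  refine Finset.sum_congr rfl fun i _ => ?_
  rw [ranked, dif_pos i.2]

theorem exists_ranked_eq (x : Fin N → ℝ) (j : Fin N) : ∃ n < N, ranked x n = x j := by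
  refine ⟨(Tuple.sort fun i => -x i).symm j, Fin.is_lt _, ?_⟩
  rw [ranked, dif_pos (Fin.is_lt _)]
  simp

theorem le_ranked_zero (x : Fin N → ℝ) (j : Fin N) : x j ≤ ranked x 0 := by
  obtain ⟨n, hn, h⟩ := exists_ranked_eq x j
  rw [← h]
  exact ranked_anti x (Nat.zero_le n) hn

theorem ranked_last_le (x : Fin N → ℝ) (j : Fin N) : ranked x (N - 1) ≤ x j := by
  obtain ⟨n, hn, h⟩ := exists_ranked_eq x j
  rw [← h]
  exact ranked_anti x (by omega) (by omega)

theorem exists_eq_ranked (x : Fin N → ℝ) {n : ℕ} (hn : n < N) : ∃ j, x j = ranked x n :=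
  ⟨_, by rw [ranked, dif_pos hn]⟩

theorem ranked_zero (hN : 0 < N) (x : Fin N → ℝ) : ranked x 0 = ⨆ i, x i := by
  have : Nonempty (Fin N) := ⟨⟨0, hN⟩⟩
  obtain ⟨j, hj⟩ := exists_eq_ranked x hN
  refine le_antisymm ?_ (ciSup_le fun i => le_ranked_zero x i)
  rw [← hj]
  exact le_ciSup (Set.finite_range x).bddAbove j

/-- The numerator `x_(1) + ⋯ + x_(l) - l x_(l+1)` of `z_l`: the excess of `x` over `x_(l+1)`. -/
def rankGap (x : Fin N → ℝ) (l : ℕ) : ℝ := ∑ n ∈ Finset.range l, ranked x n - l * ranked x l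

/-- The weighted sum `∑ l, Φ (Z_l) / (l (l + 1))` over the rank gaps `Z_l`. -/
def rankSum (Φ : ℝ → ℝ) (x : Fin N → ℝ) : ℝ :=
  ∑ l ∈ Finset.Ico 1 N, 1 / ((l : ℝ) * (l + 1)) * Φ (rankGap x l)

theorem excess_eq_ranked (x : Fin N → ℝ) {m : ℕ} (hm : m ≤ N) {y : ℝ}
    (h1 : ∀ n < m, y ≤ ranked x n) (h2 : ∀ n, m ≤ n → n < N → ranked x n ≤ y) :
    excess x y = ∑ n ∈ Finset.range m, ranked x n - m * y := by
  rw [excess, ← sum_ranked x (fun u => max (u - y) 0),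
    ← Finset.sum_subset (Finset.range_subset_range.2 hm)]
  · rw [Finset.sum_congr rfl fun n hn => max_eq_left (sub_nonneg.2 (h1 n (Finset.mem_range.1 hn)))]
    simp
  · intro n hn hn'
    rw [Finset.mem_range] at hn hn'
    exact max_eq_right (by linarith [h2 n (by omega) hn])

theorem rankGap_eq_excess (x : Fin N → ℝ) {l : ℕ} (hl : l < N) :
    rankGap x l = excess x (ranked x l) :=
  (excess_eq_ranked x hl.le (fun _ hn => ranked_anti x hn.le hl)
    fun _ hn hn' => ranked_anti x hn hn').symm

theorem rankGap_nonneg (x : Fin N → ℝ) {l : ℕ} (hl : l < N) : 0 ≤ rankGap x l := by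
  rw [rankGap_eq_excess x hl]; exact excess_nonneg _ _

/-- The excess is affine in the level between consecutive ranked coordinates, so the integral of
`φ ∘ excess` is a sum of increments of an antiderivative; summation by parts gives the weights
`1 / (l (l + 1))`. -/
theorem intervalIntegral_comp_excess {φ Φ : ℝ → ℝ} (hΦ : ∀ h, HasDerivAt Φ (φ h) h)
    (hφ : Continuous φ) (x : Fin N → ℝ) {m : ℕ} (hm : m < N) :
    ∫ y in ranked x m..ranked x 0, φ (excess x y) =
      ∑ l ∈ Finset.Ico 1 (m + 1), 1 / ((l : ℝ) * (l + 1)) * Φ (rankGap x l) - Φ 0 +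
        Φ (rankGap x m) / (m + 1) := by
  have hint : ∀ a b, IntervalIntegrable (fun y => φ (excess x y)) volume a b := fun a b =>
    (hφ.comp (continuous_excess_right x)).intervalIntegrable a b
  induction m with
  | zero => simp [rankGap]
  | succ m ih =>
    rw [← intervalIntegral.integral_add_adjacent_intervals (hint _ (ranked x m)) (hint _ _),
      ih (by omega), Finset.sum_Ico_succ_top (by omega : 1 ≤ m + 1)]
    have hle : ranked x (m + 1) ≤ ranked x m := ranked_anti x (by omega) hm
    have h1 : ∫ y in ranked x (m + 1)..ranked x m, φ (excess x y) =
        ∫ y in ranked x (m + 1)..ranked x m,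
          φ (∑ n ∈ Finset.range (m + 1), ranked x n - ((m + 1 : ℕ) : ℝ) * y) := by
      refine intervalIntegral.integral_congr fun y hy => ?_
      rw [Set.uIcc_of_le hle] at hy
      rw [excess_eq_ranked x (m := m + 1) (by omega)
        (fun n hn => hy.2.trans (ranked_anti x (by omega) (by omega)))
        (fun n hn hn' => (ranked_anti x hn hn').trans hy.1)]
    have h2 : ∫ y in ranked x (m + 1)..ranked x m,
        φ (∑ n ∈ Finset.range (m + 1), ranked x n - ((m + 1 : ℕ) : ℝ) * y) =
        (Φ (rankGap x (m + 1)) - Φ (rankGap x m)) / (m + 1) := by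
      rw [intervalIntegral.integral_comp_sub_mul (fun u => φ u)
        (by positivity : ((m + 1 : ℕ) : ℝ) ≠ 0),
        intervalIntegral.integral_eq_sub_of_hasDerivAt (fun u _ => hΦ u)
          (hφ.intervalIntegrable _ _)]
      have h3 : ∑ n ∈ Finset.range (m + 1), ranked x n - ((m + 1 : ℕ) : ℝ) * ranked x m =
          rankGap x m := by
        rw [rankGap, Finset.sum_range_succ]; push_cast; ring
      rw [h3, ← rankGap, smul_eq_mul]
      push_cast
      field_simp
    rw [h1, h2]
    push_cast
    field_simp
    ring

theorem integrable_exp_indicator (M : ℝ) :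
    Integrable ((Set.Iio M).indicator fun y => Real.exp (y - M)) := by
  rw [integrable_indicator_iff measurableSet_Iio]
  have h := (integrableOn_exp_Iic M).mul_const (Real.exp (-M))
  simp only [← Real.exp_add] at h
  exact IntegrableOn.mono_set h Set.Iio_subset_Iic_self

theorem exp_neg_excess_le (x : Fin N → ℝ) (y : ℝ) (hN : 0 < N) :
    Real.exp (-excess x y) ≤ Real.exp (y - ranked x 0) := by
  obtain ⟨j, hj⟩ := exists_eq_ranked x hN
  have := sub_le_excess x y j
  exact Real.exp_le_exp.2 (by linarith)

theorem excess_eq_zero_of_le {x : Fin N → ℝ} {y : ℝ} (h : ranked x 0 ≤ y) : excess x y = 0 :=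
  excess_eq_zero fun j => (le_ranked_zero x j).trans h

theorem measurable_comp_excess {φ : ℝ → ℝ} (hφ : Continuous φ) (x : Fin N → ℝ) :
    Measurable fun y => φ (excess x y) :=
  (hφ.comp (continuous_excess_right x)).measurable

section

variable {φ Φ : ℝ → ℝ} {c C : ℝ}

theorem integrable_comp_excess (hφ : Continuous φ) (h0 : φ 0 = 0)
    (hC : ∀ h, 0 ≤ h → |φ h - c| ≤ C * Real.exp (-h)) (hN : 0 < N) (x : Fin N → ℝ) {b : ℝ}
    (hb : ∀ j, b ≤ x j) :
    Integrable fun y => φ (excess x y) - (Set.Iio b).indicator (fun _ => c) y := by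
  set M := ranked x 0 with hM
  have hbM : b ≤ M := by
    obtain ⟨j, hj⟩ := exists_eq_ranked x hN
    rw [hM, ← hj]; exact hb j
  have hC0 : 0 ≤ C := by
    have := (abs_nonneg _).trans (hC 0 le_rfl); simpa using this
  have hbound : Integrable fun y =>
      C * (Set.Iio M).indicator (fun y => Real.exp (y - M)) y +
        (Set.Ico b M).indicator (fun _ => |c|) y :=
    ((integrable_exp_indicator M).const_mul C).add
      ((integrable_indicator_iff measurableSet_Ico).2 (by simp))
  refine hbound.mono' ?_ (ae_of_all _ fun y => ?_)
  · exact ((measurable_comp_excess hφ x).sub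
      (measurable_const.indicator measurableSet_Iio)).aestronglyMeasurable
  · rw [Real.norm_eq_abs]
    rcases le_or_gt M y with hy | hy
    · rw [excess_eq_zero_of_le hy, h0]
      simp [not_lt.2 hy, not_lt.2 (hbM.trans hy)]
    · have h1 := hC _ (excess_nonneg x y)
      have h2 := mul_le_mul_of_nonneg_left (exp_neg_excess_le x y hN) hC0
      rw [Set.indicator_of_mem (show y ∈ Set.Iio M from hy)]
      rcases lt_or_ge y b with hyb | hyb
      · rw [Set.indicator_of_mem (show y ∈ Set.Iio b from hyb),
          Set.indicator_of_notMem (fun h => not_lt.2 h.1 hyb)]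
        linarith
      · rw [Set.indicator_of_notMem (Set.notMem_Iio.2 hyb),
          Set.indicator_of_mem (show y ∈ Set.Ico b M from ⟨hyb, hy⟩), sub_zero]
        have h3 := abs_sub_abs_le_abs_sub (φ (excess x y)) c
        linarith

/-- The integral over all levels of `φ ∘ excess`, renormalized below the level `b` by the limit `c`
of `φ` at infinity, in terms of the rank gaps. -/
theorem integral_comp_excess (hΦ : ∀ h, HasDerivAt Φ (φ h) h)
    (hφ : Continuous φ) (h0 : φ 0 = 0) (hC : ∀ h, 0 ≤ h → |φ h - c| ≤ C * Real.exp (-h))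
    (hlim : Tendsto (fun h => Φ h - c * h) atTop (𝓝 0)) (hN : 0 < N) (x : Fin N → ℝ) {b : ℝ}
    (hb : ∀ j, b ≤ x j) :
    ∫ y, (φ (excess x y) - (Set.Iio b).indicator (fun _ => c) y) =
      rankSum Φ x - Φ 0 + c * (1 / N * ∑ i, x i) - c * b := by
  have hNr : (N : ℝ) ≠ 0 := by positivity
  have hI := integrable_comp_excess (c := c) hφ h0 hC hN x hb
  set f := fun y => φ (excess x y) - (Set.Iio b).indicator (fun _ => c) y with hf
  set a := ranked x (N - 1) with ha
  set M := ranked x 0 with hM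
  have hba : b ≤ a := by
    obtain ⟨j, hj⟩ := exists_eq_ranked x (n := N - 1) (by omega)
    rw [ha, ← hj]; exact hb j
  have haM : a ≤ M := ranked_anti x (Nat.zero_le _) (by omega)
  have hlow : ∀ y ≤ a, excess x y = ∑ i, x i - N * y := by
    intro y hy
    rw [excess_eq_ranked x le_rfl (fun n hn => hy.trans (ranked_anti x (by omega) (by omega)))
      (fun n hn hn' => absurd hn' (not_lt.2 hn)), sum_ranked x (fun u => u)]
  have hgap : rankGap x (N - 1) = ∑ i, x i - N * a := by
    rw [rankGap_eq_excess x (by omega), hlow _ le_rfl]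
  -- the part below `b`
  have h1 : ∫ y in Set.Iic b, f y = -(Φ (∑ i, x i - N * b) - c * (∑ i, x i - N * b)) / N := by
    have hg : ∀ y : ℝ, HasDerivAt (fun y : ℝ => ∑ i, x i - N * y) (-(N : ℝ)) y := fun y => by
      refine (((hasDerivAt_id y).const_mul (N : ℝ)).const_sub (∑ i, x i)).congr_deriv ?_
      simp
    have h2 : ∀ y : ℝ, HasDerivAt
        (fun y : ℝ => -(Φ (∑ i, x i - N * y) - c * (∑ i, x i - N * y)) / N)
        (φ (∑ i, x i - N * y) - c) y := fun y => by
      refine ((((hΦ _).comp y (hg y)).sub ((hg y).const_mul c)).neg.div_const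
        (N : ℝ)).congr_deriv ?_
      field_simp
      ring
    have h3 : Tendsto (fun y : ℝ => -(Φ (∑ i, x i - N * y) - c * (∑ i, x i - N * y)) / N) atBot
        (𝓝 0) := by
      have h4 : Tendsto (fun y : ℝ => ∑ i, x i - N * y) atBot atTop := by
        refine tendsto_atTop_add_const_left _ _ (tendsto_neg_atBot_atTop.comp ?_)
        exact tendsto_id.const_mul_atBot (by positivity)
      simpa using (hlim.comp h4).neg.div_const (N : ℝ)
    have h5 : Set.EqOn f (fun y => φ (∑ i, x i - N * y) - c) (Set.Iio b) := fun y hy => by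
      simp only [hf]
      rw [Set.indicator_of_mem hy, hlow y (hy.out.le.trans hba)]
    have h6 : IntegrableOn (fun y => φ (∑ i, x i - N * y) - c) (Set.Iic b) := by
      rw [integrableOn_Iic_iff_integrableOn_Iio]
      exact (hI.integrableOn.congr_fun h5 measurableSet_Iio)
    rw [integral_Iic_eq_integral_Iio, setIntegral_congr_fun measurableSet_Iio h5,
      ← integral_Iic_eq_integral_Iio,
      integral_Iic_of_hasDerivAt_of_tendsto (h2 b).continuousAt.continuousWithinAt
        (fun y _ => h2 y) h6 h3, sub_zero]
  have hf' : ∀ {u v : ℝ}, b ≤ u → u ≤ v →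
      ∫ y in u..v, f y = ∫ y in u..v, φ (excess x y) := by
    intro u v hu huv
    refine intervalIntegral.integral_congr fun y hy => ?_
    rw [Set.uIcc_of_le huv] at hy
    simp only [hf]
    rw [Set.indicator_of_notMem (Set.notMem_Iio.2 (hu.trans hy.1)), sub_zero]
  -- between `b` and the least coordinate the excess is still affine, without renormalization
  have h2 : ∫ y in b..a, f y = (Φ (∑ i, x i - N * b) - Φ (∑ i, x i - N * a)) / N := by
    rw [hf' le_rfl hba, intervalIntegral.integral_congr (g := fun y => φ (∑ i, x i - N * y))]
    · rw [intervalIntegral.integral_comp_sub_mul (fun u => φ u) hNr,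
        intervalIntegral.integral_eq_sub_of_hasDerivAt (fun u _ => hΦ u)
          (hφ.intervalIntegrable _ _), smul_eq_mul]
      field_simp
    · intro y hy
      rw [Set.uIcc_of_le hba] at hy
      simp only [hlow y hy.2]
  -- between the least and the largest coordinate
  have h3 : ∫ y in a..M, f y = rankSum Φ x - Φ 0 + Φ (∑ i, x i - N * a) / N := by
    rw [hf' hba haM, ha, hM, intervalIntegral_comp_excess hΦ hφ x (m := N - 1) (by omega), rankSum,
      Nat.sub_add_cancel hN, hgap, Nat.cast_sub hN]
    simp [ha]
  have h4 : ∫ y in Set.Ioi M, f y = 0 := by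
    refine setIntegral_eq_zero_of_forall_eq_zero fun y hy => ?_
    simp only [hf]
    rw [excess_eq_zero_of_le (le_of_lt hy), h0,
      Set.indicator_of_notMem (Set.notMem_Iio.2 ((hba.trans haM).trans (le_of_lt hy))), sub_zero]
  rw [← intervalIntegral.integral_Iic_add_Ioi (b := b) hI.integrableOn hI.integrableOn,
    ← intervalIntegral.integral_interval_add_Ioi (a := b) (b := a) hI.integrableOn hI.integrableOn,
    ← intervalIntegral.integral_interval_add_Ioi (a := a) (b := M) hI.integrableOn hI.integrableOn,
    h1, h2, h3, h4]
  field_simp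
  ring

end

/-! ### The potential at unit time and its first derivatives -/

/-- The max potential at the time at which `√(-2κt) = 1`. -/
def unitPotential (x : Fin N → ℝ) : ℝ := 1 / (N : ℝ) * ∑ i, x i + rankSum profile x

/-- The potential is an integral over all levels `y` of a smooth function of the excess of `x`
over `y`. Unlike the formula in terms of ranks, this one has no seams at ties. -/
theorem unitPotential_eq (hN : 0 < N) (x : Fin N → ℝ) {b : ℝ} (hb : ∀ j, b ≤ x j) :
    unitPotential x = √(2 / Real.pi) + b +
      ∫ y, (halfCdf (excess x y) - (Set.Iio b).indicator (fun _ => 1) y) := by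
  rw [integral_comp_excess (C := 2) hasDerivAt_profile continuous_halfCdf halfCdf_zero
    (fun h _ => ?_) (by simpa using tendsto_profile_sub) hN x hb, profile_zero, unitPotential]
  · ring
  · rw [abs_sub_comm, abs_of_nonneg (by linarith [halfCdf_le_one h])]
    exact one_sub_halfCdf_le h

/-- The linear functional `v ↦ ∑ j, v_j`, the sum over the coordinates of `x` above `y`. -/
def sumAbove (x : Fin N → ℝ) (y : ℝ) : (Fin N → ℝ) →L[ℝ] ℝ :=
  ∑ j ∈ above x y, ContinuousLinearMap.proj (R := ℝ) (φ := fun _ : Fin N => ℝ) j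

theorem sumAbove_apply (x : Fin N → ℝ) (y : ℝ) (v : Fin N → ℝ) :
    sumAbove x y v = ∑ j ∈ above x y, v j := by
  simp [sumAbove]

theorem ae_ne_coord (x : Fin N → ℝ) : ∀ᵐ y : ℝ, ∀ j, x j ≠ y := by
  rw [ae_all_iff]
  intro j
  have : ∀ᵐ y : ℝ, y ≠ x j := by simp [ae_iff, measure_singleton]
  exact this.mono fun y hy => hy.symm

theorem stronglyMeasurable_sumAbove (x : Fin N → ℝ) : StronglyMeasurable (sumAbove x) := by
  have h : sumAbove x = fun y => ∑ j, (Set.Iio (x j)).indicator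
      (fun _ => ContinuousLinearMap.proj (R := ℝ) (φ := fun _ : Fin N => ℝ) j) y := by
    funext y
    rw [sumAbove, above, Finset.sum_filter]
    refine Finset.sum_congr rfl fun j _ => ?_
    simp only [Set.indicator_apply, Set.mem_Iio]
  rw [h]
  exact Finset.stronglyMeasurable_fun_sum _ fun j _ =>
    stronglyMeasurable_const.indicator measurableSet_Iio

theorem abs_sub_le_of_mem_ball {x x₀ : Fin N → ℝ} {r : ℝ} (hx : x ∈ Metric.ball x₀ r) (j : Fin N) :
    |x j - x₀ j| ≤ r := by
  have h1 := norm_le_pi_norm (x - x₀) j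
  rw [Real.norm_eq_abs, Pi.sub_apply] at h1
  rw [Metric.mem_ball, dist_eq_norm] at hx
  linarith

/-- The difference quotients of the integrand in `unitPotential_eq` are dominated by an exponential
in the level, uniformly near `x₀`. -/
theorem hasFDerivAt_unitPotential (hN : 0 < N) (x₀ : Fin N → ℝ) :
    Integrable (fun y => halfDens (excess x₀ y) • sumAbove x₀ y) ∧
      HasFDerivAt unitPotential (∫ y, halfDens (excess x₀ y) • sumAbove x₀ y) x₀ := by
  set b := ranked x₀ (N - 1) - 1 with hb
  set M := ranked x₀ 0 with hM
  have hbx : ∀ x ∈ Metric.ball x₀ 1, ∀ j, b ≤ x j := fun x hx j => by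
    have h1 := abs_le.1 (abs_sub_le_of_mem_ball hx j)
    have h2 := ranked_last_le x₀ j
    linarith
  have hMx : ∀ x ∈ Metric.ball x₀ 1, ∀ j, x j ≤ M + 1 := fun x hx j => by
    have h1 := abs_le.1 (abs_sub_le_of_mem_ball hx j)
    have h2 := le_ranked_zero x₀ j
    linarith
  obtain ⟨k, hk⟩ := exists_eq_ranked x₀ hN
  have hball : Metric.ball x₀ 1 ∈ 𝓝 x₀ := Metric.ball_mem_nhds _ one_pos
  have key := hasFDerivAt_integral_of_dominated_loc_of_lip (𝕜 := ℝ) (μ := volume)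
    (F := fun x y => halfCdf (excess x y) - (Set.Iio b).indicator (fun _ => (1 : ℝ)) y)
    (F' := fun y => halfDens (excess x₀ y) • sumAbove x₀ y) (x₀ := x₀)
    (bound := fun y => 2 * Real.exp 2 * N *
      (Set.Iio (M + 1)).indicator (fun y => Real.exp (y - (M + 1))) y)
    hball (Eventually.of_forall fun x => ?_) ?_ ?_ ?_ ?_ ?_
  · refine ⟨key.1, ?_⟩
    have h1 : unitPotential =ᶠ[𝓝 x₀] fun x => √(2 / Real.pi) + b +
        ∫ y, (halfCdf (excess x y) - (Set.Iio b).indicator (fun _ => 1) y) := by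
      filter_upwards [hball] with x hx
      exact unitPotential_eq hN x (hbx x hx)
    exact (key.2.const_add _).congr_of_eventuallyEq h1
  · exact ((measurable_comp_excess continuous_halfCdf x).sub
      (measurable_const.indicator measurableSet_Iio)).aestronglyMeasurable
  · refine integrable_comp_excess (C := 2) continuous_halfCdf halfCdf_zero (fun h _ => ?_) hN x₀
      (hbx x₀ (Metric.mem_ball_self one_pos))
    rw [abs_sub_comm, abs_of_nonneg (by linarith [halfCdf_le_one h])]
    exact one_sub_halfCdf_le h
  · exact ((measurable_comp_excess continuous_halfDens x₀).stronglyMeasurable.smul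
      (stronglyMeasurable_sumAbove x₀)).aestronglyMeasurable
  · refine ae_of_all _ fun y => LipschitzOnWith.of_dist_le_mul fun x hx x' hx' => ?_
    simp only [Real.coe_nnabs, Real.dist_eq, sub_sub_sub_cancel_right]
    rcases le_or_gt (M + 1) y with hy | hy
    · rw [excess_eq_zero fun j => (hMx x hx j).trans hy,
        excess_eq_zero fun j => (hMx x' hx' j).trans hy]
      simp only [sub_self, abs_zero]
      positivity
    · rw [Set.indicator_of_mem (show y ∈ Set.Iio (M + 1) from hy),
        abs_of_nonneg (a := 2 * Real.exp 2 * N * Real.exp (y - (M + 1))) (by positivity)]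
      have hc : ∀ x ∈ Metric.ball x₀ 1, max (M - 1 - y) 0 ≤ excess x y := fun x hx => by
        refine max_le ?_ (excess_nonneg _ _)
        have h1 := abs_le.1 (abs_sub_le_of_mem_ball hx k)
        have h2 := sub_le_excess x y k
        linarith
      refine (abs_halfCdf_sub_le (le_max_right _ _) (hc x hx) (hc x' hx')).trans ?_
      have h1 : Real.exp (-max (M - 1 - y) 0) ≤ Real.exp 2 * Real.exp (y - (M + 1)) := by
        rw [← Real.exp_add]
        exact Real.exp_le_exp.2 (by linarith [le_max_left (M - 1 - y) 0])
      have h2 := abs_excess_sub_le x x' y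
      rw [dist_eq_norm]
      calc 2 * Real.exp (-max (M - 1 - y) 0) * |excess x y - excess x' y|
          ≤ 2 * (Real.exp 2 * Real.exp (y - (M + 1))) * (N * ‖x - x'‖) := by gcongr
        _ = _ := by ring
  · exact (integrable_exp_indicator (M + 1)).const_mul _
  · filter_upwards [ae_ne_coord x₀] with y hy
    have h1 := (hasDerivAt_halfCdf (excess x₀ y)).comp_hasFDerivAt x₀ (hasFDerivAt_excess hy)
    exact h1.sub_const _

/-- The partial derivative `∂_i` of the potential at unit time, as an integral over the
levels `x_i - s` below `x_i`. -/
def unitGrad (i : Fin N) (x : Fin N → ℝ) : ℝ :=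
  ∫ s in Set.Ioi (0 : ℝ), halfDens (excess x (x i - s))

theorem integral_Ioi_comp_sub {E : Type*} [NormedAddCommGroup E] [NormedSpace ℝ E] (f : ℝ → E)
    (c : ℝ) : ∫ s in Set.Ioi (0 : ℝ), f (c - s) = ∫ y in Set.Iio c, f y := by
  rw [← integral_indicator measurableSet_Ioi, ← integral_indicator measurableSet_Iio,
    ← integral_sub_left_eq_self ((Set.Iio c).indicator f) volume c]
  congr 1
  funext s
  simp only [Set.indicator_apply, Set.mem_Ioi, Set.mem_Iio, sub_lt_self_iff]

theorem unitGrad_eq (i : Fin N) (x : Fin N → ℝ) :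
    unitGrad i x = ∫ y in Set.Iio (x i), halfDens (excess x y) :=
  integral_Ioi_comp_sub (fun y => halfDens (excess x y)) (x i)

theorem unitGrad_nonneg (i : Fin N) (x : Fin N → ℝ) : 0 ≤ unitGrad i x :=
  setIntegral_nonneg measurableSet_Ioi fun _ _ => (halfDens_pos _).le

theorem fderiv_unitPotential_single (hN : 0 < N) (x : Fin N → ℝ) (i : Fin N) :
    fderiv ℝ unitPotential x (Pi.single i 1) = unitGrad i x := by
  obtain ⟨h1, h2⟩ := hasFDerivAt_unitPotential hN x
  rw [h2.fderiv, ContinuousLinearMap.integral_apply h1, unitGrad_eq,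
    ← integral_indicator measurableSet_Iio]
  congr 1
  funext y
  simp only [smul_apply, sumAbove_apply, smul_eq_mul]
  by_cases hy : y < x i
  · rw [Set.indicator_of_mem (show y ∈ Set.Iio (x i) from hy),
      Finset.sum_eq_single_of_mem i (mem_above.2 hy)]
    · simp
    · intro j _ hj; simp [hj]
  · rw [Set.indicator_of_notMem (show y ∉ Set.Iio (x i) from hy), Finset.sum_eq_zero, mul_zero]
    intro j hj
    have : j ≠ i := fun h => hy (h ▸ mem_above.1 hj)
    simp [this]

theorem clm_eq_sum_proj (L : (Fin N → ℝ) →L[ℝ] ℝ) (v : Fin N → ℝ) :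
    L v = ∑ i, L (Pi.single i 1) * v i := by
  conv_lhs => rw [pi_eq_sum_univ' v]
  rw [map_sum]
  refine Finset.sum_congr rfl fun i _ => ?_
  rw [map_smul, smul_eq_mul, mul_comm]

theorem fderiv_unitPotential (hN : 0 < N) (x v : Fin N → ℝ) :
    fderiv ℝ unitPotential x v = ∑ i, unitGrad i x * v i := by
  rw [clm_eq_sum_proj]
  simp_rw [fderiv_unitPotential_single hN]

/-! ### The second derivatives -/

/-- The linear functional `v ↦ ∑ j, (v_j - v_i)`, the sum over the coordinates of `x` above `y`. At
`y = x_i - s` it is the differential of `x ↦ excess x (x_i - s)`. -/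
def relSumAbove (i : Fin N) (x : Fin N → ℝ) (y : ℝ) : (Fin N → ℝ) →L[ℝ] ℝ :=
  ∑ j ∈ above x y, (ContinuousLinearMap.proj (R := ℝ) (φ := fun _ : Fin N => ℝ) j -
        ContinuousLinearMap.proj (R := ℝ) (φ := fun _ : Fin N => ℝ) i)

/-- The differential of `unitGrad i` as an integral over the levels below `x_i`. -/
def unitHess (i : Fin N) (x : Fin N → ℝ) : (Fin N → ℝ) →L[ℝ] ℝ :=
  ∫ s in Set.Ioi (0 : ℝ), (-(excess x (x i - s) * halfDens (excess x (x i - s)))) •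
    relSumAbove i x (x i - s)

theorem stronglyMeasurable_relSumAbove (i : Fin N) (x : Fin N → ℝ) :
    StronglyMeasurable (relSumAbove i x) := by
  have h : relSumAbove i x = fun y => ∑ j, (Set.Iio (x j)).indicator
      (fun _ => ContinuousLinearMap.proj (R := ℝ) (φ := fun _ : Fin N => ℝ) j -
        ContinuousLinearMap.proj (R := ℝ) (φ := fun _ : Fin N => ℝ) i) y := by
    funext y
    rw [relSumAbove, above, Finset.sum_filter]
    refine Finset.sum_congr rfl fun j _ => ?_
    simp only [Set.indicator_apply, Set.mem_Iio]
  rw [h]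
  exact Finset.stronglyMeasurable_fun_sum _ fun j _ =>
    stronglyMeasurable_const.indicator measurableSet_Iio

theorem relSumAbove_apply (i : Fin N) (x : Fin N → ℝ) (y : ℝ) (v : Fin N → ℝ) :
    relSumAbove i x y v = ∑ j ∈ above x y, (v j - v i) := by
  simp [relSumAbove]

theorem norm_relSumAbove_le (i : Fin N) (x : Fin N → ℝ) (y : ℝ) :
    ‖relSumAbove i x y‖ ≤ 2 * N := by
  refine ContinuousLinearMap.opNorm_le_bound _ (by positivity) fun v => ?_
  rw [relSumAbove_apply]
  refine (norm_sum_le _ _).trans ?_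
  refine (Finset.sum_le_card_nsmul _ _ (2 * ‖v‖) fun j _ => ?_).trans ?_
  · refine (norm_sub_le _ _).trans ?_
    linarith [norm_le_pi_norm v j, norm_le_pi_norm v i]
  · rw [nsmul_eq_mul]
    have : ((above x y).card : ℝ) ≤ N := by
      exact_mod_cast (Finset.card_le_univ _).trans (by simp)
    nlinarith [norm_nonneg v]

theorem hasFDerivAt_excess_coord (i : Fin N) {x : Fin N → ℝ} {s : ℝ} (h : ∀ j, x j ≠ x i - s) :
    HasFDerivAt (fun x : Fin N → ℝ => excess x (x i - s)) (relSumAbove i x (x i - s)) x := by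
  have h1 : (fun x' : Fin N → ℝ => excess x' (x' i - s)) =ᶠ[𝓝 x]
      fun x' => ∑ j ∈ above x (x i - s), (x' j - (x' i - s)) := by
    have : Tendsto (fun x' : Fin N → ℝ => (x', x' i - s)) (𝓝 x) (𝓝 (x, x i - s)) :=
      (by fun_prop : Continuous fun x' : Fin N → ℝ => (x', x' i - s)).tendsto x
    filter_upwards [this.eventually (eventually_above_eq h)] with x' hx'
    rw [excess_eq_sum_above, hx']
  refine HasFDerivAt.congr_of_eventuallyEq ?_ h1
  refine HasFDerivAt.fun_sum fun j _ => ?_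
  exact (ContinuousLinearMap.proj (R := ℝ) (φ := fun _ : Fin N => ℝ) j).hasFDerivAt.sub
    ((ContinuousLinearMap.proj (R := ℝ) (φ := fun _ : Fin N => ℝ) i).hasFDerivAt.sub_const s)

theorem le_excess_coord (i : Fin N) (x : Fin N → ℝ) (s : ℝ) : s ≤ excess x (x i - s) := by
  have := sub_le_excess x (x i - s) i
  linarith

theorem excess_add_const (x : Fin N → ℝ) (y c : ℝ) :
    excess (fun j => x j + c) (y + c) = excess x y := by
  simp [excess]

theorem abs_excess_coord_sub_le (i : Fin N) (x x' : Fin N → ℝ) (s : ℝ) :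
    |excess x (x i - s) - excess x' (x' i - s)| ≤ 2 * N * ‖x - x'‖ := by
  have h1 := excess_add_const x (x i - s) (-x i)
  have h2 := excess_add_const x' (x' i - s) (-x' i)
  rw [← h1, ← h2, show x i - s + -x i = x' i - s + -x' i by ring]
  refine (abs_excess_sub_le _ _ _).trans ?_
  have h3 : ‖(fun j => x j + -x i) - fun j => x' j + -x' i‖ ≤ 2 * ‖x - x'‖ := by
    refine (pi_norm_le_iff_of_nonneg (by positivity)).2 fun j => ?_
    simp only [Pi.sub_apply]
    rw [show x j + -x i - (x' j + -x' i) = (x - x') j - (x - x') i by simp; ring]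
    refine (norm_sub_le _ _).trans ?_
    linarith [norm_le_pi_norm (x - x') j, norm_le_pi_norm (x - x') i]
  nlinarith [(Nat.cast_nonneg N : (0 : ℝ) ≤ N)]

theorem ae_ne_coord_sub (x : Fin N → ℝ) (i : Fin N) :
    ∀ᵐ s ∂(volume.restrict (Set.Ioi (0 : ℝ))), ∀ j, x j ≠ x i - s := by
  refine ae_restrict_of_ae ?_
  rw [ae_all_iff]
  intro j
  have : ∀ᵐ s : ℝ, s ≠ x i - x j := by simp [ae_iff, measure_singleton]
  exact this.mono fun s hs h => hs (by linarith)

theorem aestronglyMeasurable_unitHess (i : Fin N) (x : Fin N → ℝ) (μ : Measure ℝ) :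
    AEStronglyMeasurable (fun s => (-(excess x (x i - s) * halfDens (excess x (x i - s)))) •
      relSumAbove i x (x i - s)) μ := by
  have h1 : Measurable fun s : ℝ => x i - s := by fun_prop
  have h2 : Continuous fun h : ℝ => -(h * halfDens h) :=
    (continuous_id.mul continuous_halfDens).neg
  exact (((measurable_comp_excess h2 x).comp h1).stronglyMeasurable.smul
    ((stronglyMeasurable_relSumAbove i x).comp_measurable h1)).aestronglyMeasurable

theorem integrable_unitGrad (i : Fin N) (x : Fin N → ℝ) :
    IntegrableOn (fun s => halfDens (excess x (x i - s))) (Set.Ioi 0) := by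
  refine Integrable.mono' ((integrableOn_exp_neg_Ioi 0).const_mul 2)
    ((measurable_comp_excess continuous_halfDens x).comp (by fun_prop)).aestronglyMeasurable
    (ae_of_all _ fun s => ?_)
  rw [Real.norm_eq_abs, abs_of_pos (halfDens_pos _)]
  refine (halfDens_le _).trans ?_
  gcongr
  exact le_excess_coord i x s

theorem norm_unitHess_integrand_le (i : Fin N) (x : Fin N → ℝ) (s : ℝ) :
    ‖(-(excess x (x i - s) * halfDens (excess x (x i - s)))) • relSumAbove i x (x i - s)‖ ≤
      40 * N * Real.exp (-s) := by
  rw [norm_smul, norm_neg, Real.norm_eq_abs,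
    abs_of_nonneg (mul_nonneg (excess_nonneg _ _) (halfDens_pos _).le)]
  have h1 : Real.exp (-excess x (x i - s)) ≤ Real.exp (-s) :=
    Real.exp_le_exp.2 (by linarith [le_excess_coord i x s])
  calc _ ≤ 20 * Real.exp (-s) * (2 * N) :=
        mul_le_mul ((mul_halfDens_le (excess_nonneg _ _)).trans (by gcongr))
          (norm_relSumAbove_le i x _) (norm_nonneg _) (by positivity)
    _ = _ := by ring

/-- Levels are measured from `x_i` here, so that the domain of integration does not move. -/
theorem hasFDerivAt_unitGrad (i : Fin N) (x₀ : Fin N → ℝ) :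
    HasFDerivAt (unitGrad i) (unitHess i x₀) x₀ := by
  have key := hasFDerivAt_integral_of_dominated_loc_of_lip (𝕜 := ℝ)
    (μ := volume.restrict (Set.Ioi (0 : ℝ)))
    (F := fun (x : Fin N → ℝ) s => halfDens (excess x (x i - s)))
    (F' := fun s => (-(excess x₀ (x₀ i - s) * halfDens (excess x₀ (x₀ i - s)))) •
      relSumAbove i x₀ (x₀ i - s)) (x₀ := x₀)
    (bound := fun s => 40 * N * Real.exp (-s)) (s := Set.univ) univ_mem
    (Eventually.of_forall fun x => (integrable_unitGrad i x).aestronglyMeasurable)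
    (integrable_unitGrad i x₀) (aestronglyMeasurable_unitHess i x₀ _) ?_
    ((integrableOn_exp_neg_Ioi 0).const_mul _) ?_
  · exact key.2
  · refine (ae_restrict_iff' measurableSet_Ioi).2 (ae_of_all _ fun s hs => ?_)
    refine LipschitzOnWith.of_dist_le_mul fun x _ x' _ => ?_
    rw [Real.coe_nnabs, Real.dist_eq, abs_of_nonneg (a := 40 * N * Real.exp (-s)) (by positivity),
      dist_eq_norm]
    refine (abs_halfDens_sub_le (le_of_lt hs) (le_excess_coord i x s)
      (le_excess_coord i x' s)).trans ?_
    have := abs_excess_coord_sub_le i x x' s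
    calc _ ≤ 20 * Real.exp (-s) * (2 * N * ‖x - x'‖) := by gcongr
      _ = _ := by ring
  · filter_upwards [ae_ne_coord_sub x₀ i] with s hs
    exact (hasDerivAt_halfDens _).comp_hasFDerivAt x₀ (hasFDerivAt_excess_coord i hs)

theorem integrable_unitHess (i : Fin N) (x : Fin N → ℝ) :
    IntegrableOn (fun s => (-(excess x (x i - s) * halfDens (excess x (x i - s)))) •
      relSumAbove i x (x i - s)) (Set.Ioi 0) :=
  Integrable.mono' ((integrableOn_exp_neg_Ioi 0).const_mul (40 * N))
    (aestronglyMeasurable_unitHess i x _) (ae_of_all _ (norm_unitHess_integrand_le i x))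

theorem continuous_unitHess (i : Fin N) : Continuous (unitHess i) := by
  refine continuous_iff_continuousAt.2 fun x₀ => ?_
  refine continuousAt_of_dominated (bound := fun s => 40 * N * Real.exp (-s))
    (F := fun x s => (-(excess x (x i - s) * halfDens (excess x (x i - s)))) •
      relSumAbove i x (x i - s))
    (Eventually.of_forall fun x => aestronglyMeasurable_unitHess i x _)
    (Eventually.of_forall fun x => ae_of_all _ (norm_unitHess_integrand_le i x))
    ((integrableOn_exp_neg_Ioi 0).const_mul _) ?_
  filter_upwards [ae_ne_coord_sub x₀ i] with s hs
  have hc : Continuous fun x : Fin N → ℝ => (x, x i - s) := by fun_prop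
  refine ContinuousAt.fun_smul ?_ ?_
  · have h1 : Continuous fun x : Fin N → ℝ => excess x (x i - s) := continuous_excess.comp hc
    exact ((h1.mul (continuous_halfDens.comp h1)).neg).continuousAt
  · refine (continuousAt_const (y := relSumAbove i x₀ (x₀ i - s))).congr ?_
    filter_upwards [(hc.tendsto x₀).eventually (eventually_above_eq hs)] with x hx
    simp only [relSumAbove, hx]

theorem contDiff_unitGrad (i : Fin N) : ContDiff ℝ 1 (unitGrad i) := by
  refine contDiff_one_iff_fderiv.2 ⟨fun x => (hasFDerivAt_unitGrad i x).differentiableAt, ?_⟩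
  have : fderiv ℝ (unitGrad i) = unitHess i := funext fun x => (hasFDerivAt_unitGrad i x).fderiv
  rw [this]
  exact continuous_unitHess i

theorem differentiable_unitPotential (hN : 0 < N) :
    Differentiable ℝ (unitPotential (N := N)) := fun x =>
  (hasFDerivAt_unitPotential hN x).2.differentiableAt

theorem contDiff_unitPotential (hN : 0 < N) : ContDiff ℝ 2 (unitPotential (N := N)) := by
  rw [show (2 : WithTop ℕ∞) = 1 + 1 by norm_num]
  refine contDiff_succ_iff_fderiv.2 ⟨differentiable_unitPotential hN, by simp, ?_⟩
  refine contDiff_clm_apply_iff.2 fun v => ?_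
  simp_rw [fderiv_unitPotential hN]
  exact ContDiff.sum fun i _ => (contDiff_unitGrad i).mul contDiff_const

theorem unitHess_apply (i : Fin N) (x v : Fin N → ℝ) :
    unitHess i x v = ∫ y in Set.Iio (x i),
      excess x y * halfDens (excess x y) * ∑ j ∈ above x y, (v i - v j) := by
  have h : unitHess i x v = ∫ s in Set.Ioi (0 : ℝ), (fun y =>
      excess x y * halfDens (excess x y) * ∑ j ∈ above x y, (v i - v j)) (x i - s) := by
    refine (ContinuousLinearMap.integral_apply (integrable_unitHess i x) v).trans ?_
    congr 1
    funext s
    simp only [smul_apply, relSumAbove_apply, smul_eq_mul]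
    rw [neg_mul, ← mul_neg, ← Finset.sum_neg_distrib]
    simp only [neg_sub]
  rw [h]
  exact integral_Ioi_comp_sub (fun y =>
      excess x y * halfDens (excess x y) * ∑ j ∈ above x y, (v i - v j)) (x i)

/-! ### The curvature of the potential -/

/-- The weight `H ρ(H)` of the level `y` in the second derivatives at `x`, where `H` is the excess
of `x` over `y` and `ρ` is the half-normal density. -/
def levelWeight (x : Fin N → ℝ) (y : ℝ) : ℝ := excess x y * halfDens (excess x y)

theorem levelWeight_nonneg (x : Fin N → ℝ) (y : ℝ) : 0 ≤ levelWeight x y :=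
  mul_nonneg (excess_nonneg _ _) (halfDens_pos _).le

theorem levelWeight_le (x : Fin N → ℝ) (y : ℝ) : levelWeight x y ≤ 20 := by
  refine (mul_halfDens_le (excess_nonneg x y)).trans ?_
  have : Real.exp (-excess x y) ≤ 1 := Real.exp_le_one_iff.2 (by linarith [excess_nonneg x y])
  linarith

theorem levelWeight_eq_zero {x : Fin N → ℝ} {y : ℝ} (h : ∀ j, x j ≤ y) : levelWeight x y = 0 := by
  rw [levelWeight, excess_eq_zero h, zero_mul]

theorem abs_mul_halfDens_sub_zero_le (h : ℝ) (hh : 0 ≤ h) :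
    |h * halfDens h - 0| ≤ 20 * Real.exp (-h) := by
  rw [sub_zero, abs_of_nonneg (mul_nonneg hh (halfDens_pos _).le)]
  exact mul_halfDens_le hh

theorem continuous_mul_halfDens : Continuous fun h : ℝ => h * halfDens h :=
  continuous_id.mul continuous_halfDens

theorem integrable_levelWeight (hN : 0 < N) (x : Fin N → ℝ) : Integrable (levelWeight x) := by
  have := integrable_comp_excess (c := 0) continuous_mul_halfDens (zero_mul _)
    abs_mul_halfDens_sub_zero_le hN x (b := ranked x (N - 1)) (ranked_last_le x)
  simp only [Set.indicator_zero, sub_zero] at this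
  exact this

/-- The largest second derivative of the potential at unit time, in terms of ranks. -/
def unitCurv (x : Fin N → ℝ) : ℝ := rankSum halfDens x

/-- The level representation of the curvature: minus the half-normal density is an antiderivative of
`h ↦ h ρ(h)`. -/
theorem unitCurv_eq (hN : 0 < N) (x : Fin N → ℝ) :
    unitCurv x = √(2 / Real.pi) - ∫ y, levelWeight x y := by
  have h := integral_comp_excess (Φ := fun h => -halfDens h) (c := 0)
    (fun h => (hasDerivAt_halfDens h).neg.congr_deriv (neg_neg _))
    continuous_mul_halfDens (zero_mul _) abs_mul_halfDens_sub_zero_le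
    (by simpa using tendsto_halfDens.neg) hN x (b := ranked x (N - 1)) (ranked_last_le x)
  have h1 : rankSum (fun h => -halfDens h) x = -unitCurv x := by
    simp [rankSum, unitCurv]
  simp only [Set.indicator_zero, sub_zero, h1, halfDens_zero, zero_mul, add_zero] at h
  unfold levelWeight
  rw [h]
  ring

theorem unitCurv_nonneg (x : Fin N → ℝ) : 0 ≤ unitCurv x := by
  unfold unitCurv rankSum
  exact Finset.sum_nonneg fun l _ => mul_nonneg (by positivity) (halfDens_pos _).le

theorem unitCurv_le (hN : 0 < N) (x : Fin N → ℝ) : unitCurv x ≤ 1 := by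
  rw [unitCurv_eq hN]
  have := integral_nonneg (μ := volume) (f := levelWeight x) (levelWeight_nonneg x)
  linarith [sqrt_two_div_pi_le_one]

theorem measurable_comp_above (x : Fin N → ℝ) (F : Finset (Fin N) → ℝ) :
    Measurable fun y => F (above x y) := by
  let m : MeasurableSpace (Finset (Fin N)) := ⊤
  have h : Measurable (above x) := by
    refine measurable_to_countable' fun S => ?_
    have : above x ⁻¹' {S} = ⋂ j, {y | y < x j ↔ j ∈ S} := by
      ext y
      simp [Finset.ext_iff, mem_above]
    rw [this]
    refine MeasurableSet.iInter fun j => ?_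
    by_cases hj : j ∈ S
    · simp only [hj, iff_true]
      exact measurableSet_Iio
    · simp only [hj, iff_false, not_lt]
      exact measurableSet_Ici
  exact (measurable_from_top (f := F)).comp h

theorem integrable_levelWeight_mul (hN : 0 < N) (x : Fin N → ℝ) (F : Finset (Fin N) → ℝ) :
    Integrable fun y => levelWeight x y * F (above x y) := by
  refine (integrable_levelWeight hN x).mul_bdd (c := ∑ S, |F S|)
    (measurable_comp_above x F).aestronglyMeasurable (ae_of_all _ fun y => ?_)
  exact Finset.single_le_sum (f := fun S => |F S|) (fun _ _ => abs_nonneg _) (Finset.mem_univ _)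

/-- The fundamental theorem of calculus for the half-normal density of the excess. -/
theorem integral_levelWeight_mul_card (hN : 0 < N) (x : Fin N → ℝ) :
    ∫ y, levelWeight x y * ((above x y).card : ℝ) = √(2 / Real.pi) := by
  set M := ranked x 0 with hM
  have hint := integrable_levelWeight_mul hN x (fun S => (S.card : ℝ))
  have h1 : ∀ a : ℝ, ∫ y in a..M, levelWeight x y * ((above x y).card : ℝ) =
      halfDens (excess x M) - halfDens (excess x a) := fun a => by
    refine integral_eq_of_hasDerivAt_off_countable (s := Set.range x)
      (fun y => halfDens (excess x y)) _ (Set.countable_range x)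
      (continuous_halfDens.comp (continuous_excess_right x)).continuousOn
      (fun y hy => ?_) hint.intervalIntegrable
    refine ((hasDerivAt_halfDens _).comp y
      (hasDerivAt_excess fun j hj => hy.2 ⟨j, hj⟩)).congr_deriv ?_
    rw [levelWeight]
    ring
  have h2 := intervalIntegral_tendsto_integral_Iic M hint.integrableOn tendsto_id
  simp only [id, h1, excess_eq_zero_of_le hM.ge] at h2
  have h3 : Tendsto (fun a => excess x a) atBot atTop := by
    obtain ⟨k, _⟩ := exists_eq_ranked x hN
    refine tendsto_atTop_mono (fun a => sub_le_excess x a k) ?_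
    exact tendsto_atTop_add_const_left _ _ tendsto_neg_atBot_atTop
  have h4 : Tendsto (fun a => halfDens 0 - halfDens (excess x a)) atBot (𝓝 (halfDens 0 - 0)) :=
    (tendsto_halfDens.comp h3).const_sub _
  have h5 := tendsto_nhds_unique h2 h4
  have h6 : ∫ y in Set.Ioi M, levelWeight x y * ((above x y).card : ℝ) = 0 :=
    setIntegral_eq_zero_of_forall_eq_zero fun y hy => by
      rw [levelWeight_eq_zero fun j => (le_ranked_zero x j).trans (le_of_lt hy), zero_mul]
  rw [← intervalIntegral.integral_Iic_add_Ioi (b := M) hint.integrableOn hint.integrableOn, h5, h6,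
    sub_zero, add_zero, halfDens_zero]

/-- Natural subtraction only matters above all coordinates, where the weight vanishes. -/
theorem unitCurv_eq_integral (hN : 0 < N) (x : Fin N → ℝ) :
    unitCurv x = ∫ y, levelWeight x y * (((above x y).card - 1 : ℕ) : ℝ) := by
  rw [unitCurv_eq hN, ← integral_levelWeight_mul_card hN x,
    ← integral_sub (integrable_levelWeight_mul hN x (fun S => (S.card : ℝ)))
      (integrable_levelWeight hN x)]
  congr 1
  funext y
  rcases Finset.eq_empty_or_nonempty (above x y) with h | h
  · rw [levelWeight_eq_zero fun j => not_lt.1 fun hj => by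
      have := mem_above.2 hj; rw [h] at this; simp at this]
    simp
  · rw [Nat.cast_pred h.card_pos]
    ring

theorem unitHess_single (i : Fin N) (x : Fin N → ℝ) :
    unitHess i x (Pi.single i 1) = ∫ y, (Set.Iio (x i)).indicator
      (fun y => levelWeight x y * (((above x y).card - 1 : ℕ) : ℝ)) y := by
  rw [unitHess_apply, integral_indicator measurableSet_Iio]
  refine setIntegral_congr_fun measurableSet_Iio fun y hy => ?_
  have hi : i ∈ above x y := mem_above.2 hy
  rw [← levelWeight, Finset.sum_sub_distrib]
  have h1 : ∑ j ∈ above x y, (Pi.single i (1 : ℝ) : Fin N → ℝ) j = 1 := by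
    rw [Finset.sum_eq_single_of_mem i hi]
    · simp
    · intro j _ hj; simp [hj]
  rw [h1, Nat.cast_pred (Finset.card_pos.2 ⟨i, hi⟩)]
  simp

theorem unitHess_single_le (hN : 0 < N) (i : Fin N) (x : Fin N → ℝ) :
    unitHess i x (Pi.single i 1) ≤ unitCurv x := by
  have hint := integrable_levelWeight_mul hN x (fun S => ((S.card - 1 : ℕ) : ℝ))
  rw [unitHess_single, unitCurv_eq_integral hN]
  refine integral_mono (hint.indicator measurableSet_Iio) hint fun y => ?_
  exact Set.indicator_le_self' (fun _ _ => mul_nonneg (levelWeight_nonneg _ _) (by positivity)) y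

/-- If the coordinate `i` lags by at most `g` behind the leader, then `∂_ii` is smaller than the
largest second derivative by at most a multiple of `N g`. -/
theorem unitCurv_sub_le_unitHess (hN : 0 < N) (i : Fin N) (x : Fin N → ℝ) {g : ℝ}
    (hg : ∀ j, x j ≤ x i + g) :
    unitCurv x - 20 * N * g ≤ unitHess i x (Pi.single i 1) := by
  have hg0 : 0 ≤ g := by linarith [hg i]
  have hint := integrable_levelWeight_mul hN x (fun S => ((S.card - 1 : ℕ) : ℝ))
  have hI : Integrable fun y => (Set.Ico (x i) (x i + g)).indicator (fun _ => 20 * (N : ℝ)) y :=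
    IntegrableOn.integrable_indicator (integrableOn_const (by simp)) measurableSet_Ico
  have h1 : ∫ y, (Set.Ico (x i) (x i + g)).indicator (fun _ => 20 * (N : ℝ)) y = 20 * N * g := by
    rw [integral_indicator measurableSet_Ico]
    simp [hg0]
    ring
  rw [unitHess_single, unitCurv_eq_integral hN, ← h1, ← integral_sub hint hI]
  refine integral_mono (hint.sub hI) (hint.indicator measurableSet_Iio) fun y => ?_
  have hcard : (((above x y).card - 1 : ℕ) : ℝ) ≤ N := by
    have := Finset.card_le_univ (above x y)
    rw [Fintype.card_fin] at this
    exact_mod_cast (Nat.sub_le _ _).trans this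
  have hw := levelWeight_nonneg x y
  have hw' := levelWeight_le x y
  rcases lt_or_ge y (x i) with hy | hy
  · rw [Set.indicator_of_mem (show y ∈ Set.Iio (x i) from hy),
      Set.indicator_of_notMem (fun h => not_lt.2 h.1 hy), sub_zero]
  · rw [Set.indicator_of_notMem (Set.notMem_Iio.2 hy)]
    rcases lt_or_ge y (x i + g) with hy' | hy'
    · rw [Set.indicator_of_mem (show y ∈ Set.Ico _ _ from ⟨hy, hy'⟩), sub_nonpos]
      gcongr
    · rw [Set.indicator_of_notMem (fun h => not_lt.2 hy' h.2),
        levelWeight_eq_zero fun j => (hg j).trans hy', zero_mul, sub_zero]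

/-- A leading coordinate lies above every level that carries weight. -/
theorem unitHess_single_eq (hN : 0 < N) {i : Fin N} {x : Fin N → ℝ} (hi : ∀ j, x j ≤ x i) :
    unitHess i x (Pi.single i 1) = unitCurv x := by
  refine le_antisymm (unitHess_single_le hN i x) ?_
  simpa using unitCurv_sub_le_unitHess hN i x (g := 0) (by simpa using hi)

theorem abs_levelWeight_sub_le (x x' : Fin N → ℝ) (y : ℝ) :
    |levelWeight x y - levelWeight x' y| ≤ 20 * N * ‖x - x'‖ *
      ((Set.Iio (ranked x 0)).indicator (fun y => Real.exp (y - ranked x 0)) y +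
        (Set.Iio (ranked x' 0)).indicator (fun y => Real.exp (y - ranked x' 0)) y) := by
  rcases Nat.eq_zero_or_pos N with rfl | hN
  · simp [levelWeight, excess]
  wlog h : excess x y ≤ excess x' y generalizing x x'
  · have := this x' x (not_le.1 h).le
    rwa [abs_sub_comm, norm_sub_rev, add_comm ((Set.Iio (ranked x' 0)).indicator _ y)] at this
  have hd := abs_excess_sub_le x x' y
  have hnn : ∀ z : Fin N → ℝ,
      0 ≤ (Set.Iio (ranked z 0)).indicator (fun y => Real.exp (y - ranked z 0)) y := fun z =>
    Set.indicator_nonneg (fun _ _ => (Real.exp_pos _).le) y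
  rcases lt_or_ge y (ranked x 0) with hy | hy
  · refine (abs_mul_halfDens_sub_le (excess_nonneg x y) le_rfl h).trans ?_
    rw [Set.indicator_of_mem (show y ∈ Set.Iio (ranked x 0) from hy)]
    have h1 := exp_neg_excess_le x y hN
    calc 20 * Real.exp (-excess x y) * |excess x y - excess x' y|
        ≤ 20 * Real.exp (y - ranked x 0) * (N * ‖x - x'‖) := by gcongr
      _ = 20 * N * ‖x - x'‖ * (Real.exp (y - ranked x 0) + 0) := by ring
      _ ≤ _ := by gcongr; exact hnn x'
  · -- here the excess of `x` vanishes, so its exponential gives no decay; that of `x'` is used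
    have h0 := excess_eq_zero_of_le hy
    rw [levelWeight, h0, zero_mul, zero_sub, abs_neg, abs_of_nonneg (levelWeight_nonneg _ _)]
    rw [h0, zero_sub, abs_neg, abs_of_nonneg (excess_nonneg _ _)] at hd
    rcases lt_or_ge y (ranked x' 0) with hy' | hy'
    · rw [Set.indicator_of_mem (show y ∈ Set.Iio (ranked x' 0) from hy')]
      have h1 := exp_neg_excess_le x' y hN
      have h2 := halfDens_le (excess x' y)
      have h3 := excess_nonneg x' y
      calc levelWeight x' y ≤ (N * ‖x - x'‖) * (2 * Real.exp (y - ranked x' 0)) :=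
            mul_le_mul hd (by linarith) (halfDens_pos _).le (by positivity)
        _ ≤ 20 * N * ‖x - x'‖ * (0 + Real.exp (y - ranked x' 0)) := by
            have : 0 ≤ N * ‖x - x'‖ * Real.exp (y - ranked x' 0) := by positivity
            nlinarith
        _ ≤ _ := by gcongr; exact hnn x
    · rw [levelWeight, excess_eq_zero_of_le hy', zero_mul]
      have := hnn x
      have := hnn x'
      positivity

theorem integral_exp_indicator (M : ℝ) :
    ∫ y, (Set.Iio M).indicator (fun y => Real.exp (y - M)) y = 1 := by
  rw [integral_indicator measurableSet_Iio, ← integral_Iic_eq_integral_Iio]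
  simp_rw [sub_eq_add_neg, Real.exp_add]
  rw [integral_mul_const, integral_exp_Iic, ← Real.exp_add]
  simp

/-- The curvature is Lipschitz in the maximum norm. -/
theorem abs_unitCurv_sub_le (hN : 0 < N) (x x' : Fin N → ℝ) :
    |unitCurv x - unitCurv x'| ≤ 40 * N * ‖x - x'‖ := by
  rw [unitCurv_eq hN, unitCurv_eq hN, sub_sub_sub_cancel_left, abs_sub_comm,
    ← integral_sub (integrable_levelWeight hN x) (integrable_levelWeight hN x')]
  have hI := integrable_exp_indicator (ranked x 0)
  have hI' := integrable_exp_indicator (ranked x' 0)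
  refine (norm_integral_le_of_norm_le (f := fun y => levelWeight x y - levelWeight x' y)
    ((hI.add hI').const_mul (20 * N * ‖x - x'‖))
    (ae_of_all _ fun y => abs_levelWeight_sub_le x x' y)).trans ?_
  simp only [Pi.add_apply]
  rw [integral_const_mul, integral_add hI hI', integral_exp_indicator, integral_exp_indicator]
  apply le_of_eq
  ring

theorem continuous_unitCurv (hN : 0 < N) : Continuous (unitCurv (N := N)) :=
  (LipschitzWith.of_dist_le_mul (K := 40 * N) fun x x' => by
    rw [Real.dist_eq, dist_eq_norm]
    exact_mod_cast abs_unitCurv_sub_le hN x x').continuous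

/-! ### The Hessian as a quadratic form -/

/-- The second derivative of the potential at unit time in the direction `v`. -/
def unitQuad (x v : Fin N → ℝ) : ℝ :=
  ∫ y, levelWeight x y *
    ((above x y).card * ∑ i ∈ above x y, v i ^ 2 - (∑ i ∈ above x y, v i) ^ 2)

theorem integrable_unitQuad (hN : 0 < N) (x v : Fin N → ℝ) :
    Integrable fun y => levelWeight x y *
      ((above x y).card * ∑ i ∈ above x y, v i ^ 2 - (∑ i ∈ above x y, v i) ^ 2) :=
  integrable_levelWeight_mul hN x fun S => (S.card : ℝ) * ∑ i ∈ S, v i ^ 2 - (∑ i ∈ S, v i) ^ 2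

/-- The quadratic form of the Hessian, by the identity
`∑ i, ∑ j, (v_i - v_j) v_i = n ∑ v_i² - (∑ v_i)²` on each level. -/
theorem sum_unitHess (hN : 0 < N) (x v : Fin N → ℝ) :
    ∑ i, unitHess i x v * v i = unitQuad x v := by
  have h1 : ∀ i, unitHess i x v * v i = ∫ y, (Set.Iio (x i)).indicator (fun y =>
      levelWeight x y * ((∑ j ∈ above x y, (v i - v j)) * v i)) y := fun i => by
    rw [unitHess_apply, ← integral_mul_const, integral_indicator measurableSet_Iio]
    refine setIntegral_congr_fun measurableSet_Iio fun y _ => ?_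
    rw [← levelWeight]
    ring
  have h2 : ∀ i, Integrable fun y => (Set.Iio (x i)).indicator (fun y =>
      levelWeight x y * ((∑ j ∈ above x y, (v i - v j)) * v i)) y := fun i =>
    (integrable_levelWeight_mul hN x
      fun S => (∑ j ∈ S, (v i - v j)) * v i).indicator measurableSet_Iio
  simp_rw [h1]
  rw [← integral_finsetSum _ fun i _ => h2 i, unitQuad]
  congr 1
  funext y
  have h3 : ∀ i, (Set.Iio (x i)).indicator (fun y =>
      levelWeight x y * ((∑ j ∈ above x y, (v i - v j)) * v i)) y =
      if y < x i then levelWeight x y * ((∑ j ∈ above x y, (v i - v j)) * v i) else 0 := fun i => by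
    simp [Set.indicator_apply]
  simp_rw [h3]
  rw [← Finset.sum_filter, ← above, ← Finset.mul_sum]
  congr 1
  simp_rw [Finset.sum_sub_distrib, Finset.sum_const, nsmul_eq_mul, sub_mul]
  rw [Finset.sum_sub_distrib, ← Finset.mul_sum, sq (∑ j ∈ above x y, v j), Finset.mul_sum]
  congr 1
  rw [Finset.mul_sum]
  exact Finset.sum_congr rfl fun i _ => by ring

theorem hasDerivAt_unitPotential_line (hN : 0 < N) (x v : Fin N → ℝ) (s : ℝ) :
    HasDerivAt (fun s : ℝ => unitPotential (x + s • v))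
      (fderiv ℝ unitPotential (x + s • v) v) s := by
  have h1 : HasDerivAt (fun s : ℝ => x + s • v) v s := by
    simpa using ((hasDerivAt_id s).smul_const v).const_add x
  exact (differentiable_unitPotential hN _).hasFDerivAt.comp_hasDerivAt s h1

theorem hasDerivAt_fderiv_unitPotential_line (hN : 0 < N) (x v : Fin N → ℝ) (s : ℝ) :
    HasDerivAt (fun s : ℝ => fderiv ℝ unitPotential (x + s • v) v)
      (unitQuad (x + s • v) v) s := by
  have h1 : HasDerivAt (fun s : ℝ => x + s • v) v s := by
    simpa using ((hasDerivAt_id s).smul_const v).const_add x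
  simp_rw [fderiv_unitPotential hN]
  rw [← sum_unitHess hN]
  refine HasDerivAt.fun_sum fun i _ => ?_
  exact ((hasFDerivAt_unitGrad i _).comp_hasDerivAt s h1).mul_const (v i)

/-- Taylor's inequality of second order with a one-sided bound on the second derivative. -/
theorem taylor_two_le {f f' f'' : ℝ → ℝ} {B : ℝ} (hf : ∀ s, HasDerivAt f (f' s) s)
    (hf' : ∀ s, HasDerivAt f' (f'' s) s) (hB : ∀ s ∈ Set.Icc (0 : ℝ) 1, f'' s ≤ B) :
    f 1 ≤ f 0 + f' 0 + B / 2 := by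
  have h1 : MonotoneOn (fun s => B * s - f' s) (Set.Icc 0 1) := by
    refine monotoneOn_of_hasDerivWithinAt_nonneg (convex_Icc 0 1) (f' := fun s => B * 1 - f'' s)
      (fun s _ => ?_) (fun s _ => ?_) fun s hs => ?_
    · exact (((hasDerivAt_id s).const_mul B).sub (hf' s)).continuousAt.continuousWithinAt
    · exact (((hasDerivAt_id s).const_mul B).sub (hf' s)).hasDerivWithinAt
    · linarith [hB s (interior_subset hs)]
  have hd : ∀ s, HasDerivAt (fun s => B * s ^ 2 / 2 + f' 0 * s - f s) (B * s + f' 0 - f' s) s := by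
    intro s
    refine ((((hasDerivAt_pow 2 s).const_mul B).div_const 2).add
      ((hasDerivAt_id s).const_mul (f' 0))).sub (hf s) |>.congr_deriv ?_
    simp
    ring
  have h2 : MonotoneOn (fun s => B * s ^ 2 / 2 + f' 0 * s - f s) (Set.Icc 0 1) := by
    refine monotoneOn_of_hasDerivWithinAt_nonneg (convex_Icc 0 1)
      (f' := fun s => B * s + f' 0 - f' s)
      (fun s _ => (hd s).continuousAt.continuousWithinAt) (fun s _ => (hd s).hasDerivWithinAt)
      fun s hs => ?_
    have hs' := interior_subset hs
    have := h1 (Set.left_mem_Icc.2 zero_le_one) hs' hs'.1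
    simp only at this
    linarith
  have := h2 (Set.left_mem_Icc.2 zero_le_one) (Set.right_mem_Icc.2 zero_le_one) zero_le_one
  simp only at this
  linarith

/-! ### The worst direction in the cube -/

theorem convexOn_card_mul_sum_sq_sub (S : Finset (Fin N)) :
    ConvexOn ℝ Set.univ fun v : Fin N → ℝ => S.card * ∑ i ∈ S, v i ^ 2 - (∑ i ∈ S, v i) ^ 2 := by
  refine ⟨convex_univ, fun v _ w _ a b ha hb hab => ?_⟩
  have h := sq_sum_le_card_mul_sum_sq (s := S) (f := fun i => v i - w i)
  have e1 : ∑ i ∈ S, (v i - w i) ^ 2 =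
      ∑ i ∈ S, v i ^ 2 - 2 * ∑ i ∈ S, v i * w i + ∑ i ∈ S, w i ^ 2 := by
    rw [Finset.mul_sum, ← Finset.sum_sub_distrib, ← Finset.sum_add_distrib]
    exact Finset.sum_congr rfl fun i _ => by ring
  have e2 : ∑ i ∈ S, (a • v + b • w) i ^ 2 = a ^ 2 * ∑ i ∈ S, v i ^ 2 +
      2 * a * b * ∑ i ∈ S, v i * w i + b ^ 2 * ∑ i ∈ S, w i ^ 2 := by
    rw [Finset.mul_sum, Finset.mul_sum, Finset.mul_sum, ← Finset.sum_add_distrib,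
      ← Finset.sum_add_distrib]
    exact Finset.sum_congr rfl fun i _ => by simp; ring
  have e3 : ∑ i ∈ S, (a • v + b • w) i = a * ∑ i ∈ S, v i + b * ∑ i ∈ S, w i := by
    rw [Finset.mul_sum, Finset.mul_sum, ← Finset.sum_add_distrib]
    exact Finset.sum_congr rfl fun i _ => by simp
  rw [Finset.sum_sub_distrib, e1] at h
  simp only [smul_eq_mul]
  rw [e2, e3]
  have hab' := mul_nonneg ha hb
  obtain rfl : b = 1 - a := by linarith
  have := mul_nonneg hab' (sub_nonneg.2 h)
  linarith

/-- For `q` in the cube, `n ∑ q_i² - (∑ q_i)²` over `n` indices is at most `n²`, and at most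
`n² - 1` when `n` is odd: by convexity the maximum is at a sign vector. -/
theorem card_mul_sum_sq_sub_le (S : Finset (Fin N)) {q : Fin N → ℝ}
    (hq : ∀ i, q i ∈ Set.Icc (-1 : ℝ) 1) :
    S.card * ∑ i ∈ S, q i ^ 2 - (∑ i ∈ S, q i) ^ 2 ≤
      (S.card : ℝ) ^ 2 - if Even S.card then 0 else 1 := by
  have hmem : q ∈ convexHull ℝ (Set.univ.pi fun _ : Fin N => ({-1, 1} : Set ℝ)) := by
    rw [convexHull_pi]
    intro i _
    rw [convexHull_pair, segment_eq_Icc (by norm_num)]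
    exact hq i
  obtain ⟨w, hw, hle⟩ := (convexOn_card_mul_sum_sq_sub S).exists_ge_of_mem_convexHull
    (Set.subset_univ _) hmem
  refine hle.trans ?_
  have hw' : ∀ i, w i = -1 ∨ w i = 1 := fun i => hw i (Set.mem_univ i)
  have h1 : ∑ i ∈ S, w i ^ 2 = S.card := by
    rw [Finset.sum_congr rfl fun i _ => show w i ^ 2 = 1 by rcases hw' i with h | h <;> simp [h]]
    simp
  rw [h1, ← sq]
  split_ifs with heven
  · nlinarith [sq_nonneg (∑ i ∈ S, w i)]
  · -- with an odd number of signs, the sum is an odd integer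
    have h2 : ∃ m : ℤ, ∑ i ∈ S, w i = 2 * m + S.card := by
      have h3 : ∀ i, ∃ m : ℤ, w i = 2 * m + 1 := fun i => by
        rcases hw' i with h | h
        · exact ⟨-1, by rw [h]; norm_num⟩
        · exact ⟨0, by rw [h]; norm_num⟩
      choose m hm using h3
      refine ⟨∑ i ∈ S, m i, ?_⟩
      rw [Finset.sum_congr rfl fun i _ => hm i, Finset.sum_add_distrib, ← Finset.mul_sum]
      simp
    obtain ⟨m, hm⟩ := h2
    have h4 : (2 * m + S.card : ℤ) ≠ 0 := fun h0 => heven <| by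
      have : Even ((S.card : ℤ)) := ⟨-m, by omega⟩
      exact_mod_cast this
    have h5 : (1 : ℤ) ≤ (2 * m + S.card : ℤ) ^ 2 := by
      have := pow_pos (abs_pos.2 h4) 2
      rw [sq_abs] at this
      omega
    have h6 : (1 : ℝ) ≤ (∑ i ∈ S, w i) ^ 2 := by
      rw [hm]; exact_mod_cast h5
    linarith

/-- The ratio `κ_m δ / (1 - δ)`. -/
def cubeFactor (N : ℕ) : ℝ :=
  if Even N then (N : ℝ) ^ 2 / (2 * ((N : ℝ) - 1)) else ((N : ℝ) + 1) / 2

theorem kappaUpper_eq (N : ℕ) (δ : ℝ) : kappaUpper N δ = (1 - δ) / δ * cubeFactor N := by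
  unfold kappaUpper cubeFactor
  split_ifs <;> rfl

theorem one_le_cubeFactor (hN : 0 < N) : 1 ≤ cubeFactor N := by
  have h1 : (1 : ℝ) ≤ N := by exact_mod_cast hN
  unfold cubeFactor
  split_ifs with h
  · have h2 : (2 : ℝ) ≤ N := by
      have : 2 ≤ N := by obtain ⟨k, hk⟩ := h; omega
      exact_mod_cast this
    rw [le_div_iff₀ (by linarith)]
    nlinarith
  · linarith

/-- The two cases of `κ_m` are the suprema of `n² / (2 (n - 1))` over even `n ≤ N` and of
`(n² - 1) / (2 (n - 1)) = (n + 1) / 2` over odd `n ≤ N`, whichever is larger. -/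
theorem sq_sub_le_cubeFactor {n : ℕ} (hn : 0 < n) (hnN : n ≤ N) :
    (n : ℝ) ^ 2 - (if Even n then 0 else 1) ≤ 2 * cubeFactor N * (n - 1) := by
  have h1 : (1 : ℝ) ≤ n := by exact_mod_cast hn
  have h2 : (n : ℝ) ≤ N := by exact_mod_cast hnN
  unfold cubeFactor
  split_ifs with he hE hE
  · have h3 : (2 : ℝ) ≤ n := by
      have : 2 ≤ n := by obtain ⟨k, hk⟩ := he; omega
      exact_mod_cast this
    have h4 : 0 < (N : ℝ) - 1 := by linarith
    rw [show 2 * ((N : ℝ) ^ 2 / (2 * (N - 1))) * (n - 1) = N ^ 2 * (n - 1) / (N - 1) by field_simp,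
      le_div_iff₀ h4]
    have h5 : 0 ≤ ((N : ℝ) - n) * (n * N - N - n) :=
      mul_nonneg (by linarith) (by nlinarith)
    nlinarith
  · have h3 : (2 : ℝ) ≤ n := by
      have : 2 ≤ n := by obtain ⟨k, hk⟩ := he; omega
      exact_mod_cast this
    have h4 : (n : ℝ) + 1 ≤ N := by
      have : n + 1 ≤ N := by
        rcases hnN.lt_or_eq with h | h
        · exact h
        · exact absurd (h ▸ he) hE
      exact_mod_cast this
    nlinarith
  · have h4 : (n : ℝ) + 1 ≤ N := by
      have : n + 1 ≤ N := by
        rcases hnN.lt_or_eq with h | h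
        · exact h
        · exact absurd (h ▸ hE) he
      exact_mod_cast this
    have h5 : 0 < (N : ℝ) - 1 := by linarith
    have h6 : (n : ℝ) + 1 ≤ 2 * ((N : ℝ) ^ 2 / (2 * (N - 1))) := by
      rw [show 2 * ((N : ℝ) ^ 2 / (2 * (N - 1))) = N ^ 2 / (N - 1) by field_simp,
        le_div_iff₀ h5]
      nlinarith
    nlinarith
  · nlinarith

/-- In a direction `c q` with `q` in the cube, the second derivative is at most
`2 c² cubeFactor N` times the largest pure second derivative. The inequality holds level by level,
where it only depends on the number of coordinates above the level. -/
theorem unitQuad_le (hN : 0 < N) (x : Fin N → ℝ) {q : Fin N → ℝ}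
    (hq : ∀ i, q i ∈ Set.Icc (-1 : ℝ) 1) (c : ℝ) :
    unitQuad x (c • q) ≤ 2 * cubeFactor N * c ^ 2 * unitCurv x := by
  rw [unitQuad, unitCurv_eq_integral hN, ← integral_const_mul]
  refine integral_mono (integrable_unitQuad hN x _)
    ((integrable_levelWeight_mul hN x fun S => ((S.card - 1 : ℕ) : ℝ)).const_mul _) fun y => ?_
  set S := above x y
  have e1 : (S.card : ℝ) * ∑ i ∈ S, (c • q) i ^ 2 - (∑ i ∈ S, (c • q) i) ^ 2 =
      c ^ 2 * (S.card * ∑ i ∈ S, q i ^ 2 - (∑ i ∈ S, q i) ^ 2) := by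
    simp only [Pi.smul_apply, smul_eq_mul, mul_pow]
    rw [← Finset.mul_sum, ← Finset.mul_sum]
    ring
  have e2 : (S.card : ℝ) * ∑ i ∈ S, q i ^ 2 - (∑ i ∈ S, q i) ^ 2 ≤
      2 * cubeFactor N * ((S.card - 1 : ℕ) : ℝ) := by
    rcases Finset.eq_empty_or_nonempty S with h | h
    · simp [h]
    · rw [Nat.cast_pred h.card_pos]
      refine (card_mul_sum_sq_sub_le S hq).trans (sq_sub_le_cubeFactor h.card_pos ?_)
      simpa using Finset.card_le_univ S
  simp only
  rw [e1]
  calc levelWeight x y * (c ^ 2 * (S.card * ∑ i ∈ S, q i ^ 2 - (∑ i ∈ S, q i) ^ 2))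
      ≤ levelWeight x y * (c ^ 2 * (2 * cubeFactor N * ((S.card - 1 : ℕ) : ℝ))) := by
        have := levelWeight_nonneg x y
        gcongr
    _ = _ := by ring

/-- The directions `±c q^m` of the max adversary only see the pure second derivative. -/
theorem unitQuad_maxVector (x : Fin N → ℝ) (k : Fin N) (c : ℝ) :
    unitQuad x (c • maxVector k) = 4 * c ^ 2 * unitHess k x (Pi.single k 1) := by
  rw [unitQuad, unitHess_single, ← integral_const_mul]
  congr 1
  funext y
  set S := above x y with hS
  have h1 : ∑ i ∈ S, (c • maxVector k) i ^ 2 = c ^ 2 * S.card := by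
    rw [Finset.sum_congr rfl fun i _ => show (c • maxVector k) i ^ 2 = c ^ 2 by
      simp only [Pi.smul_apply, maxVector, smul_eq_mul]; split_ifs <;> ring]
    simp [mul_comm]
  have h2 : ∑ i ∈ S, (c • maxVector k) i = c * (2 * (if k ∈ S then 1 else 0) - S.card) := by
    have : ∀ i, (c • maxVector k) i = c * (2 * (if i = k then 1 else 0) - 1) := fun i => by
      simp only [Pi.smul_apply, maxVector, smul_eq_mul]; split_ifs <;> ring
    simp_rw [this]
    rw [← Finset.mul_sum, Finset.sum_sub_distrib, ← Finset.mul_sum, Finset.sum_ite_eq']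
    simp
  rw [h1, h2]
  by_cases hk : y < x k
  · have hkS : k ∈ S := mem_above.2 hk
    rw [Set.indicator_of_mem (show y ∈ Set.Iio (x k) from hk), if_pos hkS,
      Nat.cast_pred (Finset.card_pos.2 ⟨k, hkS⟩)]
    ring
  · rw [Set.indicator_of_notMem (show y ∉ Set.Iio (x k) from hk),
      if_neg (fun h => hk (mem_above.1 h))]
    ring

theorem norm_smul_le_of_cube {q : Fin N → ℝ} (hq : ∀ i, q i ∈ Set.Icc (-1 : ℝ) 1) (c : ℝ) :
    ‖c • q‖ ≤ |c| := by
  rw [norm_smul, Real.norm_eq_abs]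
  refine mul_le_of_le_one_right (abs_nonneg c)
    ((pi_norm_le_iff_of_nonneg zero_le_one).2 fun i => ?_)
  exact abs_le.2 (hq i)

/-- The Taylor estimate for a step `c q` with `q` in the cube. -/
theorem unitPotential_add_le (hN : 0 < N) (x : Fin N → ℝ) {q : Fin N → ℝ}
    (hq : ∀ i, q i ∈ Set.Icc (-1 : ℝ) 1) {c : ℝ} (hc : 0 ≤ c) :
    unitPotential (x + c • q) ≤ unitPotential x + fderiv ℝ unitPotential x (c • q) +
      cubeFactor N * c ^ 2 * (unitCurv x + 40 * N * c) := by
  have h := taylor_two_le (hasDerivAt_unitPotential_line hN x (c • q))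
    (hasDerivAt_fderiv_unitPotential_line hN x (c • q))
    (B := 2 * cubeFactor N * c ^ 2 * (unitCurv x + 40 * N * c)) fun s hs => ?_
  · simp only [one_smul, zero_smul, add_zero] at h
    linarith
  · refine (unitQuad_le hN _ hq c).trans ?_
    have h1 := (abs_le.1 (abs_unitCurv_sub_le hN (x + s • c • q) x)).2
    have h2 := norm_smul_le_of_cube hq c
    have h3 : ‖s • c • q‖ ≤ c := by
      rw [norm_smul, Real.norm_eq_abs, abs_of_nonneg hs.1]
      rw [abs_of_nonneg hc] at h2
      nlinarith [hs.2, norm_nonneg (c • q)]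
    rw [add_sub_cancel_left] at h1
    have h4 := one_le_cubeFactor hN
    have h5 : 40 * (N : ℝ) * ‖s • c • q‖ ≤ 40 * N * c := by gcongr
    have h6 : unitCurv (x + s • c • q) ≤ unitCurv x + 40 * N * c := by linarith
    gcongr

theorem maxVector_mem (k i : Fin N) : maxVector k i ∈ Set.Icc (-1 : ℝ) 1 := by
  unfold maxVector
  split_ifs <;> simp

/-- The Taylor estimate for a step of the max adversary, in either direction. -/
theorem le_unitPotential_add_maxVector (hN : 0 < N) {x : Fin N → ℝ} {k : Fin N}
    (hk : ∀ j, x j ≤ x k) {c : ℝ} :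
    unitPotential x + fderiv ℝ unitPotential x (c • maxVector k) +
      2 * c ^ 2 * (unitCurv x - 80 * N * |c|) ≤ unitPotential (x + c • maxVector k) := by
  have h := taylor_two_le (fun s => (hasDerivAt_unitPotential_line hN x (c • maxVector k) s).neg)
    (fun s => (hasDerivAt_fderiv_unitPotential_line hN x (c • maxVector k) s).neg)
    (B := -(4 * c ^ 2 * (unitCurv x - 80 * N * |c|))) fun s hs => ?_
  · simp only [Pi.neg_apply, one_smul, zero_smul, add_zero] at h
    linarith
  · rw [unitQuad_maxVector, neg_le_neg_iff]
    set x' := x + s • c • maxVector k with hx'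
    have h1 := (abs_le.1 (abs_unitCurv_sub_le hN x' x)).1
    have h2 := norm_smul_le_of_cube (maxVector_mem k) c
    have h3 : ‖s • c • maxVector k‖ ≤ |c| := by
      rw [norm_smul, Real.norm_eq_abs, abs_of_nonneg hs.1]
      nlinarith [hs.2, norm_nonneg (c • maxVector k), abs_nonneg c]
    rw [hx', add_sub_cancel_left, ← hx'] at h1
    have h5 : 40 * (N : ℝ) * ‖s • c • maxVector k‖ ≤ 40 * N * |c| := by gcongr
    -- along the step, a coordinate gains at most `2 |c|` on the former leader `k`
    have h6 := unitCurv_sub_le_unitHess hN k x' (g := 2 * |c|) fun j => by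
      have e : ∀ i, x' i = x i + s * (c * maxVector k i) := fun i => by simp [hx']
      have h7 : s * c ≤ |c| ∧ -|c| ≤ s * c := by
        rw [and_comm, ← abs_le, abs_mul, abs_of_nonneg hs.1]
        nlinarith [hs.2, abs_nonneg c]
      rw [e, e]
      have h8 := hk j
      unfold maxVector
      rw [if_pos rfl]
      split_ifs with hj
      · subst hj; linarith [abs_nonneg c]
      · linarith
    have h9 : unitCurv x - 80 * N * |c| ≤ unitHess k x' (Pi.single k 1) := by linarith
    gcongr

/-! ### The max potential -/

theorem ranked_smul {c : ℝ} (hc : 0 ≤ c) (x : Fin N → ℝ) (n : ℕ) :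
    ranked (c • x) n = c * ranked x n := by
  by_cases hn : n < N
  · rw [ranked_eq (x := c • x) (σ := Tuple.sort fun i => -x i) _ hn, ranked, dif_pos hn]
    · rfl
    · intro i j hij
      exact mul_le_mul_of_nonneg_left (antitone_comp_sort x hij) hc
  · simp [ranked, hn]

theorem ranked_add_const (x : Fin N → ℝ) (c : ℝ) {n : ℕ} (hn : n < N) :
    ranked (x + fun _ => c) n = ranked x n + c := by
  rw [ranked_eq (x := x + fun _ => c) (σ := Tuple.sort fun i => -x i) _ hn, ranked, dif_pos hn]
  · rfl
  · intro i j hij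
    exact add_le_add_left (antitone_comp_sort x hij) c

theorem rankGap_smul {c : ℝ} (hc : 0 ≤ c) (x : Fin N → ℝ) (l : ℕ) :
    rankGap (c • x) l = c * rankGap x l := by
  simp only [rankGap, ranked_smul hc, mul_sub, Finset.mul_sum]
  ring

theorem rankGap_add_const (x : Fin N → ℝ) (c : ℝ) {l : ℕ} (hl : l < N) :
    rankGap (x + fun _ => c) l = rankGap x l := by
  rw [rankGap, rankGap, ranked_add_const x c hl, Finset.sum_congr rfl fun n hn =>
    ranked_add_const x c ((Finset.mem_range.1 hn).trans hl), Finset.sum_add_distrib]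
  simp
  ring

/-- The spatial scale `√(-2κt)` of the potential at time `t`. -/
def timeScale (κ t : ℝ) : ℝ := √(-2 * κ * t)

theorem timeScale_pos {κ t : ℝ} (hκ : 0 < κ) (ht : t < 0) : 0 < timeScale κ t :=
  Real.sqrt_pos.2 (by nlinarith)

theorem timeScale_sq {κ t : ℝ} (hκ : 0 < κ) (ht : t < 0) : timeScale κ t ^ 2 = 2 * κ * -t := by
  rw [timeScale, Real.sq_sqrt (by nlinarith)]
  ring

theorem continuous_timeScale (κ : ℝ) : Continuous (timeScale κ) := by
  unfold timeScale; fun_prop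

theorem hasDerivAt_timeScale {κ t : ℝ} (hκ : 0 < κ) (ht : t < 0) :
    HasDerivAt (timeScale κ) (-(κ / timeScale κ t)) t := by
  have h := ((hasDerivAt_id t).const_mul (-2 * κ)).sqrt (by simp only [id]; nlinarith)
  refine h.congr_deriv ?_
  simp only [id]
  rw [← timeScale]
  have := (timeScale_pos hκ ht).ne'
  field_simp

theorem maxPotential_eq_rankGap (κ : ℝ) (x : Fin N → ℝ) (t : ℝ) :
    maxPotential N κ x t = 1 / (N : ℝ) * ∑ i, x i + ∑ l ∈ Finset.Ico 1 N,
      1 / ((l : ℝ) * (l + 1)) * (timeScale κ t * profile (rankGap x l / timeScale κ t)) := by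
  rw [maxPotential, Finset.mul_sum (Finset.Ico 1 N)]
  congr 1
  refine Finset.sum_congr rfl fun l _ => ?_
  rw [rankArg, ← rankGap, ← timeScale]
  ring

/-- The potential is self-similar. -/
theorem maxPotential_eq {κ t : ℝ} (hκ : 0 < κ) (ht : t < 0) (x : Fin N → ℝ) :
    maxPotential N κ x t = timeScale κ t * unitPotential ((timeScale κ t)⁻¹ • x) := by
  have hs := timeScale_pos hκ ht
  rw [maxPotential_eq_rankGap, unitPotential, rankSum, mul_add, Finset.mul_sum (Finset.Ico 1 N)]
  congr 1
  · have : ∑ i, ((timeScale κ t)⁻¹ • x) i = (timeScale κ t)⁻¹ * ∑ i, x i := by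
      simp [Finset.mul_sum]
    rw [this]
    field_simp
  · refine Finset.sum_congr rfl fun l _ => ?_
    rw [rankGap_smul (inv_pos.2 hs).le, inv_mul_eq_div]
    ring

theorem maxPotential_add_const (hN : 0 < N) (κ : ℝ) (x : Fin N → ℝ) (t c : ℝ) :
    maxPotential N κ (x + fun _ => c) t = maxPotential N κ x t + c := by
  have hNr : (N : ℝ) ≠ 0 := by positivity
  rw [maxPotential_eq_rankGap, maxPotential_eq_rankGap]
  have h1 : ∑ i, (x + fun _ => c : Fin N → ℝ) i = ∑ i, x i + N * c := by
    simp [Finset.sum_add_distrib]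
  rw [h1, Finset.sum_congr (s₁ := Finset.Ico 1 N) rfl fun l hl => by
    rw [rankGap_add_const x c (Finset.mem_Ico.1 hl).2]]
  field_simp
  ring

theorem hasFDerivAt_maxPotential (hN : 0 < N) {κ t : ℝ} (hκ : 0 < κ) (ht : t < 0)
    (x : Fin N → ℝ) :
    HasFDerivAt (fun x => maxPotential N κ x t)
      (fderiv ℝ unitPotential ((timeScale κ t)⁻¹ • x)) x := by
  have hs := (timeScale_pos hκ ht).ne'
  have h0 : (fun x => maxPotential N κ x t) =
      fun x => timeScale κ t * unitPotential ((timeScale κ t)⁻¹ • x) :=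
    funext fun x => maxPotential_eq hκ ht x
  rw [h0]
  have h1 : HasFDerivAt (fun x : Fin N → ℝ => (timeScale κ t)⁻¹ • x)
      ((timeScale κ t)⁻¹ • ContinuousLinearMap.id ℝ (Fin N → ℝ)) x :=
    (ContinuousLinearMap.id ℝ (Fin N → ℝ)).hasFDerivAt.const_smul (timeScale κ t)⁻¹
  have h2 := ((differentiable_unitPotential hN _).hasFDerivAt.comp x h1).const_mul (timeScale κ t)
  refine h2.congr_fderiv ?_
  ext v
  simp [hs]

theorem partialDeriv_maxPotential (hN : 0 < N) {κ t : ℝ} (hκ : 0 < κ) (ht : t < 0) (i : Fin N) :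
    partialDeriv i (fun x => maxPotential N κ x t) =
      fun x => unitGrad i ((timeScale κ t)⁻¹ • x) := by
  funext x
  rw [partialDeriv, (hasFDerivAt_maxPotential hN hκ ht x).fderiv, fderiv_unitPotential_single hN]

theorem partialDeriv_partialDeriv_maxPotential (hN : 0 < N) {κ t : ℝ} (hκ : 0 < κ) (ht : t < 0)
    (i : Fin N) (x : Fin N → ℝ) :
    partialDeriv i (partialDeriv i fun x => maxPotential N κ x t) x =
      (timeScale κ t)⁻¹ * unitHess i ((timeScale κ t)⁻¹ • x) (Pi.single i 1) := by
  rw [partialDeriv_maxPotential hN hκ ht, partialDeriv]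
  have h1 : HasFDerivAt (fun x : Fin N → ℝ => (timeScale κ t)⁻¹ • x)
      ((timeScale κ t)⁻¹ • ContinuousLinearMap.id ℝ (Fin N → ℝ)) x :=
    (ContinuousLinearMap.id ℝ (Fin N → ℝ)).hasFDerivAt.const_smul (timeScale κ t)⁻¹
  have h2 := (hasFDerivAt_unitGrad i _).comp x h1
  rw [show (fun x => unitGrad i ((timeScale κ t)⁻¹ • x)) =
    unitGrad i ∘ fun x => (timeScale κ t)⁻¹ • x from rfl, h2.fderiv]
  simp

/-- Each rank contributes `σ f(Z / σ)` with `σ = √(-2κt)`, whose derivative in `σ` is `ρ(Z / σ)`,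
since `f(z) - z f'(z)` is the half-normal density. -/
theorem hasDerivAt_maxPotential {κ t : ℝ} (hκ : 0 < κ) (ht : t < 0) (x : Fin N → ℝ) :
    HasDerivAt (maxPotential N κ x)
      (-(κ * ((timeScale κ t)⁻¹ * unitCurv ((timeScale κ t)⁻¹ • x)))) t := by
  have hs := timeScale_pos hκ ht
  have h0 : maxPotential N κ x = fun t => 1 / (N : ℝ) * ∑ i, x i + ∑ l ∈ Finset.Ico 1 N,
      1 / ((l : ℝ) * (l + 1)) * (timeScale κ t * profile (rankGap x l / timeScale κ t)) :=
    funext fun t => maxPotential_eq_rankGap κ x t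
  rw [h0]
  have h1 : ∀ l, HasDerivAt (fun t => timeScale κ t * profile (rankGap x l / timeScale κ t))
      (-(κ / timeScale κ t) * halfDens (rankGap x l / timeScale κ t)) t := fun l => by
    have h2 := hasDerivAt_timeScale hκ ht
    have h3 := (hasDerivAt_const t (rankGap x l)).div h2 hs.ne'
    refine (h2.mul ((hasDerivAt_profile _).comp t h3)).congr_deriv ?_
    simp only [Pi.div_apply, Function.comp_apply]
    rw [profile_eq]
    field_simp
    ring
  refine ((HasDerivAt.fun_sum fun l _ =>
    (h1 l).const_mul (1 / ((l : ℝ) * (l + 1)))).const_add _).congr_deriv ?_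
  rw [unitCurv, rankSum, Finset.mul_sum, Finset.mul_sum, ← Finset.sum_neg_distrib]
  refine Finset.sum_congr rfl fun l _ => ?_
  rw [rankGap_smul (inv_pos.2 hs).le, inv_mul_eq_div]
  ring_nf

/-- The identity in place of the profile gives the maximum. -/
theorem rankSum_id (hN : 0 < N) (x : Fin N → ℝ) :
    1 / (N : ℝ) * ∑ i, x i + rankSum (fun h => h) x = ⨆ i, x i := by
  have h := intervalIntegral_comp_excess (φ := fun _ => 1) (Φ := fun h => h)
    (fun h => hasDerivAt_id h) continuous_const x (m := N - 1) (by omega)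
  have hNr : (N : ℝ) ≠ 0 := by positivity
  have h1 : rankGap x (N - 1) = ∑ i, x i - N * ranked x (N - 1) := by
    rw [← sum_ranked x (fun u => u), rankGap]
    obtain ⟨m, rfl⟩ : ∃ m, N = m + 1 := ⟨N - 1, by omega⟩
    rw [Finset.sum_range_succ]
    simp
    ring
  rw [Nat.sub_add_cancel hN, h1, Nat.cast_sub hN] at h
  rw [← ranked_zero hN, rankSum]
  simp only [intervalIntegral.integral_const, smul_eq_mul, mul_one, Nat.cast_one,
    sub_add_cancel, sub_zero] at h
  rw [sub_eq_iff_eq_add.1 h]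
  field_simp
  ring

theorem sum_inv_mul_succ (hN : 0 < N) :
    ∑ l ∈ Finset.Ico 1 N, 1 / ((l : ℝ) * (l + 1)) = ((N : ℝ) - 1) / N := by
  induction N, hN using Nat.le_induction with
  | base => simp
  | succ n hn ih =>
    have : (0 : ℝ) < n := by exact_mod_cast hn
    rw [Finset.sum_Ico_succ_top hn, ih]
    push_cast
    field_simp
    ring

theorem iSup_le_maxPotential (hN : 0 < N) {κ t : ℝ} (hκ : 0 < κ) (ht : t < 0) (x : Fin N → ℝ) :
    ⨆ i, x i ≤ maxPotential N κ x t := by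
  have hs := timeScale_pos hκ ht
  rw [← rankSum_id hN x, maxPotential_eq_rankGap, rankSum]
  gcongr with l hl
  have := mul_le_mul_of_nonneg_left (le_profile (rankGap x l / timeScale κ t)) hs.le
  rwa [mul_div_cancel₀ _ hs.ne'] at this

theorem maxPotential_le (hN : 0 < N) {κ t : ℝ} (hκ : 0 < κ) (ht : t < 0) (x : Fin N → ℝ) :
    maxPotential N κ x t ≤ (⨆ i, x i) + timeScale κ t * (√(2 / Real.pi) * (((N : ℝ) - 1) / N)) := by
  have hs := timeScale_pos hκ ht
  rw [← rankSum_id hN x, maxPotential_eq_rankGap, rankSum, ← sum_inv_mul_succ hN, add_assoc,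
    Finset.mul_sum (Finset.Ico 1 N), Finset.mul_sum (Finset.Ico 1 N), ← Finset.sum_add_distrib]
  gcongr with l hl
  have h0 := rankGap_nonneg x (Finset.mem_Ico.1 hl).2
  have h1 := mul_le_mul_of_nonneg_left (profile_le (div_nonneg h0 hs.le)) hs.le
  rw [mul_add, mul_div_cancel₀ _ hs.ne'] at h1
  have h2 : (0 : ℝ) ≤ 1 / ((l : ℝ) * (l + 1)) := by positivity
  calc _ ≤ 1 / ((l : ℝ) * (l + 1)) * (rankGap x l + timeScale κ t * √(2 / Real.pi)) := by gcongr
    _ = _ := by ring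

theorem abs_iSup_sub_le (hN : 0 < N) (x y : Fin N → ℝ) :
    |(⨆ i, x i) - ⨆ i, y i| ≤ ‖x - y‖ := by
  have : Nonempty (Fin N) := ⟨⟨0, hN⟩⟩
  have h : ∀ x y : Fin N → ℝ, (⨆ i, x i) ≤ (⨆ i, y i) + ‖x - y‖ := fun x y => by
    refine ciSup_le fun i => ?_
    have h1 := le_ciSup (Set.finite_range y).bddAbove i
    have h2 := (abs_le.1 (norm_le_pi_norm (x - y) i)).2
    rw [Pi.sub_apply] at h2
    linarith
  rw [abs_le]
  have h1 := h x y
  have h2 := h y x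
  rw [norm_sub_rev] at h2
  constructor <;> linarith

theorem continuous_iSup_coord (hN : 0 < N) : Continuous fun x : Fin N → ℝ => ⨆ i, x i :=
  (LipschitzWith.of_dist_le_mul (K := 1) fun x x' => by
    rw [Real.dist_eq, dist_eq_norm, NNReal.coe_one, one_mul]
    exact abs_iSup_sub_le hN x x').continuous

theorem exists_argmax (hN : 0 < N) (x : Fin N → ℝ) : ∃ i, ∀ j, x j ≤ x i := by
  have : Nonempty (Fin N) := ⟨⟨0, hN⟩⟩
  exact Finite.exists_max x

/-- The maximum of the pure second derivatives is attained at a leading coordinate, where it equals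
the curvature that also governs the time derivative. -/
theorem isClassicalMaxSolution_maxPotential (hN : 0 < N) {κ : ℝ} (hκ : 0 < κ) :
    IsClassicalMaxSolution N κ (maxPotential N κ) where
  contDiff_space t ht := by
    rw [show (fun x => maxPotential N κ x t) =
      fun x => timeScale κ t * unitPotential ((timeScale κ t)⁻¹ • x) from
        funext fun x => maxPotential_eq hκ ht x]
    exact contDiff_const.mul ((contDiff_unitPotential hN).comp (contDiff_id.const_smul _))
  differentiable_time x t ht := (hasDerivAt_maxPotential hκ ht x).differentiableAt
  continuous_time := by
    have h : ContinuousOn (fun y : (Fin N → ℝ) × ℝ =>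
        -(κ * ((timeScale κ y.2)⁻¹ * unitCurv ((timeScale κ y.2)⁻¹ • y.1))))
        (Set.univ ×ˢ Set.Iio 0) := by
      have h1 : ContinuousOn (fun y : (Fin N → ℝ) × ℝ => (timeScale κ y.2)⁻¹)
          (Set.univ ×ˢ Set.Iio 0) :=
        ((continuous_timeScale κ).comp continuous_snd).continuousOn.inv₀
          fun y hy => (timeScale_pos hκ hy.2).ne'
      exact (continuousOn_const.mul (h1.mul ((continuous_unitCurv hN).comp_continuousOn
        (h1.smul continuousOn_fst)))).neg
    exact h.congr fun y hy => (hasDerivAt_maxPotential hκ hy.2 y.1).deriv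
  continuous_space i := by
    have h : ContinuousOn (fun y : (Fin N → ℝ) × ℝ =>
        (timeScale κ y.2)⁻¹ * unitHess i ((timeScale κ y.2)⁻¹ • y.1) (Pi.single i 1))
        (Set.univ ×ˢ Set.Iio 0) := by
      have h1 : ContinuousOn (fun y : (Fin N → ℝ) × ℝ => (timeScale κ y.2)⁻¹)
          (Set.univ ×ˢ Set.Iio 0) :=
        ((continuous_timeScale κ).comp continuous_snd).continuousOn.inv₀
          fun y hy => (timeScale_pos hκ hy.2).ne'
      exact h1.mul (((continuous_unitHess i).comp_continuousOn
        (h1.smul continuousOn_fst)).clm_apply continuousOn_const)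
    exact h.congr fun y hy => partialDeriv_partialDeriv_maxPotential hN hκ hy.2 i y.1
  equation x t ht := by
    have : Nonempty (Fin N) := ⟨⟨0, hN⟩⟩
    have hs := inv_pos.2 (timeScale_pos hκ ht)
    set z := (timeScale κ t)⁻¹ • x with hz
    have h1 : ⨆ i, partialDeriv i (partialDeriv i fun y => maxPotential N κ y t) x =
        (timeScale κ t)⁻¹ * unitCurv z := by
      simp_rw [partialDeriv_partialDeriv_maxPotential hN hκ ht]
      refine le_antisymm (ciSup_le fun i => ?_) ?_
      · exact mul_le_mul_of_nonneg_left (unitHess_single_le hN i _) hs.le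
      · obtain ⟨k, hk⟩ := exists_argmax hN z
        rw [← unitHess_single_eq hN hk]
        exact le_ciSup (f := fun i => (timeScale κ t)⁻¹ * unitHess i z (Pi.single i 1))
          (Set.finite_range _).bddAbove k
    rw [h1, (hasDerivAt_maxPotential hκ ht x).deriv]
    ring
  final x := by
    have hsup : Tendsto (fun y : (Fin N → ℝ) × ℝ => ⨆ i, y.1 i) (𝓝 x ×ˢ 𝓝[<] 0)
        (𝓝 (⨆ i, x i)) := ((continuous_iSup_coord hN).tendsto x).comp tendsto_fst
    have hsc : Tendsto (fun y : (Fin N → ℝ) × ℝ => timeScale κ y.2) (𝓝 x ×ˢ 𝓝[<] 0) (𝓝 0) := by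
      have h1 : Tendsto (timeScale κ) (𝓝[<] 0) (𝓝 0) := by
        have := (continuous_timeScale κ).tendsto 0
        rw [show timeScale κ 0 = 0 by simp [timeScale]] at this
        exact this.mono_left nhdsWithin_le_nhds
      exact h1.comp tendsto_snd
    have hneg : ∀ᶠ y : (Fin N → ℝ) × ℝ in 𝓝 x ×ˢ 𝓝[<] 0, y.2 < 0 :=
      tendsto_snd.eventually (self_mem_nhdsWithin : ∀ᶠ t : ℝ in 𝓝[<] 0, t ∈ Set.Iio 0)
    refine tendsto_of_tendsto_of_tendsto_of_le_of_le' hsup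
      (h := fun y : (Fin N → ℝ) × ℝ => (⨆ i, y.1 i) +
        timeScale κ y.2 * (√(2 / Real.pi) * (((N : ℝ) - 1) / N))) ?_
      (hneg.mono fun y hy => iSup_le_maxPotential hN hκ hy y.1)
      (hneg.mono fun y hy => maxPotential_le hN hκ hy y.1)
    simpa using hsup.add (hsc.mul_const (√(2 / Real.pi) * (((N : ℝ) - 1) / N)))

/-- The effect of one round with losses `q`, in terms of the time derivative. -/
theorem maxPotential_add_le (hN : 0 < N) {κ t : ℝ} (hκ : 0 < κ) (ht : t < 0) (x : Fin N → ℝ)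
    {q : Fin N → ℝ} (hq : ∀ i, q i ∈ Set.Icc (-1 : ℝ) 1) :
    maxPotential N κ (x + q) t ≤ maxPotential N κ x t +
      fderiv ℝ (fun x => maxPotential N κ x t) x q -
      cubeFactor N / κ * deriv (maxPotential N κ x) t + 20 * N * cubeFactor N / κ * (-t)⁻¹ := by
  have hs := timeScale_pos hκ ht
  have hsq := timeScale_sq hκ ht
  rw [(hasFDerivAt_maxPotential hN hκ ht x).fderiv, (hasDerivAt_maxPotential hκ ht x).deriv,
    maxPotential_eq hκ ht, maxPotential_eq hκ ht, smul_add]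
  have h := mul_le_mul_of_nonneg_left (unitPotential_add_le hN ((timeScale κ t)⁻¹ • x) hq
    (inv_pos.2 hs).le) hs.le
  rw [map_smul, smul_eq_mul] at h
  refine h.trans (le_of_eq ?_)
  have ht' : (-t)⁻¹ = 2 * κ / timeScale κ t ^ 2 := by
    rw [hsq]
    have : -t ≠ 0 := by linarith
    field_simp
  rw [ht']
  field_simp
  ring

/-- The effect of one round of the max adversary, in terms of the time derivative. -/
theorem le_maxPotential_add_maxVector (hN : 0 < N) {κ t : ℝ} (hκ : 0 < κ) (ht : t < 0)
    {x : Fin N → ℝ} {k : Fin N} (hk : ∀ j, x j ≤ x k) {ε : ℝ} (hε : |ε| = 1) :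
    maxPotential N κ x t + fderiv ℝ (fun x => maxPotential N κ x t) x (ε • maxVector k) -
      2 / κ * deriv (maxPotential N κ x) t - 80 * N / κ * (-t)⁻¹ ≤
      maxPotential N κ (x + ε • maxVector k) t := by
  have hs := timeScale_pos hκ ht
  have hsq := timeScale_sq hκ ht
  rw [(hasFDerivAt_maxPotential hN hκ ht x).fderiv, (hasDerivAt_maxPotential hκ ht x).deriv,
    maxPotential_eq hκ ht, maxPotential_eq hκ ht, smul_add]
  have hk' : ∀ j, ((timeScale κ t)⁻¹ • x) j ≤ ((timeScale κ t)⁻¹ • x) k := fun j =>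
    mul_le_mul_of_nonneg_left (hk j) (inv_pos.2 hs).le
  have h := mul_le_mul_of_nonneg_left (le_unitPotential_add_maxVector hN hk'
    (c := (timeScale κ t)⁻¹ * ε)) hs.le
  rw [abs_mul, hε, mul_one, abs_of_pos (inv_pos.2 hs), mul_pow, ← sq_abs ε, hε, one_pow, mul_one,
    mul_smul, map_smul, smul_eq_mul] at h
  refine (le_of_eq ?_).trans h
  have ht' : (-t)⁻¹ = 2 * κ / timeScale κ t ^ 2 := by
    rw [hsq]
    have : -t ≠ 0 := by linarith
    field_simp
  rw [ht']
  field_simp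
  ring

/-! ### The Laplace transform in time -/

/-- The average `e^δ ∫_{-∞}^{-δ} e^t g(t) dt` of `g` against the exponential law on
`(-∞, -δ]`. -/
def expAverage (δ : ℝ) (g : ℝ → ℝ) : ℝ := Real.exp δ * ∫ t in Set.Iic (-δ), Real.exp t * g t

/-- Integrability of `g` against the exponential law on `(-∞, -δ]`. -/
def ExpIntegrable (δ : ℝ) (g : ℝ → ℝ) : Prop :=
  IntegrableOn (fun t => Real.exp t * g t) (Set.Iic (-δ))

section

variable {δ : ℝ} {g h : ℝ → ℝ}

theorem ExpIntegrable.add (hg : ExpIntegrable δ g) (hh : ExpIntegrable δ h) :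
    ExpIntegrable δ fun t => g t + h t := by
  unfold ExpIntegrable
  simp_rw [mul_add]
  exact Integrable.add hg hh

theorem ExpIntegrable.const_mul (hg : ExpIntegrable δ g) (c : ℝ) :
    ExpIntegrable δ fun t => c * g t := by
  unfold ExpIntegrable
  simp_rw [mul_left_comm]
  exact Integrable.const_mul hg c

theorem expIntegrable_const (c : ℝ) : ExpIntegrable δ fun _ => c :=
  (integrableOn_exp_Iic _).mul_const c

theorem expAverage_add (hg : ExpIntegrable δ g) (hh : ExpIntegrable δ h) :
    expAverage δ (fun t => g t + h t) = expAverage δ g + expAverage δ h := by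
  unfold expAverage
  simp_rw [mul_add (Real.exp _) (g _)]
  rw [integral_add hg hh, mul_add]

theorem expAverage_const_mul (c : ℝ) :
    expAverage δ (fun t => c * g t) = c * expAverage δ g := by
  unfold expAverage
  simp_rw [mul_left_comm _ c]
  rw [integral_const_mul, mul_left_comm]

theorem expAverage_const (c : ℝ) : expAverage δ (fun _ => c) = c := by
  unfold expAverage
  rw [integral_mul_const, integral_exp_Iic, ← mul_assoc, ← Real.exp_add]
  simp

theorem expAverage_mono (hg : ExpIntegrable δ g) (hh : ExpIntegrable δ h)
    (hle : ∀ t ≤ -δ, g t ≤ h t) : expAverage δ g ≤ expAverage δ h := by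
  refine mul_le_mul_of_nonneg_left ?_ (Real.exp_pos _).le
  exact setIntegral_mono_on hg hh measurableSet_Iic fun t ht =>
    mul_le_mul_of_nonneg_left (hle t ht) (Real.exp_pos _).le

/-- Continuous functions growing at most like `e^{-t/2}` are integrable. -/
theorem expIntegrable_of_bound (hg : ContinuousOn g (Set.Iic (-δ))) {A B : ℝ}
    (hb : ∀ t ≤ -δ, |g t| ≤ A + B * Real.exp (-t / 2)) : ExpIntegrable δ g := by
  have hI : IntegrableOn (fun t => A * Real.exp t + B * Real.exp (1 / 2 * t)) (Set.Iic (-δ)) :=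
    ((integrableOn_exp_Iic _).const_mul A).add
      ((integrableOn_exp_mul_Iic (by norm_num) _).const_mul B)
  refine Integrable.mono' hI
    ((Real.continuous_exp.continuousOn.mul hg).aestronglyMeasurable measurableSet_Iic)
    ((ae_restrict_iff' measurableSet_Iic).2 (ae_of_all _ fun t ht => ?_))
  rw [Real.norm_eq_abs, abs_mul, abs_of_pos (Real.exp_pos _)]
  have h1 := mul_le_mul_of_nonneg_left (hb t ht) (Real.exp_pos t).le
  refine h1.trans (le_of_eq ?_)
  rw [mul_add, mul_left_comm, ← Real.exp_add]
  ring_nf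

end

theorem timeScale_le {κ : ℝ} (hκ : 0 < κ) (t : ℝ) :
    timeScale κ t ≤ √(2 * κ) * Real.exp (-t / 2) := by
  refine Real.sqrt_le_iff.2 ⟨by positivity, ?_⟩
  rw [mul_pow, Real.sq_sqrt (by positivity), ← Real.exp_nat_mul]
  have : -t ≤ Real.exp ((2 : ℕ) * (-t / 2)) := by
    push_cast
    rw [mul_div_cancel₀ _ two_ne_zero]
    linarith [Real.add_one_le_exp (-t)]
  nlinarith

section

variable {δ κ : ℝ}

theorem maxTransform_eq (δ κ : ℝ) (x : Fin N → ℝ) :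
    maxTransform N δ κ x = expAverage δ (maxPotential N κ x) := rfl

theorem abs_maxPotential_le (hN : 0 < N) (hκ : 0 < κ) {t : ℝ} (ht : t < 0) (x : Fin N → ℝ) :
    |maxPotential N κ x t| ≤ |⨆ i, x i| + √(2 * κ) * Real.exp (-t / 2) := by
  have h1 := iSup_le_maxPotential hN hκ ht x
  have h2 := maxPotential_le hN hκ ht x
  have h3 : √(2 / Real.pi) * (((N : ℝ) - 1) / N) ≤ 1 := by
    have h4 : ((N : ℝ) - 1) / N ≤ 1 := by
      rw [div_le_one (by positivity)]
      linarith
    have h5 : 0 ≤ ((N : ℝ) - 1) / N :=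
      div_nonneg (sub_nonneg.2 (by exact_mod_cast hN)) (by positivity)
    exact mul_le_one₀ sqrt_two_div_pi_le_one h5 h4
  have h4 := mul_le_of_le_one_right (timeScale_pos hκ ht).le h3
  have h5 := timeScale_le hκ t
  have h6 := abs_le.1 (le_refl |⨆ i, x i|)
  have h7 := timeScale_pos hκ ht
  rw [abs_le]
  constructor <;> linarith

theorem expIntegrable_maxPotential (hN : 0 < N) (hδ : 0 < δ) (hκ : 0 < κ) (x : Fin N → ℝ) :
    ExpIntegrable δ (maxPotential N κ x) :=
  expIntegrable_of_bound
    (fun t ht =>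
      (hasDerivAt_maxPotential hκ (by linarith [ht.out]) x).continuousAt.continuousWithinAt)
    fun _ ht => abs_maxPotential_le hN hκ (by linarith) x

theorem continuousOn_inv_timeScale (hδ : 0 < δ) (hκ : 0 < κ) :
    ContinuousOn (fun t => (timeScale κ t)⁻¹) (Set.Iic (-δ)) :=
  (continuous_timeScale κ).continuousOn.inv₀
    fun t ht => (timeScale_pos hκ (by linarith [ht.out])).ne'

theorem inv_timeScale_le (hδ : 0 < δ) (hκ : 0 < κ) {t : ℝ} (ht : t ≤ -δ) :
    (timeScale κ t)⁻¹ ≤ (timeScale κ (-δ))⁻¹ := by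
  refine inv_anti₀ (timeScale_pos hκ (by linarith)) (Real.sqrt_le_sqrt ?_)
  nlinarith

theorem expIntegrable_deriv_maxPotential (hN : 0 < N) (hδ : 0 < δ) (hκ : 0 < κ) (x : Fin N → ℝ) :
    ExpIntegrable δ (deriv (maxPotential N κ x)) := by
  have hcont : ContinuousOn (fun t =>
      -(κ * ((timeScale κ t)⁻¹ * unitCurv ((timeScale κ t)⁻¹ • x)))) (Set.Iic (-δ)) := by
    have h1 := continuousOn_inv_timeScale hδ hκ
    exact (continuousOn_const.mul (h1.mul ((continuous_unitCurv hN).comp_continuousOn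
      (h1.smul continuousOn_const)))).neg
  refine expIntegrable_of_bound (A := κ * (timeScale κ (-δ))⁻¹) (B := 0)
    (hcont.congr fun t ht => (hasDerivAt_maxPotential hκ (by linarith [ht.out]) x).deriv)
    fun t ht => ?_
  have hs := inv_pos.2 (timeScale_pos hκ (show t < 0 by linarith))
  rw [(hasDerivAt_maxPotential hκ (by linarith) x).deriv, abs_neg, zero_mul, add_zero,
    abs_of_nonneg (mul_nonneg hκ.le (mul_nonneg hs.le (unitCurv_nonneg _)))]
  gcongr
  exact (mul_le_of_le_one_right hs.le (unitCurv_le hN _)).trans (inv_timeScale_le hδ hκ ht)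

/-- Integration by parts: the transform of the time derivative. -/
theorem expAverage_deriv_maxPotential (hN : 0 < N) (hδ : 0 < δ) (hκ : 0 < κ) (x : Fin N → ℝ) :
    expAverage δ (deriv (maxPotential N κ x)) =
      maxPotential N κ x (-δ) - maxTransform N δ κ x := by
  have h1 := expIntegrable_maxPotential hN hδ hκ x
  have h2 := expIntegrable_deriv_maxPotential hN hδ hκ x
  have hlim : Tendsto (fun t => Real.exp t * maxPotential N κ x t) atBot (𝓝 0) := by
    have hb : Tendsto (fun t => |⨆ i, x i| * Real.exp t + √(2 * κ) * Real.exp (t / 2)) atBot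
        (𝓝 (|⨆ i, x i| * 0 + √(2 * κ) * 0)) :=
      (Real.tendsto_exp_atBot.const_mul _).add
        ((Real.tendsto_exp_atBot.comp (tendsto_id.atBot_div_const two_pos)).const_mul _)
    rw [mul_zero, mul_zero, add_zero] at hb
    refine squeeze_zero_norm' ((eventually_lt_atBot 0).mono fun t ht => ?_) hb
    rw [Real.norm_eq_abs, abs_mul, abs_of_pos (Real.exp_pos _)]
    refine (mul_le_mul_of_nonneg_left (abs_maxPotential_le hN hκ ht x) (Real.exp_pos _).le).trans
      (le_of_eq ?_)
    rw [mul_add, mul_left_comm, ← Real.exp_add]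
    ring_nf
  have h3 : ∫ t in Set.Iic (-δ), (Real.exp t * maxPotential N κ x t +
      Real.exp t * deriv (maxPotential N κ x) t) =
      Real.exp (-δ) * maxPotential N κ x (-δ) - 0 :=
    integral_Iic_of_hasDerivAt_of_tendsto' (fun t ht => by
      have h := hasDerivAt_maxPotential hκ (show t < 0 by linarith [ht.out]) x
      refine ((Real.hasDerivAt_exp t).mul h).congr_deriv ?_
      simp only [Pi.add_apply, h.deriv]) (Integrable.add h1 h2) hlim
  rw [integral_add h1 h2, sub_zero] at h3
  rw [maxTransform, expAverage, eq_sub_iff_add_eq, ← mul_add, add_comm, h3, ← mul_assoc,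
    ← Real.exp_add]
  simp

theorem unitGrad_le (i : Fin N) (x : Fin N → ℝ) : unitGrad i x ≤ 2 := by
  have h : unitGrad i x ≤ ∫ s in Set.Ioi (0 : ℝ), 2 * Real.exp (-s) := by
    refine setIntegral_mono_on (integrable_unitGrad i x) ((integrableOn_exp_neg_Ioi 0).const_mul 2)
      measurableSet_Ioi fun s _ => (halfDens_le _).trans ?_
    gcongr
    exact le_excess_coord i x s
  rw [integral_const_mul, integral_exp_neg_Ioi_zero, mul_one] at h
  exact h

theorem norm_fderiv_unitPotential_le (hN : 0 < N) (x : Fin N → ℝ) :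
    ‖fderiv ℝ unitPotential x‖ ≤ 2 * N := by
  refine ContinuousLinearMap.opNorm_le_bound _ (by positivity) fun v => ?_
  rw [fderiv_unitPotential hN]
  refine (norm_sum_le _ _).trans ?_
  refine (Finset.sum_le_card_nsmul _ _ (2 * ‖v‖) fun i _ => ?_).trans (le_of_eq ?_)
  · rw [norm_mul, Real.norm_of_nonneg (unitGrad_nonneg i x)]
    exact mul_le_mul (unitGrad_le i x) (norm_le_pi_norm v i) (norm_nonneg _) (by norm_num)
  · simp
    ring

theorem continuous_fderiv_unitPotential (hN : 0 < N) :
    Continuous (fderiv ℝ (unitPotential (N := N))) :=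
  (contDiff_unitPotential hN).continuous_fderiv (by norm_num)

theorem integrable_fderiv_maxPotential (hN : 0 < N) (hδ : 0 < δ) (hκ : 0 < κ) (x : Fin N → ℝ) :
    IntegrableOn (fun t => Real.exp t • fderiv ℝ (fun x => maxPotential N κ x t) x)
      (Set.Iic (-δ)) := by
  have hcont : ContinuousOn (fun t => Real.exp t • fderiv ℝ unitPotential
      ((timeScale κ t)⁻¹ • x)) (Set.Iic (-δ)) :=
    Real.continuous_exp.continuousOn.smul ((continuous_fderiv_unitPotential hN).comp_continuousOn
      ((continuousOn_inv_timeScale hδ hκ).smul continuousOn_const))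
  have h1 : IntegrableOn (fun t => Real.exp t • fderiv ℝ unitPotential
      ((timeScale κ t)⁻¹ • x)) (Set.Iic (-δ)) := by
    refine Integrable.mono' ((integrableOn_exp_Iic (-δ)).mul_const (2 * (N : ℝ)))
      (hcont.aestronglyMeasurable measurableSet_Iic) (ae_of_all _ fun t => ?_)
    rw [norm_smul, Real.norm_of_nonneg (Real.exp_pos _).le]
    gcongr
    exact norm_fderiv_unitPotential_le hN _
  refine h1.congr_fun (fun t ht => ?_) measurableSet_Iic
  simp only
  rw [(hasFDerivAt_maxPotential hN hκ (by linarith [ht.out]) x).fderiv]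

theorem hasFDerivAt_maxTransform (hN : 0 < N) (hδ : 0 < δ) (hκ : 0 < κ) (x : Fin N → ℝ) :
    HasFDerivAt (maxTransform N δ κ) (Real.exp δ • ∫ t in Set.Iic (-δ),
      Real.exp t • fderiv ℝ (fun x => maxPotential N κ x t) x) x := by
  have key := hasFDerivAt_integral_of_dominated_of_fderiv_le (𝕜 := ℝ)
    (μ := volume.restrict (Set.Iic (-δ))) (s := Set.univ) (x₀ := x)
    (F := fun x t => Real.exp t * maxPotential N κ x t)
    (F' := fun x t => Real.exp t • fderiv ℝ (fun x => maxPotential N κ x t) x)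
    (bound := fun t => Real.exp t * (2 * N)) univ_mem
    (Eventually.of_forall fun x => (expIntegrable_maxPotential hN hδ hκ x).aestronglyMeasurable)
    (expIntegrable_maxPotential hN hδ hκ x)
    (integrable_fderiv_maxPotential hN hδ hκ x).aestronglyMeasurable ?_
    ((integrableOn_exp_Iic (-δ)).mul_const _) ?_
  · exact key.const_mul (Real.exp δ)
  · refine (ae_restrict_iff' measurableSet_Iic).2 (ae_of_all _ fun t ht x _ => ?_)
    rw [(hasFDerivAt_maxPotential hN hκ (by linarith [ht.out]) x).fderiv, norm_smul,
      Real.norm_of_nonneg (Real.exp_pos _).le]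
    gcongr
    exact norm_fderiv_unitPotential_le hN _
  · refine (ae_restrict_iff' measurableSet_Iic).2 (ae_of_all _ fun t ht x _ => ?_)
    have h := hasFDerivAt_maxPotential hN hκ (show t < 0 by linarith [ht.out]) x
    rw [h.fderiv]
    exact h.const_mul (Real.exp t)

theorem differentiable_maxTransform (hN : 0 < N) (hδ : 0 < δ) (hκ : 0 < κ) :
    Differentiable ℝ (maxTransform N δ κ) := fun x =>
  (hasFDerivAt_maxTransform hN hδ hκ x).differentiableAt

theorem expIntegrable_fderiv (hN : 0 < N) (hδ : 0 < δ) (hκ : 0 < κ) (x v : Fin N → ℝ) :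
    ExpIntegrable δ fun t => fderiv ℝ (fun x => maxPotential N κ x t) x v :=
  (integrable_fderiv_maxPotential hN hδ hκ x).apply_continuousLinearMap v

theorem fderiv_maxTransform (hN : 0 < N) (hδ : 0 < δ) (hκ : 0 < κ) (x v : Fin N → ℝ) :
    fderiv ℝ (maxTransform N δ κ) x v =
      expAverage δ fun t => fderiv ℝ (fun x => maxPotential N κ x t) x v := by
  rw [(hasFDerivAt_maxTransform hN hδ hκ x).fderiv, smul_apply,
    ContinuousLinearMap.integral_apply (integrable_fderiv_maxPotential hN hδ hκ x)]
  rfl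

theorem maxTransform_add_const (hN : 0 < N) (hδ : 0 < δ) (hκ : 0 < κ) (x : Fin N → ℝ) (c : ℝ) :
    maxTransform N δ κ (x + fun _ => c) = maxTransform N δ κ x + c := by
  rw [maxTransform_eq, show maxPotential N κ (x + fun _ => c) = fun t => maxPotential N κ x t + c
    from funext fun t => maxPotential_add_const hN κ x t c,
    expAverage_add (expIntegrable_maxPotential hN hδ hκ x) (expIntegrable_const c),
    expAverage_const, maxTransform_eq]

/-- The gradient of the transformed potential is a probability vector: its entries are
nonnegative, and they sum to one because constants can be pulled out of the potential. -/
theorem partialDeriv_maxTransform_mem (hN : 0 < N) (hδ : 0 < δ) (hκ : 0 < κ) (x : Fin N → ℝ) :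
    (fun i => partialDeriv i (maxTransform N δ κ) x) ∈ stdSimplex ℝ (Fin N) := by
  refine ⟨fun i => ?_, ?_⟩
  · simp only [partialDeriv]
    rw [fderiv_maxTransform hN hδ hκ]
    have h := expAverage_mono (expIntegrable_const (δ := δ) 0)
      (expIntegrable_fderiv hN hδ hκ x (Pi.single i 1)) fun t ht => by
        have := congrFun (partialDeriv_maxPotential hN hκ (show t < 0 by linarith) i) x
        rw [partialDeriv] at this
        rw [this]
        exact unitGrad_nonneg i _
    rwa [expAverage_const] at h
  · have h1 : ∑ i, partialDeriv i (maxTransform N δ κ) x =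
        fderiv ℝ (maxTransform N δ κ) x (fun _ => 1) := by
      rw [clm_eq_sum_proj]
      simp [partialDeriv]
    rw [h1]
    have h2 : HasDerivAt (fun s : ℝ => x + s • (fun _ : Fin N => (1 : ℝ))) (fun _ => 1) 0 := by
      simpa using ((hasDerivAt_id (0 : ℝ)).smul_const (fun _ : Fin N => (1 : ℝ))).const_add x
    have h3 : HasFDerivAt (maxTransform N δ κ) (fderiv ℝ (maxTransform N δ κ) x)
        (x + (0 : ℝ) • (fun _ : Fin N => (1 : ℝ))) := by
      simpa using (differentiable_maxTransform hN hδ hκ x).hasFDerivAt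
    have h4 := h3.comp_hasDerivAt 0 h2
    have h5 : HasDerivAt (fun s : ℝ => maxTransform N δ κ x + s) 1 0 :=
      (hasDerivAt_id (0 : ℝ)).const_add _
    refine h4.unique (h5.congr_of_eventuallyEq (Eventually.of_forall fun s => ?_))
    have : s • (fun _ : Fin N => (1 : ℝ)) = fun _ => s := by ext; simp
    rw [Function.comp_apply, this]
    exact maxTransform_add_const hN hδ hκ x s

theorem iSup_le_maxTransform (hN : 0 < N) (hδ : 0 < δ) (hκ : 0 < κ) (x : Fin N → ℝ) :
    ⨆ i, x i ≤ maxTransform N δ κ x := by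
  have := expAverage_mono (expIntegrable_const (δ := δ) (⨆ i, x i))
    (expIntegrable_maxPotential hN hδ hκ x) fun t ht =>
      iSup_le_maxPotential hN hκ (by linarith) x
  rwa [expAverage_const] at this

theorem maxPotential_zero (hN : 0 < N) (κ t : ℝ) :
    maxPotential N κ 0 t = timeScale κ t * (√(2 / Real.pi) * (((N : ℝ) - 1) / N)) := by
  have h : ∀ l, rankGap (0 : Fin N → ℝ) l = 0 := fun l => by
    have := rankGap_smul le_rfl (0 : Fin N → ℝ) l
    simpa using this
  rw [maxPotential_eq_rankGap, ← sum_inv_mul_succ hN, Finset.mul_sum (Finset.Ico 1 N),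
    Finset.mul_sum (Finset.Ico 1 N)]
  simp only [h, zero_div, profile_zero]
  simp only [Pi.zero_apply, Finset.sum_const_zero, mul_zero, zero_add]
  exact Finset.sum_congr rfl fun l _ => by ring

theorem maxTransform_le (hN : 0 < N) (hδ : 0 < δ) (hκ : 0 < κ) (x : Fin N → ℝ) :
    maxTransform N δ κ x ≤ (⨆ i, x i) + maxTransform N δ κ 0 := by
  have := expAverage_mono (expIntegrable_maxPotential hN hδ hκ x)
    ((expIntegrable_const (⨆ i, x i)).add (expIntegrable_maxPotential hN hδ hκ 0))
      fun t ht => by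
        rw [maxPotential_zero hN]
        exact maxPotential_le hN hκ (by linarith) x
  rwa [expAverage_add (expIntegrable_const _) (expIntegrable_maxPotential hN hδ hκ 0),
    expAverage_const] at this

/-! ### Values at the origin -/

theorem hasDerivAt_erf_sqrt_neg {t : ℝ} (ht : t < 0) :
    HasDerivAt (fun t => -(√Real.pi * erf √(-t))) (Real.exp t * (√(-t))⁻¹) t := by
  have h1 : HasDerivAt (fun t : ℝ => √(-t)) (-1 / (2 * √(-t))) t :=
    (hasDerivAt_neg t).sqrt (by linarith)
  refine (((hasDerivAt_erf _).comp t h1).const_mul (√Real.pi)).neg.congr_deriv ?_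
  have h2 : √Real.pi ≠ 0 := by positivity
  have h3 : √(-t) ≠ 0 := (Real.sqrt_pos.2 (by linarith)).ne'
  rw [Real.sq_sqrt (by linarith), neg_neg]
  field_simp

theorem expAverage_inv_sqrt (hδ : 0 < δ) :
    expAverage δ (fun t => (√(-t))⁻¹) = √Real.pi * (Real.exp δ * erfc √δ) := by
  have hI : ExpIntegrable δ fun t => (√(-t))⁻¹ := by
    refine expIntegrable_of_bound (A := (√δ)⁻¹) (B := 0) ?_ fun t ht => ?_
    · refine ContinuousOn.inv₀ (by fun_prop) fun t ht => (Real.sqrt_pos.2 ?_).ne'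
      linarith [ht.out]
    · rw [zero_mul, add_zero, abs_of_nonneg (by positivity)]
      exact inv_anti₀ (Real.sqrt_pos.2 hδ) (Real.sqrt_le_sqrt (by linarith))
  have hlim : Tendsto (fun t => -(√Real.pi * erf √(-t))) atBot (𝓝 (-(√Real.pi * 1))) :=
    ((tendsto_erf.comp (Real.tendsto_sqrt_atTop.comp tendsto_neg_atBot_atTop)).const_mul _).neg
  have h := integral_Iic_of_hasDerivAt_of_tendsto' (a := -δ)
    (fun t ht => hasDerivAt_erf_sqrt_neg (by linarith [ht.out])) hI hlim
  rw [expAverage, h, erfc, neg_neg]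
  ring

theorem unitCurv_zero (hN : 0 < N) :
    unitCurv (0 : Fin N → ℝ) = √(2 / Real.pi) * (((N : ℝ) - 1) / N) := by
  have h : ∀ l, rankGap (0 : Fin N → ℝ) l = 0 := fun l => by
    have := rankGap_smul le_rfl (0 : Fin N → ℝ) l
    simpa using this
  rw [unitCurv, rankSum, ← sum_inv_mul_succ hN, Finset.mul_sum (Finset.Ico 1 N)]
  simp only [h, halfDens_zero]
  exact Finset.sum_congr rfl fun l _ => by ring

theorem maxPotential_zero_neg (hN : 0 < N) (hδ : 0 < δ) (hκ : 0 < κ) :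
    maxPotential N κ 0 (-δ) = 2 * √(κ * δ / Real.pi) * (((N : ℝ) - 1) / N) := by
  rw [maxPotential_zero hN, timeScale, ← mul_assoc, ← Real.sqrt_mul (by nlinarith)]
  congr 1
  rw [show -2 * κ * -δ * (2 / Real.pi) = 2 ^ 2 * (κ * δ / Real.pi) by ring,
    Real.sqrt_mul (by norm_num), Real.sqrt_sq (by norm_num)]

/-- At the origin the time derivative is a multiple of `(-t)^{-1/2}`, whose transform is explicit,
and the transform of the derivative determines that of the potential. -/
theorem maxTransform_zero (hN : 0 < N) (hδ : 0 < δ) (hκ : 0 < κ) :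
    maxTransform N δ κ 0 = ((N : ℝ) - 1) / N * √κ * (Real.exp δ * erfc √δ) +
      2 * √(κ * δ / Real.pi) * (((N : ℝ) - 1) / N) := by
  have h1 := expAverage_deriv_maxPotential hN hδ hκ (0 : Fin N → ℝ)
  have h2 : expAverage δ (deriv (maxPotential N κ 0)) =
      expAverage δ (fun t => -(√κ / √Real.pi * (((N : ℝ) - 1) / N)) * (√(-t))⁻¹) := by
    unfold expAverage
    congr 1
    refine setIntegral_congr_fun measurableSet_Iic fun t ht => ?_
    have ht' : 0 < -t := by linarith [ht.out]
    simp only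
    rw [(hasDerivAt_maxPotential hκ (by linarith) 0).deriv, smul_zero, unitCurv_zero hN, timeScale,
      show -2 * κ * t = 2 * (κ * -t) by ring, Real.sqrt_mul (by norm_num), Real.sqrt_mul hκ.le,
      Real.sqrt_div (by norm_num)]
    have h3 : √κ * √κ = κ := Real.mul_self_sqrt hκ.le
    have h4 : √κ ≠ 0 := (Real.sqrt_pos.2 hκ).ne'
    have h5 : √(-t) ≠ 0 := (Real.sqrt_pos.2 ht').ne'
    have h6 : √(2 : ℝ) ≠ 0 := by positivity
    have h7 : √Real.pi ≠ 0 := by positivity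
    nth_rewrite 1 [← h3]
    field_simp
  rw [h2, expAverage_const_mul, expAverage_inv_sqrt hδ, maxPotential_zero_neg hN hδ hκ] at h1
  have h7 : √Real.pi ≠ 0 := by positivity
  have h8 : -(√κ / √Real.pi * (((N : ℝ) - 1) / N)) * (√Real.pi * (Real.exp δ * erfc √δ)) =
      -(((N : ℝ) - 1) / N * √κ * (Real.exp δ * erfc √δ)) := by
    field_simp
  rw [h8] at h1
  linarith

/-! ### The increment of the transformed potential in one round -/

theorem expIntegrable_neg_inv (hδ : 0 < δ) : ExpIntegrable δ fun t => (-t)⁻¹ := by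
  refine expIntegrable_of_bound (A := δ⁻¹) (B := 0) ?_ fun t ht => ?_
  · refine ContinuousOn.inv₀ (by fun_prop) fun t ht => ?_
    have := ht.out
    linarith
  · rw [zero_mul, add_zero, abs_of_nonneg (inv_nonneg.2 (by linarith))]
    exact inv_anti₀ hδ (by linarith)

/-- The exponential integral grows logarithmically. -/
theorem expAverage_neg_inv_le (hδ : 0 < δ) (hδ1 : δ < 1) :
    expAverage δ (fun t => (-t)⁻¹) ≤ 1 + Real.log (1 / δ) := by
  have hI := expIntegrable_neg_inv hδ
  have hI1 : IntegrableOn (fun t : ℝ => Real.exp t * (-t)⁻¹) (Set.Iic (-1)) :=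
    hI.mono_set (Set.Iic_subset_Iic.2 (by linarith))
  have h1 := intervalIntegral.integral_Iic_sub_Iic hI1 hI
  have h2 : ∫ t in Set.Iic (-1 : ℝ), Real.exp t * (-t)⁻¹ ≤ Real.exp (-1) := by
    rw [← integral_exp_Iic (-1)]
    refine setIntegral_mono_on hI1 (integrableOn_exp_Iic _) measurableSet_Iic fun t ht => ?_
    refine mul_le_of_le_one_right (Real.exp_pos _).le (inv_le_one_of_one_le₀ ?_)
    linarith [ht.out]
  have hcont : ContinuousOn (fun t : ℝ => (-t)⁻¹) (Set.Icc (-1) (-δ)) :=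
    ContinuousOn.inv₀ (by fun_prop) fun t ht => by have := ht.2; linarith
  have h3 : ∫ t in (-1 : ℝ)..-δ, Real.exp t * (-t)⁻¹ ≤
      ∫ t in (-1 : ℝ)..-δ, Real.exp (-δ) * (-t)⁻¹ := by
    have hle : (-1 : ℝ) ≤ -δ := by linarith
    refine intervalIntegral.integral_mono_on hle ?_ ?_ fun t ht => ?_
    · exact (Real.continuous_exp.continuousOn.mul hcont).intervalIntegrable_of_Icc hle
    · exact (continuousOn_const.mul hcont).intervalIntegrable_of_Icc hle
    · refine mul_le_mul_of_nonneg_right (Real.exp_le_exp.2 ht.2) (inv_nonneg.2 ?_)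
      linarith [ht.2]
  have h4 : ∫ t in (-1 : ℝ)..-δ, (-t)⁻¹ = Real.log (1 / δ) := by
    rw [intervalIntegral.integral_comp_neg (fun t : ℝ => t⁻¹), neg_neg, neg_neg,
      integral_inv_of_pos hδ one_pos]
  rw [intervalIntegral.integral_const_mul, h4] at h3
  have h5 : ∫ t in Set.Iic (-δ), Real.exp t * (-t)⁻¹ ≤
      Real.exp (-1) + Real.exp (-δ) * Real.log (1 / δ) := by linarith
  have h6 := mul_le_mul_of_nonneg_left h5 (Real.exp_pos δ).le
  have h7 : Real.exp δ * Real.exp (-1) ≤ 1 := by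
    rw [← Real.exp_add]
    exact Real.exp_le_one_iff.2 (by linarith)
  have h8 : Real.exp δ * Real.exp (-δ) = 1 := by rw [← Real.exp_add]; simp
  rw [mul_add, ← mul_assoc, h8, one_mul] at h6
  exact h6.trans (by linarith)

/-- The average over time of `maxPotential_add_le`. The time derivative becomes a difference of
potentials by parts, and the third order error becomes a logarithm. -/
theorem maxTransform_add_le (hN : 0 < N) (hδ : 0 < δ) (hδ1 : δ < 1) (hκ : 0 < κ) (x : Fin N → ℝ)
    {q : Fin N → ℝ} (hq : ∀ i, q i ∈ Set.Icc (-1 : ℝ) 1) :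
    maxTransform N δ κ (x + q) ≤ maxTransform N δ κ x + fderiv ℝ (maxTransform N δ κ) x q +
      cubeFactor N / κ * (maxTransform N δ κ x - maxPotential N κ x (-δ)) +
      20 * N * cubeFactor N / κ * (1 + Real.log (1 / δ)) := by
  have i1 := expIntegrable_maxPotential hN hδ hκ x
  have i2 := expIntegrable_fderiv hN hδ hκ x q
  have i3 := (expIntegrable_deriv_maxPotential hN hδ hκ x).const_mul (-(cubeFactor N / κ))
  have i4 := (expIntegrable_neg_inv hδ).const_mul (20 * N * cubeFactor N / κ)
  have h := expAverage_mono (expIntegrable_maxPotential hN hδ hκ (x + q))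
    (((i1.add i2).add i3).add i4) fun t ht => by
      have := maxPotential_add_le hN hκ (show t < 0 by linarith) x hq
      linarith
  rw [expAverage_add ((i1.add i2).add i3) i4, expAverage_add (i1.add i2) i3, expAverage_add i1 i2,
    expAverage_const_mul, expAverage_const_mul, expAverage_deriv_maxPotential hN hδ hκ,
    ← fderiv_maxTransform hN hδ hκ, ← maxTransform_eq, ← maxTransform_eq] at h
  have h1 : 0 ≤ 20 * N * cubeFactor N / κ := by
    have := one_le_cubeFactor hN
    positivity
  have h2 := mul_le_mul_of_nonneg_left (expAverage_neg_inv_le hδ hδ1) h1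
  linarith

/-- The average over time of `le_maxPotential_add_maxVector`. -/
theorem le_maxTransform_add_maxVector (hN : 0 < N) (hδ : 0 < δ) (hδ1 : δ < 1) (hκ : 0 < κ)
    {x : Fin N → ℝ} {k : Fin N} (hk : ∀ j, x j ≤ x k) {ε : ℝ} (hε : |ε| = 1) :
    maxTransform N δ κ x + fderiv ℝ (maxTransform N δ κ) x (ε • maxVector k) +
      2 / κ * (maxTransform N δ κ x - maxPotential N κ x (-δ)) -
      80 * N / κ * (1 + Real.log (1 / δ)) ≤ maxTransform N δ κ (x + ε • maxVector k) := by
  have i1 := expIntegrable_maxPotential hN hδ hκ x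
  have i2 := expIntegrable_fderiv hN hδ hκ x (ε • maxVector k)
  have i3 := (expIntegrable_deriv_maxPotential hN hδ hκ x).const_mul (-(2 / κ))
  have i4 := (expIntegrable_neg_inv hδ).const_mul (-(80 * N / κ))
  have h := expAverage_mono (((i1.add i2).add i3).add i4)
    (expIntegrable_maxPotential hN hδ hκ (x + ε • maxVector k)) fun t ht => by
      have := le_maxPotential_add_maxVector hN hκ (show t < 0 by linarith) hk hε
      linarith
  rw [expAverage_add ((i1.add i2).add i3) i4, expAverage_add (i1.add i2) i3, expAverage_add i1 i2,
    expAverage_const_mul, expAverage_const_mul, expAverage_deriv_maxPotential hN hδ hκ,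
    ← fderiv_maxTransform hN hδ hκ, ← maxTransform_eq, ← maxTransform_eq] at h
  have h1 : 0 ≤ 80 * N / κ := by positivity
  have h2 := mul_le_mul_of_nonneg_left (expAverage_neg_inv_le hδ hδ1) h1
  linarith

end

/-! ### The law of the play -/

/-- The outcomes whose losses lie in the cube. -/
def cubeRounds (N : ℕ) : Set (Round N) := {ω | ∀ i, ω.1 i ∈ Set.Icc (-1 : ℝ) 1}

theorem measurableSet_cube :
    MeasurableSet {q : Fin N → ℝ | ∀ i, q i ∈ Set.Icc (-1 : ℝ) 1} := by
  simp only [Set.ofPred_forall]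
  exact MeasurableSet.iInter fun i => measurable_pi_apply i measurableSet_Icc

theorem measurableSet_cubeRounds : MeasurableSet (cubeRounds N) :=
  measurable_fst measurableSet_cube

theorem norm_instRegret_le {ω : Round N} (hω : ω ∈ cubeRounds N) : ‖instRegret ω‖ ≤ 2 := by
  refine (pi_norm_le_iff_of_nonneg (by norm_num)).2 fun i => ?_
  have h1 := hω i
  have h2 := hω ω.2
  simp only [instRegret, Real.norm_eq_abs]
  rw [abs_le]
  constructor <;> linarith [h1.1, h1.2, h2.1, h2.2]

theorem cumRegret_zero (x : Fin N → ℝ) (h : Fin 0 → Round N) : cumRegret x h = x := by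
  simp [cumRegret]

theorem cumRegret_snoc {n : ℕ} (x : Fin N → ℝ) (h : Fin n → Round N) (ω : Round N) :
    cumRegret x (Fin.snoc h ω : Fin (n + 1) → Round N) = cumRegret x h + instRegret ω := by
  simp only [cumRegret, Fin.sum_univ_castSucc, Fin.snoc_castSucc, Fin.snoc_last, add_assoc]

theorem measurable_snoc (n : ℕ) :
    Measurable fun hω : (Fin n → Round N) × Round N =>
      (Fin.snoc hω.1 hω.2 : Fin (n + 1) → Round N) := by
  refine measurable_pi_lambda _ fun i => ?_
  refine Fin.lastCases ?_ (fun j => ?_) i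
  · simpa using measurable_snd
  · simp only [Fin.snoc_castSucc]
    exact (measurable_pi_apply j).comp measurable_fst

section

variable {a : AdversaryRule N} {p : PlayerRule N}

theorem isProbabilityMeasure_outcomeLaw (ha : IsAdversary a) (hp : IsPlayer p) (n : ℕ) :
    IsProbabilityMeasure (outcomeLaw a p n) := by
  induction n with
  | zero => rw [outcomeLaw]; infer_instance
  | succ n ih =>
    have := (ha n).1
    have := hp n
    rw [outcomeLaw]
    exact Measure.isProbabilityMeasure_map (measurable_snoc n).aemeasurable

theorem ae_mem_cubeRounds {μ : Measure (Fin N → ℝ)} {ν : Measure (Fin N)}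
    (hμ : ∀ᵐ q ∂μ, ∀ i, q i ∈ Set.Icc (-1 : ℝ) 1) : ∀ᵐ ω ∂(μ.prod ν), ω ∈ cubeRounds N :=
  Measure.quasiMeasurePreserving_fst.ae hμ

theorem ae_outcomeLaw_mem (ha : IsAdversary a) (hp : IsPlayer p) (n : ℕ) :
    ∀ᵐ h ∂(outcomeLaw a p n), ∀ τ, h τ ∈ cubeRounds N := by
  induction n with
  | zero => exact ae_of_all _ fun h τ => τ.elim0
  | succ n ih =>
    have := (ha n).1
    have := hp n
    have hm : MeasurableSet {h : Fin (n + 1) → Round N | ∀ τ, h τ ∈ cubeRounds N} := by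
      simp only [Set.ofPred_forall]
      exact MeasurableSet.iInter fun τ => measurable_pi_apply τ measurableSet_cubeRounds
    rw [outcomeLaw, ae_map_iff (measurable_snoc n).aemeasurable hm]
    refine Measure.ae_compProd_of_ae_ae (measurable_snoc n hm) ?_
    filter_upwards [ih] with h hh
    rw [Kernel.prod_apply]
    filter_upwards [ae_mem_cubeRounds ((ha n).2 h)] with ω hω τ
    refine Fin.lastCases ?_ (fun j => ?_) τ
    · simpa using hω
    · simpa using hh j

theorem norm_cumRegret_le {n : ℕ} (x : Fin N → ℝ) {h : Fin n → Round N}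
    (hh : ∀ τ, h τ ∈ cubeRounds N) : ‖cumRegret x h‖ ≤ ‖x‖ + 2 * n := by
  refine (norm_add_le _ _).trans ?_
  gcongr
  refine (norm_sum_le _ _).trans ?_
  refine (Finset.sum_le_card_nsmul _ _ 2 fun τ _ => norm_instRegret_le (hh τ)).trans (le_of_eq ?_)
  simp [mul_comm]

variable {g : (Fin N → ℝ) → ℝ} {C : ℝ}

theorem ae_abs_cumRegret_le (ha : IsAdversary a) (hp : IsPlayer p) (hC : ∀ z, |g z| ≤ C + ‖z‖)
    (x : Fin N → ℝ) (n : ℕ) :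
    ∀ᵐ h ∂(outcomeLaw a p n), ‖g (cumRegret x h)‖ ≤ C + ‖x‖ + 2 * n := by
  filter_upwards [ae_outcomeLaw_mem ha hp n] with h hh
  have := hC (cumRegret x h)
  have := norm_cumRegret_le x hh
  rw [Real.norm_eq_abs]
  linarith

theorem integrable_cumRegret (ha : IsAdversary a) (hp : IsPlayer p) (hg : Continuous g)
    (hC : ∀ z, |g z| ≤ C + ‖z‖) (x : Fin N → ℝ) (n : ℕ) :
    Integrable (fun h => g (cumRegret x h)) (outcomeLaw a p n) := by
  have := isProbabilityMeasure_outcomeLaw ha hp n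
  exact Integrable.of_bound (hg.measurable.comp (measurable_cumRegret x)).aestronglyMeasurable _
    (ae_abs_cumRegret_le ha hp hC x n)

theorem abs_integral_cumRegret_le (ha : IsAdversary a) (hp : IsPlayer p)
    (hC : ∀ z, |g z| ≤ C + ‖z‖) (x : Fin N → ℝ) (n : ℕ) :
    |∫ h, g (cumRegret x h) ∂(outcomeLaw a p n)| ≤ C + ‖x‖ + 2 * n := by
  have := isProbabilityMeasure_outcomeLaw ha hp n
  have h := norm_integral_le_of_norm_le_const (ae_abs_cumRegret_le ha hp hC x n)
  simpa using h

theorem integrable_add_instRegret {μ : Measure (Fin N → ℝ)} [IsProbabilityMeasure μ]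
    {ν : Measure (Fin N)} [IsProbabilityMeasure ν] (hμ : ∀ᵐ q ∂μ, ∀ i, q i ∈ Set.Icc (-1 : ℝ) 1)
    (hg : Continuous g) (hC : ∀ z, |g z| ≤ C + ‖z‖) (z : Fin N → ℝ) :
    Integrable (fun ω => g (z + instRegret ω)) (μ.prod ν) := by
  refine Integrable.of_bound (C := C + (‖z‖ + 2))
    (hg.measurable.comp (measurable_instRegret.const_add z)).aestronglyMeasurable ?_
  filter_upwards [ae_mem_cubeRounds hμ] with ω hω
  have h1 := hC (z + instRegret ω)
  have h2 := norm_add_le z (instRegret ω)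
  have h3 := norm_instRegret_le hω
  rw [Real.norm_eq_abs]
  linarith

/-- Conditioning the last round on the history. -/
theorem integral_outcomeLaw_succ (ha : IsAdversary a) (hp : IsPlayer p) (hg : Continuous g)
    (hC : ∀ z, |g z| ≤ C + ‖z‖) (x : Fin N → ℝ) (n : ℕ) :
    Integrable (fun h => ∫ ω, g (cumRegret x h + instRegret ω) ∂((a n h).prod (p n h)))
        (outcomeLaw a p n) ∧
      ∫ h, g (cumRegret x h) ∂(outcomeLaw a p (n + 1)) =
        ∫ h, ∫ ω, g (cumRegret x h + instRegret ω) ∂((a n h).prod (p n h)) ∂(outcomeLaw a p n) := by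
  have := (ha n).1
  have := hp n
  have := isProbabilityMeasure_outcomeLaw ha hp n
  have hmeas : AEStronglyMeasurable (fun h => g (cumRegret x h)) (outcomeLaw a p (n + 1)) :=
    (hg.measurable.comp (measurable_cumRegret x)).aestronglyMeasurable
  have hI := integrable_cumRegret ha hp hg hC x (n + 1)
  rw [outcomeLaw] at hI hmeas ⊢
  rw [integrable_map_measure hmeas (measurable_snoc n).aemeasurable] at hI
  rw [integral_map (measurable_snoc n).aemeasurable hmeas]
  simp only [Function.comp_def, cumRegret_snoc] at hI ⊢
  simp_rw [← Kernel.prod_apply]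
  exact ⟨Integrable.integral_compProd (κ := Kernel.const Unit (outcomeLaw a p n))
    (η := Kernel.prodMkLeft Unit ((a n).prod (p n))) (a := ()) hI, Measure.integral_compProd hI⟩

end

/-! ### Geometric stopping -/

theorem summable_geom_mul {δ : ℝ} (hδ : 0 < δ) (hδ1 : δ < 1) {F : ℕ → ℝ} {A : ℝ}
    (hF : ∀ n, |F n| ≤ A + 2 * n) (b : ℕ) : Summable fun k => δ * (1 - δ) ^ k * F (k + b) := by
  have h1 : ‖1 - δ‖ < 1 := by rw [Real.norm_eq_abs, abs_lt]; constructor <;> linarith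
  have h2 := (summable_geometric_of_norm_lt_one h1).mul_left (δ * (A + 2 * b))
  have h3 := (summable_pow_mul_geometric_of_norm_lt_one 1 h1).mul_left (2 * δ)
  refine Summable.of_norm_bounded (h2.add h3) fun k => ?_
  rw [Real.norm_eq_abs, abs_mul, abs_of_nonneg (a := δ * (1 - δ) ^ k)
    (mul_nonneg hδ.le (pow_nonneg (by linarith) _))]
  have h4 := hF (k + b)
  push_cast at h4
  calc δ * (1 - δ) ^ k * |F (k + b)| ≤ δ * (1 - δ) ^ k * (A + 2 * (k + b)) := by
        refine mul_le_mul_of_nonneg_left h4 (mul_nonneg hδ.le (pow_nonneg (by linarith) _))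
    _ = _ := by ring

theorem tsum_geom_const {δ : ℝ} (hδ : 0 < δ) (hδ1 : δ < 1) (c : ℝ) :
    HasSum (fun k : ℕ => δ * (1 - δ) ^ k * c) c := by
  have h := (hasSum_geometric_of_lt_one (r := 1 - δ) (by linarith) (by linarith)).mul_left (δ * c)
  rw [sub_sub_cancel] at h
  rw [mul_right_comm, mul_inv_cancel₀ hδ.ne', one_mul] at h
  exact h.congr_fun fun k => by ring

/-- The two geometric laws differ by a shift of one round. -/
theorem geomMean_one_sub_le {δ : ℝ} (hδ : 0 < δ) (hδ1 : δ < 1) {F : ℕ → ℝ} {A : ℝ}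
    (hF : ∀ n, |F n| ≤ A + 2 * n) (hF2 : ∀ n, |F (n + 1) - F n| ≤ 2) :
    |geomMean 1 δ F - geomMean 0 δ F| ≤ 2 := by
  have h0 := summable_geom_mul hδ hδ1 hF 0
  have h1 := summable_geom_mul hδ hδ1 hF 1
  have hc := tsum_geom_const hδ hδ1 2
  unfold geomMean
  rw [← h1.tsum_sub h0]
  rw [← Real.norm_eq_abs]
  refine tsum_of_norm_bounded hc fun k => ?_
  rw [← mul_sub, norm_mul, Real.norm_of_nonneg (mul_nonneg hδ.le (pow_nonneg (by linarith) _))]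
  exact mul_le_mul_of_nonneg_left (hF2 k) (mul_nonneg hδ.le (pow_nonneg (by linarith) _))

/-- The verification argument: a sequence `V` with `(1 - δ) V_{n+1} ≤ V_n - δ M_n + δ E` dominates
the geometric mean of `M`, up to the error `E`. -/
theorem geomMean_zero_le {δ : ℝ} (hδ : 0 < δ) (hδ1 : δ < 1) {V M : ℕ → ℝ} {A E : ℝ}
    (hV : ∀ n, |V n| ≤ A + 2 * n) (hM : ∀ n, |M n| ≤ A + 2 * n)
    (hstep : ∀ n, (1 - δ) * V (n + 1) ≤ V n - δ * M n + δ * E) :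
    geomMean 0 δ M ≤ V 0 + E := by
  have hr0 : 0 ≤ 1 - δ := by linarith
  -- discounting by `(1 - δ)^n` makes the inequalities telescope
  have hpart : ∀ n, ∑ k ∈ Finset.range n, δ * (1 - δ) ^ k * M (k + 0) ≤
      V 0 + E - (1 - δ) ^ n * E - (1 - δ) ^ n * V n := by
    intro n
    induction n with
    | zero => simp
    | succ n ih =>
      rw [Finset.sum_range_succ, pow_succ, add_zero]
      have := mul_le_mul_of_nonneg_left (hstep n) (pow_nonneg hr0 n)
      nlinarith
  have hlimE : Tendsto (fun n : ℕ => (1 - δ) ^ n * E) atTop (𝓝 0) := by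
    simpa using (tendsto_pow_atTop_nhds_zero_of_lt_one hr0 (by linarith)).mul_const E
  have hlimV : Tendsto (fun n : ℕ => (1 - δ) ^ n * V n) atTop (𝓝 0) := by
    have h := (summable_geom_mul hδ hδ1 hV 0).tendsto_atTop_zero.const_mul δ⁻¹
    rw [mul_zero] at h
    refine h.congr fun n => ?_
    rw [add_zero]
    field_simp
  have hlim := ((tendsto_const_nhds (x := V 0 + E)).sub hlimE).sub hlimV
  rw [sub_zero, sub_zero] at hlim
  exact le_of_tendsto_of_tendsto' (summable_geom_mul hδ hδ1 hM 0).hasSum.tendsto_sum_nat hlim hpart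

theorem geomMean_neg (b : ℕ) (δ : ℝ) (F : ℕ → ℝ) :
    geomMean b δ (fun n => -F n) = -geomMean b δ F := by
  unfold geomMean
  rw [← tsum_neg]
  congr 1
  funext k
  ring

theorem abs_iSup_le (hN : 0 < N) (z : Fin N → ℝ) : |⨆ i, z i| ≤ 0 + ‖z‖ := by
  have := abs_iSup_sub_le hN z 0
  have h : Nonempty (Fin N) := ⟨⟨0, hN⟩⟩
  simpa using this

section

variable {a : AdversaryRule N} {p : PlayerRule N}

theorem abs_finalRegret_le (hN : 0 < N) (ha : IsAdversary a) (hp : IsPlayer p) (x : Fin N → ℝ)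
    (n : ℕ) : |finalRegret a p x n| ≤ 0 + ‖x‖ + 2 * n :=
  abs_integral_cumRegret_le (g := fun z => ⨆ i, z i) ha hp (abs_iSup_le hN) x n

theorem abs_finalRegret_succ_sub_le (hN : 0 < N) (ha : IsAdversary a) (hp : IsPlayer p)
    (x : Fin N → ℝ) (n : ℕ) : |finalRegret a p x (n + 1) - finalRegret a p x n| ≤ 2 := by
  have := (ha n).1
  have := hp n
  have := isProbabilityMeasure_outcomeLaw ha hp n
  obtain ⟨hI, heq⟩ := integral_outcomeLaw_succ (g := fun z => ⨆ i, z i) ha hp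
    (continuous_iSup_coord hN) (abs_iSup_le hN) x n
  have hI' := integrable_cumRegret (g := fun z => ⨆ i, z i) ha hp
    (continuous_iSup_coord hN) (abs_iSup_le hN) x n
  unfold finalRegret
  rw [heq, ← integral_sub hI hI']
  have hb : ∀ h : Fin n → Round N,
      ‖(∫ ω, (⨆ i, (cumRegret x h + instRegret ω) i) ∂((a n h).prod (p n h))) -
        ⨆ i, cumRegret x h i‖ ≤ 2 := fun h => by
    have h1 := integrable_add_instRegret (ν := p n h) ((ha n).2 h)
      (continuous_iSup_coord hN) (abs_iSup_le hN) (cumRegret x h)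
    have h2 : (⨆ i, cumRegret x h i) =
        ∫ _ω, (⨆ i, cumRegret x h i) ∂((a n h).prod (p n h)) := by simp
    rw [h2, ← integral_sub h1 (integrable_const _)]
    have h3 := norm_integral_le_of_norm_le_const (μ := (a n h).prod (p n h))
      (f := fun ω => (⨆ i, (cumRegret x h + instRegret ω) i) - ⨆ i, cumRegret x h i) (C := 2) (by
        filter_upwards [ae_mem_cubeRounds ((ha n).2 h)] with ω hω
        have h4 := abs_iSup_sub_le hN (cumRegret x h + instRegret ω) (cumRegret x h)
        rw [add_sub_cancel_left] at h4
        exact h4.trans (norm_instRegret_le hω))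
    simpa using h3
  have h5 := norm_integral_le_of_norm_le_const (μ := outcomeLaw a p n) (ae_of_all _ hb)
  simpa using h5

theorem abs_geomMean_sub_le (hN : 0 < N) (ha : IsAdversary a) (hp : IsPlayer p) {δ : ℝ}
    (hδ : 0 < δ) (hδ1 : δ < 1) (x : Fin N → ℝ) {b : ℕ} (hb : b = 0 ∨ b = 1) :
    |geomMean b δ (finalRegret a p x) - geomMean 0 δ (finalRegret a p x)| ≤ 2 := by
  rcases hb with rfl | rfl
  · simp
  · exact geomMean_one_sub_le hδ hδ1 (abs_finalRegret_le hN ha hp x)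
      (abs_finalRegret_succ_sub_le hN ha hp x)

variable {W : (Fin N → ℝ) → ℝ} {C E δ : ℝ}

/-- The upper verification argument. -/
theorem geomMean_finalRegret_le (hN : 0 < N) (ha : IsAdversary a) (hp : IsPlayer p)
    (hδ : 0 < δ) (hδ1 : δ < 1) (hW : Continuous W) (hC : ∀ z, |W z| ≤ C + ‖z‖) (hC0 : 0 ≤ C)
    (x : Fin N → ℝ)
    (hstep : ∀ (n : ℕ) (h : Fin n → Round N),
      (1 - δ) * ∫ ω, W (cumRegret x h + instRegret ω) ∂((a n h).prod (p n h)) ≤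
        W (cumRegret x h) - δ * (⨆ i, cumRegret x h i) + δ * E) :
    geomMean 0 δ (finalRegret a p x) ≤ W x + E := by
  have h0 : ∫ h, W (cumRegret x h) ∂(outcomeLaw a p 0) = W x := by
    have := isProbabilityMeasure_outcomeLaw ha hp 0
    simp only [cumRegret_zero]
    simp
  rw [← h0]
  refine geomMean_zero_le (A := C + ‖x‖) hδ hδ1
    (V := fun n => ∫ h, W (cumRegret x h) ∂(outcomeLaw a p n))
    (fun n => abs_integral_cumRegret_le ha hp hC x n)
    (fun n => (abs_finalRegret_le hN ha hp x n).trans (by linarith)) fun n => ?_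
  have := isProbabilityMeasure_outcomeLaw ha hp n
  obtain ⟨hI, heq⟩ := integral_outcomeLaw_succ ha hp hW hC x n
  have hI1 := integrable_cumRegret ha hp hW hC x n
  have hI2 := integrable_cumRegret (g := fun z => ⨆ i, z i) ha hp
    (continuous_iSup_coord hN) (abs_iSup_le hN) x n
  have hI3 : Integrable (fun h => W (cumRegret x h) - δ * ⨆ i, cumRegret x h i)
      (outcomeLaw a p n) := hI1.sub (hI2.const_mul δ)
  have h := integral_mono (hI.const_mul (1 - δ)) (hI3.add (integrable_const (δ * E))) (hstep n)
  simp only [heq]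
  rw [integral_const_mul] at h
  refine h.trans (le_of_eq ?_)
  simp only [Pi.add_apply]
  rw [integral_add hI3 (integrable_const _), integral_sub hI1 (hI2.const_mul δ), integral_const_mul]
  simp [finalRegret]

/-- The lower verification argument. -/
theorem le_geomMean_finalRegret (hN : 0 < N) (ha : IsAdversary a) (hp : IsPlayer p)
    (hδ : 0 < δ) (hδ1 : δ < 1) (hW : Continuous W) (hC : ∀ z, |W z| ≤ C + ‖z‖) (hC0 : 0 ≤ C)
    (x : Fin N → ℝ)
    (hstep : ∀ (n : ℕ) (h : Fin n → Round N),
      W (cumRegret x h) - δ * (⨆ i, cumRegret x h i) - δ * E ≤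
      (1 - δ) * ∫ ω, W (cumRegret x h + instRegret ω) ∂((a n h).prod (p n h))) :
    W x - E ≤ geomMean 0 δ (finalRegret a p x) := by
  have h0 : ∫ h, W (cumRegret x h) ∂(outcomeLaw a p 0) = W x := by
    have := isProbabilityMeasure_outcomeLaw ha hp 0
    simp only [cumRegret_zero]
    simp
  suffices h : geomMean 0 δ (fun n => -finalRegret a p x n) ≤
      -(∫ h, W (cumRegret x h) ∂(outcomeLaw a p 0)) + E by
    rw [geomMean_neg, h0] at h
    linarith
  refine geomMean_zero_le (A := C + ‖x‖) hδ hδ1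
    (V := fun n => -∫ h, W (cumRegret x h) ∂(outcomeLaw a p n))
    (fun n => by rw [abs_neg]; exact abs_integral_cumRegret_le ha hp hC x n)
    (fun n => by rw [abs_neg]; exact (abs_finalRegret_le hN ha hp x n).trans (by linarith))
    fun n => ?_
  have := isProbabilityMeasure_outcomeLaw ha hp n
  obtain ⟨hI, heq⟩ := integral_outcomeLaw_succ ha hp hW hC x n
  have hI1 := integrable_cumRegret ha hp hW hC x n
  have hI2 := integrable_cumRegret (g := fun z => ⨆ i, z i) ha hp
    (continuous_iSup_coord hN) (abs_iSup_le hN) x n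
  have hI3 : Integrable (fun h => W (cumRegret x h) - δ * ⨆ i, cumRegret x h i)
      (outcomeLaw a p n) := hI1.sub (hI2.const_mul δ)
  have h := integral_mono (hI3.sub (integrable_const (δ * E))) (hI.const_mul (1 - δ)) (hstep n)
  simp only [heq]
  rw [integral_const_mul] at h
  simp only [Pi.sub_apply] at h
  rw [integral_sub hI3 (integrable_const _), integral_sub hI1 (hI2.const_mul δ),
    integral_const_mul] at h
  simp only [integral_const, probReal_univ, one_smul] at h
  unfold finalRegret
  linarith

end

/-! ### The max-based strategies -/

section

variable {δ κ : ℝ}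

theorem kappaUpper_pos (hN : 0 < N) (hδ : 0 < δ) (hδ1 : δ < 1) : 0 < kappaUpper N δ := by
  rw [kappaUpper_eq]
  have := one_le_cubeFactor hN
  exact mul_pos (div_pos (by linarith) hδ) (by linarith)

theorem kappaLower_pos (hδ : 0 < δ) (hδ1 : δ < 1) : 0 < kappaLower δ :=
  div_pos (by linarith) hδ

theorem abs_maxTransform_le (hN : 0 < N) (hδ : 0 < δ) (hκ : 0 < κ) (z : Fin N → ℝ) :
    |maxTransform N δ κ z| ≤ maxTransform N δ κ 0 + ‖z‖ := by
  have h1 := iSup_le_maxTransform hN hδ hκ z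
  have h2 := maxTransform_le hN hδ hκ z
  have h3 := iSup_le_maxTransform hN hδ hκ 0
  have h4 := abs_le.1 (abs_iSup_le hN z)
  have h5 := abs_le.1 (abs_iSup_le hN (0 : Fin N → ℝ))
  simp only [norm_zero] at h5
  rw [abs_le]
  constructor <;> linarith [h4.1, h4.2, h5.1]

theorem maxTransform_zero_nonneg (hN : 0 < N) (hδ : 0 < δ) (hκ : 0 < κ) :
    0 ≤ maxTransform N δ κ 0 := by
  have := (abs_nonneg _).trans (abs_maxTransform_le hN hδ hκ 0)
  simpa using this

theorem partialDeriv_geomUpperPotential_mem (hN : 0 < N) (hδ : 0 < δ) (hδ1 : δ < 1)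
    (z : Fin N → ℝ) :
    (fun i => partialDeriv i (geomUpperPotential N δ) z) ∈ stdSimplex ℝ (Fin N) :=
  partialDeriv_maxTransform_mem hN hδ (kappaUpper_pos hN hδ hδ1) z

theorem isProbabilityMeasure_maxPlayer (hN : 0 < N) (hδ : 0 < δ) (hδ1 : δ < 1)
    (z : Fin N → ℝ) : IsProbabilityMeasure (maxPlayer N δ z) := by
  obtain ⟨h0, h1⟩ := partialDeriv_geomUpperPotential_mem hN hδ hδ1 z
  refine ⟨?_⟩
  change (∑ i, ENNReal.ofReal (partialDeriv i (geomUpperPotential N δ) z) •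
    Measure.dirac i : Measure (Fin N)) Set.univ = 1
  simp only [Measure.coe_finsetSum, Finset.sum_apply, Measure.smul_apply, smul_eq_mul,
    measure_univ, mul_one]
  rw [← ENNReal.ofReal_sum_of_nonneg fun i _ => h0 i]
  exact (congrArg ENNReal.ofReal h1).trans ENNReal.ofReal_one

theorem integral_maxPlayer (hN : 0 < N) (hδ : 0 < δ) (hδ1 : δ < 1) (z : Fin N → ℝ)
    (f : Fin N → ℝ) :
    ∫ i, f i ∂(maxPlayer N δ z) = ∑ i, partialDeriv i (geomUpperPotential N δ) z * f i := by
  have h0 := (partialDeriv_geomUpperPotential_mem hN hδ hδ1 z).1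
  change ∫ i, f i ∂(∑ i, ENNReal.ofReal (partialDeriv i (geomUpperPotential N δ) z) •
    Measure.dirac i : Measure (Fin N)) = _
  rw [integral_finsetSum_measure fun i _ =>
    (Integrable.of_finite).smul_measure ENNReal.ofReal_ne_top]
  refine Finset.sum_congr rfl fun i _ => ?_
  have := h0 i
  rw [integral_smul_measure, integral_dirac, ENNReal.toReal_ofReal this, smul_eq_mul]

theorem isPlayer_maxPlayer (hN : 0 < N) (hδ : 0 < δ) (hδ1 : δ < 1) (x : Fin N → ℝ) :
    IsPlayer (markovPlayer (maxPlayer N δ) x) := fun n =>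
  ⟨fun h => by
    rw [markovPlayer, Kernel.comap_apply]
    exact isProbabilityMeasure_maxPlayer hN hδ hδ1 _⟩

variable {s : (Fin N → ℝ) → Fin N} (hs : IsArgmax s)

theorem maxAdversary_apply (z : Fin N → ℝ) : maxAdversary s hs z =
    (2⁻¹ : ENNReal) • Measure.dirac (maxVector (s z)) +
      (2⁻¹ : ENNReal) • Measure.dirac (-maxVector (s z)) := rfl

theorem isProbabilityMeasure_maxAdversary (z : Fin N → ℝ) :
    IsProbabilityMeasure (maxAdversary s hs z) := by
  refine ⟨?_⟩
  rw [maxAdversary_apply]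
  simp [ENNReal.inv_two_add_inv_two]

theorem ae_maxAdversary_mem (z : Fin N → ℝ) :
    ∀ᵐ q ∂(maxAdversary s hs z), ∀ i, q i ∈ Set.Icc (-1 : ℝ) 1 := by
  rw [maxAdversary_apply, ae_add_measure_iff]
  constructor <;> refine Measure.ae_smul_measure ((ae_dirac_iff measurableSet_cube).2 fun i => ?_) _
  · exact maxVector_mem _ _
  · have := maxVector_mem (s z) i
    exact ⟨neg_le_neg this.2, neg_le.1 this.1⟩

theorem isAdversary_maxAdversary (x : Fin N → ℝ) :
    IsAdversary (markovAdversary (maxAdversary s hs) x) := fun n =>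
  ⟨⟨fun h => by
    rw [markovAdversary, Kernel.comap_apply]
    exact isProbabilityMeasure_maxAdversary hs _⟩, fun h => by
    rw [markovAdversary, Kernel.comap_apply]
    exact ae_maxAdversary_mem hs _⟩

theorem integral_maxAdversary (z : Fin N → ℝ) (f : (Fin N → ℝ) → ℝ) :
    ∫ q, f q ∂(maxAdversary s hs z) = (f (maxVector (s z)) + f (-maxVector (s z))) / 2 := by
  rw [maxAdversary_apply, integral_add_measure
    ((integrable_dirac (by simp)).smul_measure (by simp))
    ((integrable_dirac (by simp)).smul_measure (by simp)), integral_smul_measure,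
    integral_smul_measure, integral_dirac, integral_dirac]
  simp only [ENNReal.toReal_inv, ENNReal.toReal_ofNat, smul_eq_mul]
  ring

/-! ### One round of the game -/

theorem maxTransform_add_instRegret (hN : 0 < N) (hδ : 0 < δ) (hκ : 0 < κ) (z q : Fin N → ℝ)
    (i : Fin N) :
    maxTransform N δ κ (z + instRegret (q, i)) = maxTransform N δ κ (z - q) + q i := by
  rw [← maxTransform_add_const hN hδ hκ]
  congr 1
  funext j
  simp only [Pi.add_apply, Pi.sub_apply, instRegret]
  ring

/-- Against the max-based player the first order terms cancel, since the player follows the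
gradient; what remains is the second order term, which `kappaUpper` dominates on the whole cube. -/
theorem integral_geomUpperPotential_le (hN : 0 < N) (hδ : 0 < δ) (hδ1 : δ < 1)
    {μ : Measure (Fin N → ℝ)} [IsProbabilityMeasure μ]
    (hμ : ∀ᵐ q ∂μ, ∀ i, q i ∈ Set.Icc (-1 : ℝ) 1) (z : Fin N → ℝ) :
    (1 - δ) * ∫ ω, geomUpperPotential N δ (z + instRegret ω) ∂(μ.prod (maxPlayer N δ z)) ≤
      geomUpperPotential N δ z - δ * (⨆ i, z i) + δ * (20 * N * (1 + Real.log (1 / δ))) := by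
  have hκ := kappaUpper_pos hN hδ hδ1
  have := isProbabilityMeasure_maxPlayer hN hδ hδ1 z
  have h1 := (partialDeriv_geomUpperPotential_mem hN hδ hδ1 z).2
  have hI := integrable_add_instRegret (ν := maxPlayer N δ z) hμ
    (g := geomUpperPotential N δ) (differentiable_maxTransform hN hδ hκ).continuous
    (abs_maxTransform_le hN hδ hκ) z
  set L := 20 * N * (1 + Real.log (1 / δ)) with hL
  have hc : cubeFactor N / kappaUpper N δ = δ / (1 - δ) := by
    have := one_le_cubeFactor hN
    have : cubeFactor N ≠ 0 := by positivity
    have : 1 - δ ≠ 0 := by linarith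
    rw [kappaUpper_eq]
    field_simp
  have hinner : ∀ q : Fin N → ℝ, (∀ i, q i ∈ Set.Icc (-1 : ℝ) 1) →
      ∫ i, geomUpperPotential N δ (z + instRegret (q, i)) ∂(maxPlayer N δ z) ≤
        geomUpperPotential N δ z + δ / (1 - δ) * (geomUpperPotential N δ z - ⨆ i, z i) +
          δ / (1 - δ) * L := by
    intro q hq
    rw [integral_maxPlayer hN hδ hδ1]
    have hneg : ∀ i, (-q) i ∈ Set.Icc (-1 : ℝ) 1 := fun i =>
      ⟨neg_le_neg (hq i).2, neg_le.1 (hq i).1⟩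
    have h2 := maxTransform_add_le hN hδ hδ1 hκ z hneg
    have h3 := iSup_le_maxPotential hN hκ (t := -δ) (by linarith) z
    have h4 : fderiv ℝ (maxTransform N δ (kappaUpper N δ)) z q =
        ∑ i, partialDeriv i (geomUpperPotential N δ) z * q i :=
      clm_eq_sum_proj _ q
    have h5 : 0 ≤ δ / (1 - δ) := div_nonneg hδ.le (by linarith)
    have h6 : ∑ i, partialDeriv i (geomUpperPotential N δ) z = 1 := h1
    -- the regret vector is `q_I 𝟙 - q`, and constants can be pulled out of the potential
    have h7 : ∑ i, partialDeriv i (geomUpperPotential N δ) z *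
        geomUpperPotential N δ (z + instRegret (q, i)) =
        geomUpperPotential N δ (z - q) +
          ∑ i, partialDeriv i (geomUpperPotential N δ) z * q i := by
      unfold geomUpperPotential at h6 ⊢
      simp only [maxTransform_add_instRegret hN hδ hκ, mul_add, Finset.sum_add_distrib]
      rw [← Finset.sum_mul, h6, one_mul]
    rw [h7, ← h4]
    rw [map_neg, ← sub_eq_add_neg, hc] at h2
    have h8 := mul_le_mul_of_nonneg_left h3 h5
    have h9 : 20 * N * cubeFactor N / kappaUpper N δ * (1 + Real.log (1 / δ)) =
        δ / (1 - δ) * L := by rw [← hc, hL]; ring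
    unfold geomUpperPotential
    rw [h9] at h2
    linarith
  rw [integral_prod _ hI]
  have h10 := integral_mono_ae hI.integral_prod_left (integrable_const _)
    (hμ.mono fun q hq => hinner q hq)
  rw [integral_const, probReal_univ, one_smul] at h10
  have h11 := mul_le_mul_of_nonneg_left h10 (by linarith : 0 ≤ 1 - δ)
  refine h11.trans (le_of_eq ?_)
  have : 1 - δ ≠ 0 := by linarith
  field_simp
  ring

/-- Against the max adversary the choice of the player does not matter, since the losses are
symmetric; the second order term in the direction of the adversary is the one of the equation. -/
theorem le_integral_geomLowerPotential (hN : 0 < N) (hδ : 0 < δ) (hδ1 : δ < 1)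
    {ν : Measure (Fin N)} [IsProbabilityMeasure ν] (z : Fin N → ℝ) :
    geomLowerPotential N δ z - δ * (⨆ i, z i) - δ * (40 * N * (1 + Real.log (1 / δ))) ≤
      (1 - δ) * ∫ ω, geomLowerPotential N δ (z + instRegret ω)
        ∂((maxAdversary s hs z).prod ν) := by
  have hκ := kappaLower_pos hδ hδ1
  have := isProbabilityMeasure_maxAdversary hs z
  have hI := integrable_add_instRegret (ν := ν) (ae_maxAdversary_mem hs z)
    (g := maxTransform N δ (kappaLower δ)) (differentiable_maxTransform hN hδ hκ).continuous
    (abs_maxTransform_le hN hδ hκ) z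
  set W := maxTransform N δ (kappaLower δ) with hW
  set C0 := 2 * √(kappaLower δ * δ / Real.pi) * (((N : ℝ) - 1) / N) with hC0
  set q := maxVector (s z) with hq
  have hc : 2 / kappaLower δ = δ / (1 - δ) := by
    have : 1 - δ ≠ 0 := by linarith
    unfold kappaLower
    field_simp
  have hint : ∫ ω, geomLowerPotential N δ (z + instRegret ω) ∂((maxAdversary s hs z).prod ν) =
      (W (z - q) + W (z + q)) / 2 - C0 := by
    unfold geomLowerPotential
    rw [integral_sub hI (integrable_const _), integral_const, probReal_univ, one_smul,
      integral_prod_symm _ hI]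
    congr 1
    simp only [integral_maxAdversary, hW, maxTransform_add_instRegret hN hδ hκ]
    rw [← hq]
    have : ∀ i, (W (z - q) + q i + (W (z - -q) + (-q) i)) / 2 = (W (z - q) + W (z + q)) / 2 :=
      fun i => by rw [sub_neg_eq_add, Pi.neg_apply]; ring
    simp only [← hW, this, integral_const, probReal_univ, one_smul]
  have h1 := le_maxTransform_add_maxVector hN hδ hδ1 hκ (x := z) (k := s z) (ε := 1)
    (hs.le z) (by simp)
  have h2 := le_maxTransform_add_maxVector hN hδ hδ1 hκ (x := z) (k := s z) (ε := -1)
    (hs.le z) (by simp)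
  rw [← hq, one_smul, hc] at h1
  rw [← hq, neg_one_smul, map_neg, ← sub_eq_add_neg (z : Fin N → ℝ), hc] at h2
  -- the constant subtracted in the lower potential absorbs the gap between `ψ(·, -δ)` and `max`
  have h3 : maxPotential N (kappaLower δ) z (-δ) ≤ (⨆ i, z i) + C0 := by
    have h := maxPotential_le hN hκ (t := -δ) (by linarith) z
    rw [hC0, ← maxPotential_zero_neg hN hδ hκ, maxPotential_zero hN]
    exact h
  have h5 : 0 ≤ δ / (1 - δ) := div_nonneg hδ.le (by linarith)
  have h6 := mul_le_mul_of_nonneg_left h3 h5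
  have h7 : 80 * N / kappaLower δ * (1 + Real.log (1 / δ)) =
      δ / (1 - δ) * (40 * N * (1 + Real.log (1 / δ))) := by rw [← hc]; ring
  rw [h7] at h1 h2
  have h8 : geomLowerPotential N δ z + δ / (1 - δ) * (geomLowerPotential N δ z - (⨆ i, z i) -
      40 * N * (1 + Real.log (1 / δ))) ≤ (W (z - q) + W (z + q)) / 2 - C0 := by
    have : geomLowerPotential N δ z = W z - C0 := rfl
    rw [this]
    linarith
  rw [hint]
  refine le_trans (le_of_eq ?_) (mul_le_mul_of_nonneg_left h8 (by linarith : 0 ≤ 1 - δ))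
  have : 1 - δ ≠ 0 := by linarith
  field_simp
  ring

end

/-! ### Bounds for the value functions -/

/-- The error term of both bounds. The constant leaves room for the error `40 N (1 + log (1 / δ))`
of the lower verification argument and the difference of at most `2` between the geometric laws. -/
def errorBound (N : ℕ) (δ : ℝ) : ℝ := 80 * (N * (1 + Real.log (1 / δ)))

section

variable {δ : ℝ}

theorem one_le_errorFactor (hN : 0 < N) (hδ : 0 < δ) (hδ1 : δ < 1) :
    1 ≤ N * (1 + Real.log (1 / δ)) := by
  have h1 : (1 : ℝ) ≤ N := by exact_mod_cast hN
  have h2 : 0 ≤ Real.log (1 / δ) := Real.log_nonneg (by rw [le_div_iff₀ hδ]; linarith)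
  nlinarith

theorem errorBound_nonneg (hN : 0 < N) (hδ : 0 < δ) (hδ1 : δ < 1) : 0 ≤ errorBound N δ := by
  have := one_le_errorFactor hN hδ hδ1
  unfold errorBound
  linarith

theorem exists_isAdversary (hN : 0 < N) : Nonempty {a : AdversaryRule N // IsAdversary a} := by
  refine ⟨fun _ => Kernel.const _ (Measure.dirac (maxVector ⟨0, hN⟩)), fun n => ⟨inferInstance,
    fun h => ?_⟩⟩
  rw [Kernel.const_apply]
  exact (ae_dirac_iff measurableSet_cube).2 fun i => maxVector_mem _ i

theorem exists_isPlayer (hN : 0 < N) : Nonempty {p : PlayerRule N // IsPlayer p} :=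
  ⟨fun _ => Kernel.const _ (Measure.dirac ⟨0, hN⟩), fun _ => inferInstance⟩

/-- The first index of a largest component is a measurable choice. -/
theorem exists_isArgmax (hN : 0 < N) : ∃ s : (Fin N → ℝ) → Fin N, IsArgmax s := by
  have h : ∀ z : Fin N → ℝ, ∃ i, (∀ j, z j ≤ z i) ∧ ∀ k < i, ¬ ∀ j, z j ≤ z k := fun z => by
    obtain ⟨i, hi⟩ := exists_argmax hN z
    obtain ⟨m, hm, hmin⟩ := WellFounded.has_min (wellFounded_lt (α := Fin N))
      {i | ∀ j, z j ≤ z i} ⟨i, hi⟩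
    exact ⟨m, hm, fun k hk h => hmin k h hk⟩
  choose s hs1 hs2 using h
  refine ⟨s, measurable_to_countable' fun i => ?_, hs1⟩
  have hle : ∀ k, MeasurableSet {z : Fin N → ℝ | ∀ j, z j ≤ z k} := fun k => by
    simp only [Set.ofPred_forall]
    exact MeasurableSet.iInter fun j =>
      measurableSet_le (measurable_pi_apply j) (measurable_pi_apply k)
  have heq : s ⁻¹' {i} = {z | ∀ j, z j ≤ z i} ∩ ⋂ k, ⋂ _ : k < i, {z | ∀ j, z j ≤ z k}ᶜ := by
    ext z
    simp only [Set.mem_preimage, Set.mem_singleton_iff, Set.mem_inter_iff, Set.mem_iInter,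
      Set.mem_compl_iff, Set.mem_ofPred_eq]
    constructor
    · rintro rfl
      exact ⟨hs1 z, hs2 z⟩
    · rintro ⟨h1, h2⟩
      rcases lt_trichotomy (s z) i with h | h | h
      · exact absurd (hs1 z) (h2 _ h)
      · exact h
      · exact absurd h1 (hs2 z _ h)
  rw [heq]
  exact (hle i).inter (MeasurableSet.iInter fun k => MeasurableSet.iInter fun _ => (hle k).compl)

variable {a : AdversaryRule N} {p : PlayerRule N} {b : ℕ}

/-- A bound that is uniform in the strategies, so that the value functions are finite. -/
theorem abs_geomMean_finalRegret_le (hN : 0 < N) (ha : IsAdversary a) (hp : IsPlayer p)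
    (hδ : 0 < δ) (hδ1 : δ < 1) (x : Fin N → ℝ) (b : ℕ) :
    |geomMean b δ (finalRegret a p x)| ≤ geomMean b δ fun n => 0 + ‖x‖ + 2 * n := by
  have hs := summable_geom_mul hδ hδ1 (F := fun n => 0 + ‖x‖ + 2 * n) (A := 0 + ‖x‖)
    (fun n => le_of_eq (abs_of_nonneg (by positivity))) b
  rw [← Real.norm_eq_abs]
  refine tsum_of_norm_bounded hs.hasSum fun k => ?_
  rw [norm_mul, Real.norm_of_nonneg (mul_nonneg hδ.le (pow_nonneg (by linarith) _))]
  exact mul_le_mul_of_nonneg_left (abs_finalRegret_le hN ha hp x (k + b))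
    (mul_nonneg hδ.le (pow_nonneg (by linarith) _))

theorem geomMean_maxPlayer_le (hN : 0 < N) (hδ : 0 < δ) (hδ1 : δ < 1) (hb : b = 0 ∨ b = 1)
    (ha : IsAdversary a) (x : Fin N → ℝ) :
    geomMean b δ (finalRegret a (markovPlayer (maxPlayer N δ) x) x) ≤
      geomUpperPotential N δ x + errorBound N δ := by
  have hκ := kappaUpper_pos hN hδ hδ1
  have hp := isPlayer_maxPlayer hN hδ hδ1 x
  have h1 := abs_le.1 (abs_geomMean_sub_le hN ha hp hδ hδ1 x hb)
  have h2 := geomMean_finalRegret_le (W := geomUpperPotential N δ) hN ha hp hδ hδ1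
    (differentiable_maxTransform hN hδ hκ).continuous (abs_maxTransform_le hN hδ hκ)
    (maxTransform_zero_nonneg hN hδ hκ) x (E := 20 * N * (1 + Real.log (1 / δ))) fun n h => by
      have := (ha n).1
      rw [markovPlayer, Kernel.comap_apply]
      exact integral_geomUpperPotential_le hN hδ hδ1 ((ha n).2 h) (cumRegret x h)
  have h3 := one_le_errorFactor hN hδ hδ1
  unfold errorBound
  linarith [h1.2]

theorem le_geomMean_maxAdversary (hN : 0 < N) (hδ : 0 < δ) (hδ1 : δ < 1) (hb : b = 0 ∨ b = 1)
    {s : (Fin N → ℝ) → Fin N} (hs : IsArgmax s) (hp : IsPlayer p) (x : Fin N → ℝ) :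
    geomLowerPotential N δ x - errorBound N δ ≤
      geomMean b δ (finalRegret (markovAdversary (maxAdversary s hs) x) p x) := by
  have hκ := kappaLower_pos hδ hδ1
  have ha := isAdversary_maxAdversary hs x
  have h1 := abs_le.1 (abs_geomMean_sub_le hN ha hp hδ hδ1 x hb)
  set c := 2 * √(kappaLower δ * δ / Real.pi) * (((N : ℝ) - 1) / N)
  have hN1 : (1 : ℝ) ≤ N := by exact_mod_cast hN
  have hc0 : 0 ≤ c := by
    have : 0 ≤ ((N : ℝ) - 1) / N := div_nonneg (by linarith) (by linarith)
    positivity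
  have hC : ∀ z, |geomLowerPotential N δ z| ≤ maxTransform N δ (kappaLower δ) 0 + c + ‖z‖ :=
    fun z => by
      have h := abs_maxTransform_le hN hδ hκ z
      have h' := abs_sub (maxTransform N δ (kappaLower δ) z) c
      rw [abs_of_nonneg hc0] at h'
      unfold geomLowerPotential
      linarith
  have h2 := le_geomMean_finalRegret (W := geomLowerPotential N δ) hN ha hp hδ hδ1
    ((differentiable_maxTransform hN hδ hκ).continuous.sub continuous_const) hC
    (add_nonneg (maxTransform_zero_nonneg hN hδ hκ) hc0) x
    (E := 40 * N * (1 + Real.log (1 / δ))) fun n h => by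
      have := hp n
      rw [markovAdversary, Kernel.comap_apply]
      exact le_integral_geomLowerPotential hs hN hδ hδ1 (cumRegret x h)
  have h3 := one_le_errorFactor hN hδ hδ1
  unfold errorBound
  linarith [h1.1]

theorem bddAbove_geomMean (hN : 0 < N) (hδ : 0 < δ) (hδ1 : δ < 1) (hp : IsPlayer p)
    (x : Fin N → ℝ) (b : ℕ) :
    BddAbove (Set.range fun a : {a : AdversaryRule N // IsAdversary a} =>
      geomMean b δ (finalRegret a p x)) := by
  refine ⟨geomMean b δ fun n => 0 + ‖x‖ + 2 * n, ?_⟩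
  rintro _ ⟨a, rfl⟩
  exact (abs_le.1 (abs_geomMean_finalRegret_le hN a.2 hp hδ hδ1 x b)).2

theorem bddBelow_geomMean (hN : 0 < N) (hδ : 0 < δ) (hδ1 : δ < 1) (ha : IsAdversary a)
    (x : Fin N → ℝ) (b : ℕ) :
    BddBelow (Set.range fun p : {p : PlayerRule N // IsPlayer p} =>
      geomMean b δ (finalRegret a p x)) := by
  refine ⟨-geomMean b δ fun n => 0 + ‖x‖ + 2 * n, ?_⟩
  rintro _ ⟨p, rfl⟩
  exact (abs_le.1 (abs_geomMean_finalRegret_le hN ha p.2 hδ hδ1 x b)).1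

theorem playerValue_le (hN : 0 < N) (hδ : 0 < δ) (hδ1 : δ < 1) (hb : b = 0 ∨ b = 1)
    (x : Fin N → ℝ) :
    playerValue b δ (maxPlayer N δ) x ≤ geomUpperPotential N δ x + errorBound N δ := by
  have := exists_isAdversary hN
  exact ciSup_le fun a => geomMean_maxPlayer_le hN hδ hδ1 hb a.2 x

theorem le_adversaryValue (hN : 0 < N) (hδ : 0 < δ) (hδ1 : δ < 1) (hb : b = 0 ∨ b = 1)
    {s : (Fin N → ℝ) → Fin N} (hs : IsArgmax s) (x : Fin N → ℝ) :
    geomLowerPotential N δ x - errorBound N δ ≤ adversaryValue b δ (maxAdversary s hs) x := by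
  have := exists_isPlayer hN
  exact le_ciInf fun p => le_geomMean_maxAdversary hN hδ hδ1 hb hs p.2 x

/-! ### Regret bounds -/

/-- The regret is the largest component of the regret vector started from `0`. -/
theorem fixedRegret_eq (hN : 0 < N) (a : AdversaryRule N) (p : PlayerRule N) :
    fixedRegret a p = finalRegret a p 0 := by
  have : Nonempty (Fin N) := ⟨⟨0, hN⟩⟩
  funext T
  refine integral_congr_ae (ae_of_all _ fun h => ?_)
  have h1 : ∀ i, cumRegret 0 h i = ∑ τ, (h τ).1 (h τ).2 - ∑ τ, (h τ).1 i := fun i => by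
    simp [cumRegret, instRegret, Finset.sum_apply]
  simp only [h1]
  refine le_antisymm ?_ (ciSup_le fun i => sub_le_sub_left
    (ciInf_le (f := fun i => ∑ τ, (h τ).1 i) (Set.finite_range _).bddBelow i) _)
  rw [sub_le_comm]
  exact le_ciInf fun i => sub_le_comm.1 (le_ciSup (f := fun i =>
    ∑ τ, (h τ).1 (h τ).2 - ∑ τ, (h τ).1 i) (Set.finite_range _).bddAbove i)

theorem regret_eq (hN : 0 < N) (b : ℕ) (δ : ℝ) (a : AdversaryRule N) (p : PlayerRule N) :
    regret b δ a p = geomMean b δ (finalRegret a p 0) := by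
  rw [regret, fixedRegret_eq hN]

theorem minRegret_eq (hN : 0 < N) (b : ℕ) (δ : ℝ) (α : Kernel (Fin N → ℝ) (Fin N → ℝ)) :
    minRegret b δ α = adversaryValue b δ α 0 := by
  simp only [minRegret, adversaryValue, regret_eq hN]

theorem maxRegret_eq (hN : 0 < N) (b : ℕ) (δ : ℝ) (π : Kernel (Fin N → ℝ) (Fin N)) :
    maxRegret b δ π = playerValue b δ π 0 := by
  simp only [maxRegret, playerValue, regret_eq hN]

/-- The constant subtracted in the lower potential is exactly the second term of
`maxTransform_zero`. -/
theorem geomLowerPotential_zero (hN : 0 < N) (hδ : 0 < δ) (hδ1 : δ < 1) :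
    geomLowerPotential N δ 0 = lowerRegretBound N δ := by
  rw [geomLowerPotential, maxTransform_zero hN hδ (kappaLower_pos hδ hδ1), add_sub_cancel_right,
    kappaLower, lowerRegretBound]

theorem geomUpperPotential_zero (hN : 0 < N) (hδ : 0 < δ) (hδ1 : δ < 1) :
    geomUpperPotential N δ 0 = ((N : ℝ) - 1) / N * √(kappaUpper N δ) *
      (Real.exp δ * erfc √δ + 2 / √Real.pi * √δ) := by
  have hκ := kappaUpper_pos hN hδ hδ1
  rw [geomUpperPotential, maxTransform_zero hN hδ hκ, Real.sqrt_div (by positivity),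
    Real.sqrt_mul hκ.le]
  ring

theorem sub_one_div_nonneg (hN : 0 < N) : 0 ≤ ((N : ℝ) - 1) / N := by
  have hN1 : (1 : ℝ) ≤ N := by exact_mod_cast hN
  exact div_nonneg (by linarith) (by linarith)

theorem geomUpperPotential_zero_le (hN : 0 < N) (hδ : 0 < δ) (hδ1 : δ < 1) :
    geomUpperPotential N δ 0 ≤ upperRegretBound N δ := by
  rw [geomUpperPotential_zero hN hδ hδ1, upperRegretBound]
  have := sub_one_div_nonneg hN
  gcongr
  norm_num

theorem maxRegret_le (hN : 0 < N) (hδ : 0 < δ) (hδ1 : δ < 1) (hb : b = 0 ∨ b = 1) :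
    maxRegret b δ (maxPlayer N δ) ≤ upperRegretBound N δ + errorBound N δ := by
  rw [maxRegret_eq hN]
  have h1 := playerValue_le hN hδ hδ1 hb 0
  have h2 := geomUpperPotential_zero_le hN hδ hδ1
  linarith

theorem le_minRegret (hN : 0 < N) (hδ : 0 < δ) (hδ1 : δ < 1) (hb : b = 0 ∨ b = 1)
    {s : (Fin N → ℝ) → Fin N} (hs : IsArgmax s) :
    lowerRegretBound N δ - errorBound N δ ≤ minRegret b δ (maxAdversary s hs) := by
  rw [minRegret_eq hN, ← geomLowerPotential_zero hN hδ hδ1]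
  exact le_adversaryValue hN hδ hδ1 hb hs 0

theorem minRegret_le_maxRegret (hN : 0 < N) (hδ : 0 < δ) (hδ1 : δ < 1) (b : ℕ)
    {s : (Fin N → ℝ) → Fin N} (hs : IsArgmax s) :
    minRegret b δ (maxAdversary s hs) ≤ maxRegret b δ (maxPlayer N δ) := by
  rw [minRegret_eq hN, maxRegret_eq hN]
  have ha := isAdversary_maxAdversary hs 0
  have hp := isPlayer_maxPlayer hN hδ hδ1 0
  exact (ciInf_le (bddBelow_geomMean hN hδ hδ1 ha 0 b) ⟨_, hp⟩).trans
    (le_ciSup (bddAbove_geomMean hN hδ hδ1 hp 0 b) ⟨_, ha⟩)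

theorem minimaxRegret_le (hN : 0 < N) (hδ : 0 < δ) (hδ1 : δ < 1) (b : ℕ) :
    minimaxRegret N b δ ≤ maxRegret b δ (maxPlayer N δ) := by
  obtain ⟨s, hs⟩ := exists_isArgmax hN
  have ha := isAdversary_maxAdversary hs 0
  refine ciInf_le ⟨-geomMean b δ fun n => 0 + ‖(0 : Fin N → ℝ)‖ + 2 * n, ?_⟩
    (⟨_, isPlayer_maxPlayer hN hδ hδ1 0⟩ : {p : PlayerRule N // IsPlayer p})
  rintro _ ⟨p, rfl⟩
  simp only [regret_eq hN]
  exact (abs_le.1 (abs_geomMean_finalRegret_le hN ha p.2 hδ hδ1 0 b)).1.trans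
    (le_ciSup (bddAbove_geomMean hN hδ hδ1 p.2 0 b) ⟨_, ha⟩)

theorem minRegret_le_minimaxRegret (hN : 0 < N) (hδ : 0 < δ) (hδ1 : δ < 1) (b : ℕ)
    {s : (Fin N → ℝ) → Fin N} (hs : IsArgmax s) :
    minRegret b δ (maxAdversary s hs) ≤ minimaxRegret N b δ := by
  have := exists_isPlayer hN
  have ha := isAdversary_maxAdversary hs 0
  unfold minRegret minimaxRegret
  simp only [regret_eq hN]
  exact ciInf_mono (bddBelow_geomMean hN hδ hδ1 ha 0 b) fun p =>
    le_ciSup (bddAbove_geomMean hN hδ hδ1 p.2 0 b) ⟨_, ha⟩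

end

/-! ### Asymptotic optimality for two and three experts -/

theorem isEquivalent_of_le_of_le {l : Filter ℝ} {f g u t : ℝ → ℝ} (hf : f ~[l] t) (hu : u ~[l] t)
    (ht : ∀ᶠ δ in l, 0 < t δ) (h1 : ∀ᶠ δ in l, f δ ≤ g δ) (h2 : ∀ᶠ δ in l, g δ ≤ u δ) :
    g ~[l] t := by
  have hne : ∀ᶠ δ in l, t δ ≠ 0 := ht.mono fun δ h => h.ne'
  rw [isEquivalent_iff_tendsto_one hne] at hf hu ⊢
  refine tendsto_of_tendsto_of_tendsto_of_le_of_le' hf hu ?_ ?_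
  · filter_upwards [ht, h1] with δ h h'
    exact div_le_div_of_nonneg_right h' h.le
  · filter_upwards [ht, h2] with δ h h'
    exact div_le_div_of_nonneg_right h' h.le

theorem tendsto_exp_mul_erfc :
    Tendsto (fun δ : ℝ => Real.exp δ * erfc √δ) (𝓝[>] 0) (𝓝 1) := by
  have hc : Continuous erf :=
    continuous_iff_continuousAt.2 fun y => (hasDerivAt_erf y).continuousAt
  have h : Continuous fun δ : ℝ => Real.exp δ * erfc √δ := by
    unfold erfc
    fun_prop
  have h0 := h.tendsto 0
  simp only [Real.exp_zero, Real.sqrt_zero, one_mul] at h0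
  have h1 : erfc 0 = 1 := by simp [erfc, erf]
  rw [h1] at h0
  exact h0.mono_left nhdsWithin_le_nhds

theorem leadingTerm_pos {c δ : ℝ} (hc : 0 < c) (hδ : 0 < δ) (hδ1 : δ < 1) :
    0 < leadingTerm c δ :=
  mul_pos hc (Real.sqrt_pos.2 (div_pos (by linarith) (by linarith)))

theorem isLittleO_errorBound (N : ℕ) {c : ℝ} (hc : 0 < c) :
    errorBound N =o[𝓝[>] 0] leadingTerm c := by
  have hev : ∀ᶠ δ : ℝ in 𝓝[>] 0, δ ∈ Set.Ioo (0 : ℝ) 1 := Ioo_mem_nhdsGT one_pos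
  rw [isLittleO_iff_tendsto' (hev.mono fun δ hδ h => absurd h (leadingTerm_pos hc hδ.1 hδ.2).ne')]
  have h1 : Tendsto (fun δ : ℝ => Real.log δ * √δ) (𝓝[>] 0) (𝓝 0) := by
    simpa only [Real.sqrt_eq_rpow] using
      tendsto_log_mul_rpow_nhdsGT_zero (r := 1 / 2) (by norm_num)
  have h2 : Tendsto (fun δ : ℝ => √δ) (𝓝[>] 0) (𝓝 0) := by
    simpa using (Real.continuous_sqrt.tendsto 0).mono_left nhdsWithin_le_nhds
  have h3 : Tendsto (fun δ : ℝ => √((1 - δ) / 2)) (𝓝[>] 0) (𝓝 √(1 / 2)) := by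
    have : Continuous fun δ : ℝ => √((1 - δ) / 2) := by fun_prop
    simpa using (this.tendsto 0).mono_left nhdsWithin_le_nhds
  have h4 := ((h2.sub h1).const_mul (80 * N / c)).div h3 (by positivity)
  simp only [sub_zero, mul_zero, zero_div] at h4
  refine h4.congr' (hev.mono fun δ hδ => ?_)
  have h5 : √δ ≠ 0 := (Real.sqrt_pos.2 hδ.1).ne'
  have h6 : √((1 - δ) / 2) ≠ 0 := (Real.sqrt_pos.2 (div_pos (by linarith [hδ.2]) two_pos)).ne'
  have h7 : √((1 - δ) / (2 * δ)) = √((1 - δ) / 2) / √δ := by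
    rw [← div_div, Real.sqrt_div (div_nonneg (by linarith [hδ.2]) two_pos.le)]
  simp only [Pi.div_apply, errorBound, leadingTerm, h7, one_div, Real.log_inv]
  field_simp
  ring

/-- For two and three experts the diffusion factors of both bounds agree. -/
theorem kappaUpper_eq_kappaLower {c : ℝ} (h : (N = 2 ∧ c = 1) ∨ (N = 3 ∧ c = 4 / 3)) (δ : ℝ) :
    kappaUpper N δ = kappaLower δ := by
  rcases h with ⟨rfl, -⟩ | ⟨rfl, -⟩
  · simp only [kappaUpper, kappaLower, even_two, if_true]
    push_cast
    ring
  · have : ¬ Even 3 := by decide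
    simp only [kappaUpper, kappaLower, this, if_false]
    push_cast
    ring

theorem mul_sqrt_kappaLower {c : ℝ} (h : (N = 2 ∧ c = 1) ∨ (N = 3 ∧ c = 4 / 3)) (δ : ℝ) :
    ((N : ℝ) - 1) / N * √(kappaLower δ) = leadingTerm c δ := by
  have h4 : kappaLower δ = 2 ^ 2 * ((1 - δ) / (2 * δ)) := by
    unfold kappaLower
    rw [mul_div_assoc, mul_comm 2 δ, ← div_div]
    ring
  rw [h4, Real.sqrt_mul (by norm_num), Real.sqrt_sq (by norm_num), leadingTerm]
  rcases h with ⟨rfl, rfl⟩ | ⟨rfl, rfl⟩ <;> push_cast <;> ring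

theorem isEquivalent_lowerRegretBound {c : ℝ} (h : (N = 2 ∧ c = 1) ∨ (N = 3 ∧ c = 4 / 3)) :
    lowerRegretBound N ~[𝓝[>] 0] leadingTerm c := by
  refine isEquivalent_iff_exists_eq_mul.2 ⟨_, tendsto_exp_mul_erfc, ?_⟩
  refine Eventually.of_forall fun δ => ?_
  rw [Pi.mul_apply, ← mul_sqrt_kappaLower h, mul_comm]
  rfl

theorem isEquivalent_upperRegretBound {c : ℝ} (h : (N = 2 ∧ c = 1) ∨ (N = 3 ∧ c = 4 / 3)) :
    upperRegretBound N ~[𝓝[>] 0] leadingTerm c := by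
  have h2 : Tendsto (fun δ : ℝ => √δ) (𝓝[>] 0) (𝓝 0) := by
    simpa using (Real.continuous_sqrt.tendsto 0).mono_left nhdsWithin_le_nhds
  have h3 := tendsto_exp_mul_erfc.add (h2.const_mul (4 / √Real.pi))
  rw [mul_zero, add_zero] at h3
  refine isEquivalent_iff_exists_eq_mul.2 ⟨_, h3, Eventually.of_forall fun δ => ?_⟩
  rw [Pi.mul_apply, ← mul_sqrt_kappaLower h, mul_comm, upperRegretBound,
    kappaUpper_eq_kappaLower h]

/-- Everything that lies between the lower and the upper regret bound, error terms included, is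
asymptotic to the leading term. -/
theorem isEquivalent_leadingTerm {c : ℝ} (h : (N = 2 ∧ c = 1) ∨ (N = 3 ∧ c = 4 / 3)) {g : ℝ → ℝ}
    (hg : ∀ δ, 0 < δ → δ < 1 → lowerRegretBound N δ - errorBound N δ ≤ g δ ∧
      g δ ≤ upperRegretBound N δ + errorBound N δ) : g ~[𝓝[>] 0] leadingTerm c := by
  have hc : 0 < c := by rcases h with ⟨-, rfl⟩ | ⟨-, rfl⟩ <;> norm_num
  have hev : ∀ᶠ δ : ℝ in 𝓝[>] 0, δ ∈ Set.Ioo (0 : ℝ) 1 := Ioo_mem_nhdsGT one_pos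
  exact isEquivalent_of_le_of_le
    ((isEquivalent_lowerRegretBound h).sub_isLittleO (isLittleO_errorBound N hc))
    ((isEquivalent_upperRegretBound h).add_isLittleO (isLittleO_errorBound N hc))
    (hev.mono fun δ hδ => leadingTerm_pos hc hδ.1 hδ.2)
    (hev.mono fun δ hδ => (hg δ hδ.1 hδ.2).1) (hev.mono fun δ hδ => (hg δ hδ.1 hδ.2).2)

theorem lowerRegretBound_le_geomUpperPotential {c : ℝ}
    (h : (N = 2 ∧ c = 1) ∨ (N = 3 ∧ c = 4 / 3)) {δ : ℝ} (hδ : 0 < δ) (hδ1 : δ < 1) :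
    lowerRegretBound N δ ≤ geomUpperPotential N δ 0 := by
  have hN : 0 < N := by rcases h with ⟨rfl, -⟩ | ⟨rfl, -⟩ <;> norm_num
  rw [geomUpperPotential_zero hN hδ hδ1, kappaUpper_eq_kappaLower h, lowerRegretBound]
  refine mul_le_mul_of_nonneg_left (le_add_of_nonneg_right (by positivity)) ?_
  exact mul_nonneg (sub_one_div_nonneg hN) (Real.sqrt_nonneg _)

end

theorem mainTheorem6 :
    ∃ EL EU : ℕ → ℝ → ℝ,
      (∃ K : ℝ, ∀ N : ℕ, 1 ≤ N → ∀ δ : ℝ, 0 < δ → δ < 1 →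
        0 ≤ EL N δ ∧ EL N δ ≤ K * (N * (1 + Real.log (1 / δ))) ∧
        0 ≤ EU N δ ∧ EU N δ ≤ K * (N * (1 + Real.log (1 / δ)))) ∧
      ∀ N : ℕ, 1 ≤ N →
        (∀ κ : ℝ, 0 < κ → IsClassicalMaxSolution N κ (maxPotential N κ)) ∧
        (∀ δ : ℝ, 0 < δ → δ < 1 →
          Differentiable ℝ (geomUpperPotential N δ) ∧
          (∀ x, (fun i => partialDeriv i (geomUpperPotential N δ) x) ∈ stdSimplex ℝ (Fin N)) ∧
          (∀ x, IsPlayer (markovPlayer (maxPlayer N δ) x)) ∧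
          ∀ b : ℕ, b = 0 ∨ b = 1 →
            (∀ x, playerValue b δ (maxPlayer N δ) x ≤ geomUpperPotential N δ x + EU N δ) ∧
            maxRegret b δ (maxPlayer N δ) ≤ upperRegretBound N δ + EU N δ ∧
            ∀ (s : (Fin N → ℝ) → Fin N) (hs : IsArgmax s),
              (∀ x, IsAdversary (markovAdversary (maxAdversary s hs) x)) ∧
              (∀ x, geomLowerPotential N δ x - EL N δ ≤
                adversaryValue b δ (maxAdversary s hs) x) ∧
              lowerRegretBound N δ - EL N δ ≤ minRegret b δ (maxAdversary s hs)) ∧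
        ∀ c : ℝ, (N = 2 ∧ c = 1) ∨ (N = 3 ∧ c = 4 / 3) →
          (fun δ => geomLowerPotential N δ 0) ~[𝓝[>] 0] leadingTerm c ∧
          (fun δ => geomUpperPotential N δ 0) ~[𝓝[>] 0] leadingTerm c ∧
          (fun δ => lowerRegretBound N δ - EL N δ) ~[𝓝[>] 0] leadingTerm c ∧
          (fun δ => upperRegretBound N δ + EU N δ) ~[𝓝[>] 0] leadingTerm c ∧
          ∀ b : ℕ, b = 0 ∨ b = 1 →
            (∀ (s : (Fin N → ℝ) → Fin N) (hs : IsArgmax s),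
              (fun δ => minRegret b δ (maxAdversary s hs)) ~[𝓝[>] 0] leadingTerm c) ∧
            (fun δ => maxRegret b δ (maxPlayer N δ)) ~[𝓝[>] 0] leadingTerm c ∧
            (fun δ => minimaxRegret N b δ) ~[𝓝[>] 0] leadingTerm c := by
  refine ⟨errorBound, errorBound, ⟨80, fun N hN δ hδ hδ1 => ⟨errorBound_nonneg hN hδ hδ1, le_rfl,
    errorBound_nonneg hN hδ hδ1, le_rfl⟩⟩, fun N hN => ⟨fun κ hκ =>
    isClassicalMaxSolution_maxPotential hN hκ, fun δ hδ hδ1 => ⟨differentiable_maxTransform hN hδ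
    (kappaUpper_pos hN hδ hδ1), partialDeriv_geomUpperPotential_mem hN hδ hδ1,
    isPlayer_maxPlayer hN hδ hδ1, fun b hb => ⟨playerValue_le hN hδ hδ1 hb,
    maxRegret_le hN hδ hδ1 hb, fun s hs => ⟨isAdversary_maxAdversary hs,
    le_adversaryValue hN hδ hδ1 hb hs, le_minRegret hN hδ hδ1 hb hs⟩⟩⟩, fun c hc => ?_⟩⟩
  obtain ⟨s₀, hs₀⟩ := exists_isArgmax hN
  have hlu : ∀ δ, 0 < δ → δ < 1 → lowerRegretBound N δ ≤ geomUpperPotential N δ 0 ∧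
      geomUpperPotential N δ 0 ≤ upperRegretBound N δ ∧ 0 ≤ errorBound N δ := fun δ hδ hδ1 =>
    ⟨lowerRegretBound_le_geomUpperPotential hc hδ hδ1, geomUpperPotential_zero_le hN hδ hδ1,
      errorBound_nonneg hN hδ hδ1⟩
  refine ⟨isEquivalent_leadingTerm hc fun δ hδ hδ1 => ?_,
    isEquivalent_leadingTerm hc fun δ hδ hδ1 => ?_,
    isEquivalent_leadingTerm hc fun δ hδ hδ1 => ?_,
    isEquivalent_leadingTerm hc fun δ hδ hδ1 => ?_,
    fun b hb => ⟨fun s hs => isEquivalent_leadingTerm hc fun δ hδ hδ1 => ?_,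
    isEquivalent_leadingTerm hc fun δ hδ hδ1 => ?_,
    isEquivalent_leadingTerm hc fun δ hδ hδ1 => ?_⟩⟩
  · obtain ⟨h1, h2, h3⟩ := hlu δ hδ hδ1
    rw [geomLowerPotential_zero hN hδ hδ1]
    constructor <;> linarith
  · obtain ⟨h1, h2, h3⟩ := hlu δ hδ hδ1
    constructor <;> linarith
  · obtain ⟨h1, h2, h3⟩ := hlu δ hδ hδ1
    constructor <;> linarith
  · obtain ⟨h1, h2, h3⟩ := hlu δ hδ hδ1
    constructor <;> linarith
  · exact ⟨le_minRegret hN hδ hδ1 hb hs,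
      (minRegret_le_maxRegret hN hδ hδ1 b hs).trans (maxRegret_le hN hδ hδ1 hb)⟩
  · exact ⟨(le_minRegret hN hδ hδ1 hb hs₀).trans (minRegret_le_maxRegret hN hδ hδ1 b hs₀),
      maxRegret_le hN hδ hδ1 hb⟩
  · exact ⟨(le_minRegret hN hδ hδ1 hb hs₀).trans (minRegret_le_minimaxRegret hN hδ hδ1 b hs₀),
      (minimaxRegret_le hN hδ hδ1 b).trans (maxRegret_le hN hδ hδ1 hb)⟩
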